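/- Let $n\ge 1$ and let $\phi$ be a real-valued Schwartz function on $\mathbb{R}^n$ with $\int_{\mathbb{R}^n}\phi\,dx=1$. For $s>0$ put $\phi_s(x)=s^{-n}\phi(x/s)$ and $\Phi_s f=\phi_s*f$. For a sequence $(t_i)_{i\ge 1}$ of positive numbers decreasing (not necessarily strictly) to $0$ define the oscillation operator $$\mathcal{O}_{\{t_i\}}(\{\Phi_s\}_{s>0},f)(x)=\Big(\sum_{i=1}^{\infty}\ \sup_{t_{i+1}\le \varepsilon_{i+1}<\varepsilon_i\le t_i}\big|\Phi_{\varepsilon_i}f(x)-\Phi_{\varepsilon_{i+1}}f(x)\big|^2\Big)^{1/2}\in[0,\infty],$$ where a supremum over the empty set is $0$. For a real-valued $f\in L^1_{\rm loc}(\mathbb{R}^n)$ let $$\|f\|_{\rm BMO}=\sup_B\frac1{|B|}\int_B|f(x)-f_B|\,dx,\qquad \|f\|_{\rm BLO}=\sup_B\frac1{|B|}\int_B\Big[f(x)-\operatorname*{ess\,inf}_{y\in B}f(y)\Big]dx,$$ where $B$ runs over all balls of $\mathbb{R}^n$ and $f_B=\frac1{|B|}\int_B f$; the space BMO (resp. BLO)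 consists of those real-valued $f\in L^1_{\rm loc}(\mathbb{R}^n)$ for which $\|f\|_{\rm BMO}<\infty$ (resp. $\|f\|_{\rm BLO}<\infty$). Then there is a constant $C>0$, depending only on $n$ and $\phi$, such that for every such sequence $(t_i)$ and every $f\in{\rm BMO}(\mathbb{R}^n)$: the integral defining $\Phi_s f(x)$ converges absolutely for all $s>0$ and $x\in\mathbb{R}^n$; $\mathcal{O}_{\{t_i\}}(\{\Phi_s\}_{s>0},f)(x)<\infty$ for almost every $x\in\mathbb{R}^n$; and $\mathcal{O}_{\{t_i\}}(\{\Phi_s\}_{s>0},f)$ belongs to ${\rm BLO}(\mathbb{R}^n)$ with $$\|\mathcal{O}_{\{t_i\}}(\{\Phi_s\}_{s>0},f)\|_{\rm BLO}\le C\|f\|_{\rm BMO}.$$ -/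

import Mathlib

open MeasureTheory Filter Topology
open scoped ENNReal NNReal SchwartzMap

noncomputable section

/-- The dilation `φ_s(x) = s⁻ⁿ φ(x / s)` of a function on `ℝⁿ`. -/
def dilate {n : ℕ} (φ : EuclideanSpace ℝ (Fin n) → ℝ) (s : ℝ) :
    EuclideanSpace ℝ (Fin n) → ℝ :=
  fun x => (s ^ n)⁻¹ * φ (s⁻¹ • x)

/-- The convolution operators `Φ_s f = φ_s * f`. -/
def approxIdentity {n : ℕ} (φ : EuclideanSpace ℝ (Fin n) → ℝ) (s : ℝ)
    (f : EuclideanSpace ℝ (Fin n) → ℝ) : EuclideanSpace ℝ (Fin n) → ℝ :=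
  convolution (dilate φ s) f (ContinuousLinearMap.mul ℝ ℝ) volume

/-- The oscillation operator of a family `T s` (`s > 0`) of operators along a sequence `t`,
`(∑ᵢ sup_{t (i+1) ≤ b < a ≤ t i} |T a f x - T b f x|²)^{1/2}`, with values in `[0, ∞]`. -/
def oscillationOp {n : ℕ}
    (T : ℝ → (EuclideanSpace ℝ (Fin n) → ℝ) → EuclideanSpace ℝ (Fin n) → ℝ)
    (t : ℕ → ℝ) (f : EuclideanSpace ℝ (Fin n) → ℝ) (x : EuclideanSpace ℝ (Fin n)) : ℝ≥0∞ :=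
  (∑' i : ℕ, ⨆ (a : ℝ) (b : ℝ) (_ : t (i + 1) ≤ b ∧ b < a ∧ a ≤ t i),
    ‖T a f x - T b f x‖ₑ ^ 2) ^ (1 / 2 : ℝ)

/-- The `BMO` seminorm `sup_B (1/|B|) ∫_B |f - f_B|`, with values in `[0, ∞]`. -/
def bmoNorm {n : ℕ} (f : EuclideanSpace ℝ (Fin n) → ℝ) : ℝ≥0∞ :=
  ⨆ (c : EuclideanSpace ℝ (Fin n)) (r : ℝ) (_ : 0 < r),
    (volume (Metric.ball c r))⁻¹ * ∫⁻ x in Metric.ball c r, ‖f x - ⨍ y in Metric.ball c r, f y‖ₑ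

/-- Membership in `BMO(ℝⁿ)`. -/
def MemBMO {n : ℕ} (f : EuclideanSpace ℝ (Fin n) → ℝ) : Prop :=
  LocallyIntegrable f volume ∧ bmoNorm f < ∞

/-- The essential infimum of `g` over the ball `B(c, r)`. It is taken in the extended reals, so
that it is `-∞` when `g` is not essentially bounded below on the ball. -/
def ballEssInf {n : ℕ} (g : EuclideanSpace ℝ (Fin n) → ℝ)
    (c : EuclideanSpace ℝ (Fin n)) (r : ℝ) : EReal :=
  essInf (fun y => (g y : EReal)) (volume.restrict (Metric.ball c r))

/-- The `BLO` quantity `sup_B (1/|B|) ∫_B (g - essinf_B g)`, with values in `[0, ∞]`.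
The integrand is nonnegative almost everywhere on `B`, and it is `∞` if the essential infimum
is `-∞`. -/
def bloNorm {n : ℕ} (g : EuclideanSpace ℝ (Fin n) → ℝ) : ℝ≥0∞ :=
  ⨆ (c : EuclideanSpace ℝ (Fin n)) (r : ℝ) (_ : 0 < r),
    (volume (Metric.ball c r))⁻¹ * ∫⁻ x in Metric.ball c r, ((g x : EReal) - ballEssInf g c r).toENNReal

/-- Membership in `BLO(ℝⁿ)`. -/
def MemBLO {n : ℕ} (g : EuclideanSpace ℝ (Fin n) → ℝ) : Prop :=
  LocallyIntegrable g volume ∧ bloNorm g < ∞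

end

/-!
The theorem follows from a comparison of the oscillation at two points of a ball. Let `B` be a ball
of radius `r`, let `2B` be its double, and let `‖f‖` be the `BMO` norm of `f`. For `x, y ∈ B`, with
`f₁ = 1_{2B} (f - f_{2B})` the local part of `f`,

  `O f (x) ≤ O' f₁ (x) + C ‖f‖ + O f (y)`,

where `O'` is the oscillation operator along the truncated scales `min (t i) r`. Taking the
essential infimum in `y` and the mean in `x`, the `BLO` bound is reduced to `∫_B O' f₁ ≤ C ‖f‖ |B|`.

The comparison separates the scales at `r`.

* Below `r` only the nonlocal part `1_{(2B)ᶜ} (f - f_{2B})` has to be estimated. Its points are at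
  distance at least `r` from `x`, so that `|φ_a - φ_b|` is at most `C (a - b) / r` times the weight
  `r / (r + |z - c|)^(n+1)`, against which `|f - f_{2B}|` has integral at most `C ‖f‖`
  (`lintegral_poissonWeight_mul_sub_average_le`).
* Above `r` the increments at `x` and at `y` are compared through the mixed difference of the kernel
  in scale and position (`exists_abs_dilate_sub_sub_le`).

In both cases the error is an increment of a monotone function of the scale with total variation
`C ‖f‖`. Its contribution is bounded in `ℓ¹`, hence in `ℓ²`, uniformly in the sequence `t`
(`scaleOscillation_le`). If `r` is at least all the scales, then the second point is not needed;
this gives finiteness almost everywhere and local integrability.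

The local part is handled by the `L²` bound for the oscillation operator
(`exists_lintegral_oscillation_sq_le`) and the John–Nirenberg inequality in its `L²` form
(`lintegral_sub_average_sq_le`).

For the `L²` bound, consider one block of scales `[t', t]`, with `t' = t (i + 1)` and `t = t i`, and
write `f = g + h` with `g = Φ_{t'} f - Φ_t f`. On the block, the increments of `Φ_s g` are dominated
by the Hardy–Littlewood maximal function of `g`, and the functions `g` of the different blocks have
bounded square sum by Plancherel's theorem. The symbol `1 - φ̂(t' ξ) + φ̂(t ξ)` of `h` is small for
frequencies `ξ` well inside the block, since `φ̂(0) = 1`. The increments of `Φ_s h` are bounded by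
`∫ |∂ₛ Φ_s h| ds` over the block. The Cauchy–Schwarz inequality with the weight `1 / t + t' / s²`,
whose mass is at most `2`, turns this into a square function without a logarithmic loss in `t / t'`,
and the square function is again computed on the Fourier side
(`exists_inv_scaleWeight_mul_le`).
-/

/-! ### The Hardy–Littlewood maximal function -/

section Maximal

variable {E : Type*} [NormedAddCommGroup E] [InnerProductSpace ℝ E] [FiniteDimensional ℝ E]

/-- Vitali's covering lemma, with the fivefold enlargements as open balls. -/
lemma exists_countable_disjoint_balls_covering (S : Set E) (ρ : E → ℝ) (hρ : ∀ x ∈ S, 0 < ρ x)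
    (R : ℝ) (hR : ∀ x ∈ S, ρ x ≤ R) :
    ∃ u ⊆ S, u.Countable ∧ u.PairwiseDisjoint (fun x => Metric.ball x (ρ x)) ∧
      S ⊆ ⋃ x ∈ u, Metric.ball x (5 * ρ x) := by
  obtain ⟨u, huS, hdis, hcov⟩ := Vitali.exists_disjoint_subfamily_covering_enlargement_closedBall
    S id ρ R hR 4 (by norm_num)
  refine ⟨u, huS, ?_, ?_, ?_⟩
  · refine hdis.countable_of_nonempty_interior fun x hx => ?_
    exact ⟨x, Metric.ball_subset_interior_closedBall (Metric.mem_ball_self (hρ x (huS hx)))⟩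
  · exact hdis.mono fun x => Metric.ball_subset_closedBall
  · intro x hx
    obtain ⟨b, hb, hsub⟩ := hcov x hx
    refine Set.mem_iUnion₂.2 ⟨b, hb, ?_⟩
    have h1 : x ∈ Metric.closedBall b (4 * ρ b) :=
      hsub (Metric.mem_closedBall_self (hρ x hx).le)
    refine Metric.closedBall_subset_ball ?_ h1
    have := hρ b (huS hb)
    linarith

variable [MeasurableSpace E] [BorelSpace E]

lemma volume_ball_ne_zero (x : E) {ρ : ℝ} (hρ : 0 < ρ) : volume (Metric.ball x ρ) ≠ 0 :=
  (Metric.measure_ball_pos volume x hρ).ne'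

lemma volume_ball_mul (x y : E) {c ρ : ℝ} (hc : 0 < c) :
    volume (Metric.ball x (c * ρ)) =
      ENNReal.ofReal (c ^ Module.finrank ℝ E) * volume (Metric.ball y ρ) := by
  rw [Measure.addHaar_ball_mul_of_pos volume x hc, Measure.addHaar_ball_center volume y]

/-- The centred Hardy–Littlewood maximal function of a function with values in `[0, ∞]`. -/
noncomputable def ballMaximal (h : E → ℝ≥0∞) (x : E) : ℝ≥0∞ :=
  ⨆ (ρ : ℝ) (_ : 0 < ρ), (volume (Metric.ball x ρ))⁻¹ * ∫⁻ z in Metric.ball x ρ, h z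

lemma ballAverage_le_ballMaximal (h : E → ℝ≥0∞) (x : E) {ρ : ℝ} (hρ : 0 < ρ) :
    (volume (Metric.ball x ρ))⁻¹ * ∫⁻ z in Metric.ball x ρ, h z ≤ ballMaximal h x :=
  le_iSup₂_of_le ρ hρ le_rfl

lemma lt_ballMaximal_iff (h : E → ℝ≥0∞) (x : E) (l : ℝ≥0∞) :
    l < ballMaximal h x ↔
      ∃ ρ : ℝ, 0 < ρ ∧ l * volume (Metric.ball x ρ) < ∫⁻ z in Metric.ball x ρ, h z := by
  simp only [ballMaximal, lt_iSup_iff, exists_prop]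
  refine exists_congr fun ρ => and_congr_right fun hρ => ?_
  rw [mul_comm, ← div_eq_mul_inv, ENNReal.lt_div_iff_mul_lt (Or.inl (volume_ball_ne_zero x hρ))
    (Or.inl measure_ball_lt_top.ne)]

lemma tsum_lintegral_ball_le (h : E → ℝ≥0∞) {u : Set E} (hu : u.Countable) (ρ : E → ℝ)
    (hdis : u.PairwiseDisjoint fun x => Metric.ball x (ρ x)) (T : Set E)
    (hT : ∀ x ∈ u, Metric.ball x (ρ x) ⊆ T) :
    ∑' x : u, ∫⁻ z in Metric.ball (x : E) (ρ x), h z ≤ ∫⁻ z in T, h z := by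
  rw [← lintegral_biUnion hu (fun _ _ => measurableSet_ball) hdis]
  exact lintegral_mono_set (Set.iUnion₂_subset hT)

/-- The weak type `(1,1)` bound for the maximal function. -/
lemma mul_volume_lt_ballMaximal_le [Nontrivial E] (h : E → ℝ≥0∞) (l : ℝ≥0∞) :
    l * volume {x : E | l < ballMaximal h x} ≤
      ENNReal.ofReal (5 ^ Module.finrank ℝ E) * ∫⁻ z, h z := by
  rcases eq_or_ne (∫⁻ z, h z) ∞ with hint | hint
  · rw [hint, ENNReal.mul_top]
    · exact le_top
    · simp
  rcases eq_or_ne l 0 with rfl | hl0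
  · simp
  set S := {x : E | l < ballMaximal h x} with hS
  have hex : ∀ x ∈ S, ∃ ρ : ℝ, 0 < ρ ∧
      l * volume (Metric.ball x ρ) < ∫⁻ z in Metric.ball x ρ, h z :=
    fun x hx => (lt_ballMaximal_iff h x l).1 hx
  choose! ρ hρ0 hρ using hex
  -- the radii are bounded because the volume of the selected balls is
  obtain ⟨R, hR⟩ : ∃ R, ∀ x ∈ S, ρ x ≤ R := by
    have hdpos : 0 < Module.finrank ℝ E := Module.finrank_pos
    have hbase : volume (Metric.ball (0 : E) 1) ≠ 0 := volume_ball_ne_zero 0 one_pos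
    have hfin : (∫⁻ z, h z) / (l * volume (Metric.ball (0 : E) 1)) ≠ ∞ :=
      ENNReal.div_ne_top hint (mul_ne_zero hl0 hbase)
    refine ⟨max 1 ((∫⁻ z, h z) / (l * volume (Metric.ball (0 : E) 1))).toReal, fun x hx => ?_⟩
    rcases le_total (ρ x) 1 with h1 | h1
    · exact le_max_of_le_left h1
    refine le_max_of_le_right ?_
    rw [← ENNReal.ofReal_le_iff_le_toReal hfin,
      ENNReal.le_div_iff_mul_le (Or.inl (mul_ne_zero hl0 hbase)) (Or.inr hint)]
    have h2 := (hρ x hx).le.trans (setLIntegral_le_lintegral _ _)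
    refine le_trans ?_ h2
    have h3 : volume (Metric.ball x (ρ x)) =
        ENNReal.ofReal (ρ x ^ Module.finrank ℝ E) * volume (Metric.ball (0 : E) 1) := by
      simpa using volume_ball_mul x (0 : E) (ρ := 1) (hρ0 x hx)
    rw [h3, mul_left_comm]
    gcongr
    exact le_self_pow₀ h1 hdpos.ne'
  obtain ⟨u, huS, huc, hdis, hcov⟩ := exists_countable_disjoint_balls_covering S ρ hρ0 R hR
  have : Countable u := huc.to_subtype
  calc l * volume S ≤ l * ∑' x : u, volume (Metric.ball (x : E) (5 * ρ x)) := by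
        gcongr
        exact (measure_mono hcov).trans (measure_biUnion_le volume huc _)
    _ = ∑' x : u, ENNReal.ofReal (5 ^ Module.finrank ℝ E) *
          (l * volume (Metric.ball (x : E) (ρ x))) := by
        rw [← ENNReal.tsum_mul_left]
        refine tsum_congr fun x => ?_
        rw [volume_ball_mul (x : E) x (by norm_num), mul_left_comm]
    _ ≤ ∑' x : u, ENNReal.ofReal (5 ^ Module.finrank ℝ E) *
          ∫⁻ z in Metric.ball (x : E) (ρ x), h z := by
        refine ENNReal.tsum_le_tsum fun x => ?_
        gcongr
        exact (hρ x (huS x.2)).le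
    _ ≤ ENNReal.ofReal (5 ^ Module.finrank ℝ E) * ∫⁻ z, h z := by
        rw [ENNReal.tsum_mul_left]
        gcongr
        simpa using tsum_lintegral_ball_le h huc ρ hdis Set.univ (fun _ _ => Set.subset_univ _)

lemma lowerSemicontinuous_lintegral_ball (h : E → ℝ≥0∞) (ρ : ℝ) :
    LowerSemicontinuous fun x : E => ∫⁻ z in Metric.ball x ρ, h z := by
  intro x l hl
  change l < ∫⁻ z in Metric.ball x ρ, h z at hl
  -- exhaust the ball by concentric smaller ones, which stay inside after a small translation
  obtain ⟨m, hm⟩ : ∃ m : ℕ, l < ∫⁻ z in Metric.ball x (ρ - 1 / (m + 1)), h z := by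
    have hunion : Metric.ball x ρ = ⋃ m : ℕ, Metric.ball x (ρ - 1 / (m + 1)) := by
      ext z
      simp only [Metric.mem_ball, Set.mem_iUnion]
      constructor
      · intro hz
        obtain ⟨m, hm⟩ := exists_nat_one_div_lt (sub_pos.2 hz)
        exact ⟨m, by linarith⟩
      · rintro ⟨m, hm⟩
        have : (0 : ℝ) < 1 / (m + 1) := by positivity
        linarith
    have hmono : Monotone fun m : ℕ => Metric.ball x (ρ - 1 / ((m : ℝ) + 1)) := by
      intro a b hab
      apply Metric.ball_subset_ball
      have : (1 : ℝ) / (b + 1) ≤ 1 / (a + 1) := by gcongr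
      linarith
    rw [hunion, setLIntegral_iUnion_of_directed _ hmono.directed_le] at hl
    exact lt_iSup_iff.1 hl
  have hpos : (0 : ℝ) < 1 / (m + 1) := by positivity
  filter_upwards [Metric.ball_mem_nhds x hpos] with y hy
  refine hm.trans_le (lintegral_mono_set (Metric.ball_subset_ball' ?_))
  rw [Metric.mem_ball, dist_comm] at hy
  linarith

lemma measurable_ballMaximal (h : E → ℝ≥0∞) : Measurable (ballMaximal h) := by
  refine LowerSemicontinuous.measurable (lowerSemicontinuous_biSup fun ρ hρ => ?_)
  have hvol : ∀ x : E, (volume (Metric.ball x ρ))⁻¹ = (volume (Metric.ball (0 : E) ρ))⁻¹ :=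
    fun x => by rw [Measure.addHaar_ball_center volume x]
  simp only [hvol]
  have h0 : (volume (Metric.ball (0 : E) ρ))⁻¹ ≠ ∞ :=
    ENNReal.inv_ne_top.2 (volume_ball_ne_zero 0 hρ)
  exact (ENNReal.continuous_const_mul h0).comp_lowerSemicontinuous
    (lowerSemicontinuous_lintegral_ball h ρ) (fun a b hab => mul_le_mul' le_rfl hab)

/-- The layer-cake formula for the square, in the direction needed below. -/
lemma sq_le_lintegral_indicator (a : ℝ≥0∞) :
    a ^ 2 ≤ ∫⁻ l in Set.Ioi (0 : ℝ), {l : ℝ | ENNReal.ofReal l < a}.indicator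
      (fun l => ENNReal.ofReal (2 * l)) l := by
  have key : ∀ K : ℝ≥0, (K : ℝ≥0∞) ≤ a → (K : ℝ≥0∞) ^ 2 ≤
      ∫⁻ l in Set.Ioi (0 : ℝ), {l : ℝ | ENNReal.ofReal l < a}.indicator
        (fun l => ENNReal.ofReal (2 * l)) l := by
    intro K hK
    have h1 : ∫⁻ l in Set.Ioo (0 : ℝ) K, ENNReal.ofReal (2 * l) = (K : ℝ≥0∞) ^ 2 := by
      rw [← ofReal_integral_eq_lintegral_ofReal]
      · rw [← integral_Ioc_eq_integral_Ioo, ← intervalIntegral.integral_of_le K.coe_nonneg,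
          intervalIntegral.integral_const_mul, integral_id]
        rw [← ENNReal.ofReal_coe_nnreal, ← ENNReal.ofReal_pow K.coe_nonneg]
        congr 1
        ring
      · exact ((continuous_const.mul continuous_id).integrableOn_Icc).mono_set
          Set.Ioo_subset_Icc_self
      · filter_upwards [ae_restrict_mem measurableSet_Ioo] with l hl
        have := hl.1
        simp only [Pi.zero_apply]
        positivity
    rw [← h1, ← lintegral_indicator measurableSet_Ioo, ← lintegral_indicator measurableSet_Ioi]
    refine lintegral_mono fun l => ?_
    by_cases hl : l ∈ Set.Ioo (0 : ℝ) K
    · have h2 : ENNReal.ofReal l < a := by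
        refine lt_of_lt_of_le ?_ hK
        rw [← ENNReal.ofReal_coe_nnreal]
        exact (ENNReal.ofReal_lt_ofReal_iff (hl.1.trans hl.2)).2 hl.2
      rw [Set.indicator_of_mem hl, Set.indicator_of_mem (Set.mem_Ioi.2 hl.1),
        Set.indicator_of_mem (Set.mem_ofPred_eq ▸ h2)]
    · rw [Set.indicator_of_notMem hl]
      exact zero_le
  rcases eq_or_ne a ∞ with rfl | ha
  · refine le_of_forall_lt fun c hc => ?_
    have hc' : c ≠ ∞ := (hc.trans_le le_top).ne
    lift c to ℝ≥0 using hc'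
    refine lt_of_lt_of_le ?_ (key (c + 1) le_top)
    norm_cast
    nlinarith [c.2, sq_nonneg c]
  · lift a to ℝ≥0 using ha
    exact key a le_rfl

/-- The Hardy–Littlewood maximal theorem in `L²`. The weak type bound is applied to the part of `h`
above half of the height, and integrated over all heights. -/
theorem lintegral_ballMaximal_sq_le [Nontrivial E] {h : E → ℝ≥0∞} (hm : Measurable h) :
    ∫⁻ x, ballMaximal h x ^ 2 ≤ ENNReal.ofReal (8 * 5 ^ Module.finrank ℝ E) * ∫⁻ x, h x ^ 2 := by
  set K : ℝ≥0∞ := ENNReal.ofReal (5 ^ Module.finrank ℝ E) with hK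
  -- the part of `h` above the height `l / 2`
  set H : ℝ → E → ℝ≥0∞ := fun l => {z | ENNReal.ofReal l < 2 * h z}.indicator h with hH
  have hsplit : ∀ l : ℝ, 0 < l → ∀ x, ENNReal.ofReal l < ballMaximal h x →
      ENNReal.ofReal (l / 2) < ballMaximal (H l) x := by
    intro l hl x hx
    rw [lt_ballMaximal_iff] at hx ⊢
    obtain ⟨ρ, hρ, hlt⟩ := hx
    refine ⟨ρ, hρ, ?_⟩
    have h1 : ∫⁻ z in Metric.ball x ρ, h z ≤
        (∫⁻ z in Metric.ball x ρ, H l z) + ENNReal.ofReal (l / 2) * volume (Metric.ball x ρ) := by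
      rw [← setLIntegral_const, ← lintegral_add_right _ measurable_const]
      refine lintegral_mono fun z => ?_
      by_cases hz : ENNReal.ofReal l < 2 * h z
      · simp only [hH]
        rw [Set.indicator_of_mem (Set.mem_ofPred_eq ▸ hz)]
        exact le_self_add
      · refine le_add_left ?_
        rw [not_lt] at hz
        have : ENNReal.ofReal l = 2 * ENNReal.ofReal (l / 2) := by
          rw [← ENNReal.ofReal_ofNat, ← ENNReal.ofReal_mul (by norm_num)]
          congr 1
          ring
        rw [this] at hz
        exact (ENNReal.mul_le_mul_iff_right (by norm_num) (by norm_num)).1 hz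
    have h2 : ENNReal.ofReal l * volume (Metric.ball x ρ) =
        ENNReal.ofReal (l / 2) * volume (Metric.ball x ρ) +
          ENNReal.ofReal (l / 2) * volume (Metric.ball x ρ) := by
      rw [← add_mul, ← ENNReal.ofReal_add (by positivity) (by positivity), add_halves]
    have h3 : ENNReal.ofReal (l / 2) * volume (Metric.ball x ρ) ≠ ∞ :=
      ENNReal.mul_ne_top ENNReal.ofReal_ne_top measure_ball_lt_top.ne
    rw [h2] at hlt
    exact (ENNReal.add_lt_add_iff_right h3).1 (hlt.trans_le h1)
  have hweak : ∀ l : ℝ, 0 < l →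
      ENNReal.ofReal (2 * l) * volume {x | ENNReal.ofReal l < ballMaximal h x} ≤
        4 * K * ∫⁻ z, H l z := by
    intro l hl
    calc ENNReal.ofReal (2 * l) * volume {x | ENNReal.ofReal l < ballMaximal h x}
        ≤ ENNReal.ofReal (2 * l) * volume {x | ENNReal.ofReal (l / 2) < ballMaximal (H l) x} := by
          exact mul_le_mul' le_rfl (measure_mono fun x hx => hsplit l hl x hx)
      _ = 4 * (ENNReal.ofReal (l / 2) *
            volume {x | ENNReal.ofReal (l / 2) < ballMaximal (H l) x}) := by
          rw [← mul_assoc]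
          congr 1
          rw [← ENNReal.ofReal_ofNat, ← ENNReal.ofReal_mul (by norm_num)]
          congr 1
          ring
      _ ≤ 4 * (K * ∫⁻ z, H l z) := by
          exact mul_le_mul' le_rfl (mul_volume_lt_ballMaximal_le _ _)
      _ = _ := by rw [mul_assoc]
  have hmeas1 : Measurable fun p : E × ℝ =>
      {l : ℝ | ENNReal.ofReal l < ballMaximal h p.1}.indicator
        (fun l => ENNReal.ofReal (2 * l)) p.2 := by
    have : (fun p : E × ℝ => {l : ℝ | ENNReal.ofReal l < ballMaximal h p.1}.indicator
        (fun l => ENNReal.ofReal (2 * l)) p.2) =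
        {p : E × ℝ | ENNReal.ofReal p.2 < ballMaximal h p.1}.indicator
          (fun p => ENNReal.ofReal (2 * p.2)) := rfl
    rw [this]
    refine Measurable.indicator (by fun_prop) (measurableSet_lt (by fun_prop) ?_)
    exact (measurable_ballMaximal h).comp measurable_fst
  have hmeas2 : Measurable fun p : ℝ × E => H p.1 p.2 := by
    have : (fun p : ℝ × E => H p.1 p.2) =
        {p : ℝ × E | ENNReal.ofReal p.1 < 2 * h p.2}.indicator (fun p => h p.2) := rfl
    rw [this]
    refine Measurable.indicator (by fun_prop) (measurableSet_lt (by fun_prop) (by fun_prop))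
  calc ∫⁻ x, ballMaximal h x ^ 2
      ≤ ∫⁻ x, ∫⁻ l in Set.Ioi (0 : ℝ), {l : ℝ | ENNReal.ofReal l < ballMaximal h x}.indicator
          (fun l => ENNReal.ofReal (2 * l)) l :=
        lintegral_mono fun x => sq_le_lintegral_indicator _
    _ = ∫⁻ l in Set.Ioi (0 : ℝ), ∫⁻ x, {l : ℝ | ENNReal.ofReal l < ballMaximal h x}.indicator
          (fun l => ENNReal.ofReal (2 * l)) l := lintegral_lintegral_swap hmeas1.aemeasurable
    _ = ∫⁻ l in Set.Ioi (0 : ℝ),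
          ENNReal.ofReal (2 * l) * volume {x | ENNReal.ofReal l < ballMaximal h x} := by
        refine lintegral_congr fun l => ?_
        have : (fun x : E => {l : ℝ | ENNReal.ofReal l < ballMaximal h x}.indicator
            (fun l => ENNReal.ofReal (2 * l)) l) =
            {x : E | ENNReal.ofReal l < ballMaximal h x}.indicator
              (fun _ => ENNReal.ofReal (2 * l)) := rfl
        rw [this, lintegral_indicator_const (measurableSet_lt measurable_const
          (measurable_ballMaximal h))]
    _ ≤ ∫⁻ l in Set.Ioi (0 : ℝ), 4 * K * ∫⁻ z, H l z :=
        setLIntegral_mono' measurableSet_Ioi fun l hl => hweak l hl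
    _ = 4 * K * ∫⁻ l in Set.Ioi (0 : ℝ), ∫⁻ z, H l z :=
        lintegral_const_mul' _ _ (ENNReal.mul_ne_top (by norm_num) ENNReal.ofReal_ne_top)
    _ = 4 * K * ∫⁻ z, ∫⁻ l in Set.Ioi (0 : ℝ), H l z := by
        rw [lintegral_lintegral_swap hmeas2.aemeasurable]
    _ ≤ 4 * K * ∫⁻ z, 2 * h z ^ 2 := by
        gcongr with z
        have : (fun l : ℝ => H l z) = {l : ℝ | ENNReal.ofReal l < 2 * h z}.indicator
            (fun _ => h z) := rfl
        rw [this, lintegral_indicator_const (measurableSet_lt (by fun_prop) measurable_const)]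
        rcases eq_or_ne (h z) ∞ with hz | hz
        · rw [hz]
          simp
        · rw [Measure.restrict_apply (measurableSet_lt (by fun_prop) measurable_const)]
          have hsub : {l : ℝ | ENNReal.ofReal l < 2 * h z} ∩ Set.Ioi 0 ⊆
              Set.Ioo 0 (2 * h z).toReal := by
            rintro l ⟨hl, hl0⟩
            refine ⟨hl0, ?_⟩
            exact (ENNReal.ofReal_lt_iff_lt_toReal (Set.mem_Ioi.1 hl0).le
              (ENNReal.mul_ne_top (by norm_num) hz)).1 hl
          calc h z * volume ({l : ℝ | ENNReal.ofReal l < 2 * h z} ∩ Set.Ioi 0)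
              ≤ h z * (2 * h z) := by
                gcongr
                refine (measure_mono hsub).trans ?_
                rw [Real.volume_Ioo, sub_zero,
                  ENNReal.ofReal_toReal (ENNReal.mul_ne_top (by norm_num) hz)]
            _ = 2 * h z ^ 2 := by ring
    _ = ENNReal.ofReal (8 * 5 ^ Module.finrank ℝ E) * ∫⁻ x, h x ^ 2 := by
        rw [lintegral_const_mul' _ _ (by norm_num), ENNReal.ofReal_mul (by norm_num), ← hK,
          ENNReal.ofReal_ofNat]
        ring

end Maximal

/-! ### Integrals against a Poisson-type weight -/

section Weight

variable {n : ℕ}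

/-- The weight `r / (r + |u|)^(n+1)` on `ℝⁿ`, comparable with the Poisson kernel at height `r`. -/
noncomputable def poissonWeight (r : ℝ) (u : EuclideanSpace ℝ (Fin n)) : ℝ :=
  r / (r + ‖u‖) ^ (n + 1)

lemma poissonWeight_nonneg {r : ℝ} (hr : 0 < r) (u : EuclideanSpace ℝ (Fin n)) :
    0 ≤ poissonWeight r u := by
  unfold poissonWeight
  positivity

lemma continuous_poissonWeight {r : ℝ} (hr : 0 < r) :
    Continuous (poissonWeight r : EuclideanSpace ℝ (Fin n) → ℝ) := by
  unfold poissonWeight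
  refine continuous_const.div (by fun_prop) fun u => ?_
  positivity

lemma volume_ball_dilate (c c' : EuclideanSpace ℝ (Fin n)) {a r : ℝ} (ha : 0 < a) :
    volume (Metric.ball c (a * r)) = ENNReal.ofReal (a ^ n) * volume (Metric.ball c' r) := by
  have := volume_ball_mul c c' (ρ := r) ha
  rwa [finrank_euclideanSpace_fin] at this

lemma volume_ball_eq (c : EuclideanSpace ℝ (Fin n)) {r : ℝ} (hr : 0 < r) :
    volume (Metric.ball c r) =
      ENNReal.ofReal (r ^ n) * volume (Metric.ball (0 : EuclideanSpace ℝ (Fin n)) 1) := by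
  simpa using volume_ball_dilate c 0 (r := 1) hr

/-- Dyadic decomposition of the weight. -/
lemma ofReal_poissonWeight_le {r : ℝ} (hr : 0 < r) (x z : EuclideanSpace ℝ (Fin n)) :
    ENNReal.ofReal (poissonWeight r (z - x)) ≤ ∑' k : ℕ,
      (Metric.ball x (2 ^ k * r)).indicator
        (fun _ => ENNReal.ofReal (2 ^ (n + 1) * (r ^ n)⁻¹ * ((2 ^ k) ^ (n + 1))⁻¹)) z := by
  -- the term of the least `k` for which the ball of radius `2 ^ k * r` contains `z` suffices
  have hex : ∃ k : ℕ, ‖z - x‖ < 2 ^ k * r := by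
    obtain ⟨k, hk⟩ := pow_unbounded_of_one_lt (‖z - x‖ / r) (one_lt_two : (1 : ℝ) < 2)
    exact ⟨k, (div_lt_iff₀ hr).1 hk⟩
  classical
  obtain ⟨k, hk, hmin⟩ : ∃ k : ℕ, ‖z - x‖ < 2 ^ k * r ∧ ∀ j < k, ¬ ‖z - x‖ < 2 ^ j * r :=
    ⟨Nat.find hex, Nat.find_spec hex, fun j hj => Nat.find_min hex hj⟩
  refine le_trans ?_ (ENNReal.le_tsum k)
  rw [Set.indicator_of_mem (by rwa [Metric.mem_ball, dist_eq_norm])]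
  apply ENNReal.ofReal_le_ofReal
  have hlow : 2 ^ k * r / 2 ≤ r + ‖z - x‖ := by
    cases k with
    | zero =>
      have := norm_nonneg (z - x)
      linarith
    | succ j =>
      have := hmin j (Nat.lt_succ_self j)
      rw [pow_succ]
      linarith
  unfold poissonWeight
  calc r / (r + ‖z - x‖) ^ (n + 1) ≤ r / (2 ^ k * r / 2) ^ (n + 1) := by gcongr
    _ = 2 ^ (n + 1) * (r ^ n)⁻¹ * ((2 ^ k) ^ (n + 1))⁻¹ := by
      rw [div_pow, mul_pow, pow_succ r n]
      field_simp

lemma lintegral_poissonWeight_mul_le {h : EuclideanSpace ℝ (Fin n) → ℝ≥0∞} (hm : AEMeasurable h)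
    {r : ℝ} (hr : 0 < r) (x : EuclideanSpace ℝ (Fin n)) :
    ∫⁻ z, ENNReal.ofReal (poissonWeight r (z - x)) * h z ≤
      ENNReal.ofReal (2 ^ (n + 1)) * volume (Metric.ball (0 : EuclideanSpace ℝ (Fin n)) 1) *
        ∑' k : ℕ, ENNReal.ofReal ((1 / 2) ^ k) * ((volume (Metric.ball x (2 ^ k * r)))⁻¹ *
          ∫⁻ z in Metric.ball x (2 ^ k * r), h z) := by
  calc ∫⁻ z, ENNReal.ofReal (poissonWeight r (z - x)) * h z
      ≤ ∫⁻ z, ∑' k : ℕ, (Metric.ball x (2 ^ k * r)).indicator (fun z =>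
          ENNReal.ofReal (2 ^ (n + 1) * (r ^ n)⁻¹ * ((2 ^ k) ^ (n + 1))⁻¹) * h z) z := by
        refine lintegral_mono fun z => ?_
        refine (mul_le_mul' (ofReal_poissonWeight_le hr x z) le_rfl).trans ?_
        rw [← ENNReal.tsum_mul_right]
        refine ENNReal.tsum_le_tsum fun k => ?_
        by_cases hz : z ∈ Metric.ball x (2 ^ k * r)
        · simp [Set.indicator_of_mem hz]
        · simp [Set.indicator_of_notMem hz]
    _ = ∑' k : ℕ, ENNReal.ofReal (2 ^ (n + 1) * (r ^ n)⁻¹ * ((2 ^ k) ^ (n + 1))⁻¹) *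
          ∫⁻ z in Metric.ball x (2 ^ k * r), h z := by
        rw [lintegral_tsum]
        · refine tsum_congr fun k => ?_
          rw [lintegral_indicator measurableSet_ball, lintegral_const_mul'' _ hm.restrict]
        · exact fun k => (hm.const_mul _).indicator measurableSet_ball
    _ = _ := by
        rw [← ENNReal.tsum_mul_left]
        refine tsum_congr fun k => ?_
        have hv0 := volume_ball_ne_zero (0 : EuclideanSpace ℝ (Fin n)) one_pos
        have hvt : volume (Metric.ball (0 : EuclideanSpace ℝ (Fin n)) 1) ≠ ∞ :=
          measure_ball_lt_top.ne
        rw [volume_ball_eq x (by positivity : 0 < 2 ^ k * r),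
          ENNReal.mul_inv (Or.inr hvt) (Or.inr hv0), ← ENNReal.ofReal_inv_of_pos (by positivity)]
        set v := volume (Metric.ball (0 : EuclideanSpace ℝ (Fin n)) 1)
        set I := ∫⁻ z in Metric.ball x (2 ^ k * r), h z
        calc ENNReal.ofReal (2 ^ (n + 1) * (r ^ n)⁻¹ * ((2 ^ k) ^ (n + 1))⁻¹) * I
            = ENNReal.ofReal (2 ^ (n + 1)) * ENNReal.ofReal ((1 / 2) ^ k) *
                ENNReal.ofReal ((2 ^ k * r) ^ n)⁻¹ * I := by
              rw [← ENNReal.ofReal_mul (by positivity), ← ENNReal.ofReal_mul (by positivity)]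
              congr 2
              rw [mul_pow, pow_succ (2 ^ k : ℝ) n, one_div, inv_pow]
              field_simp
          _ = ENNReal.ofReal (2 ^ (n + 1)) * ENNReal.ofReal ((1 / 2) ^ k) *
                ENNReal.ofReal ((2 ^ k * r) ^ n)⁻¹ * I * (v * v⁻¹) := by
              rw [ENNReal.mul_inv_cancel hv0 hvt, mul_one]
          _ = _ := by ring

lemma tsum_ofReal_geometric_two : ∑' k : ℕ, ENNReal.ofReal ((1 / 2) ^ k) = 2 := by
  rw [← ENNReal.ofReal_tsum_of_nonneg (fun k => by positivity) summable_geometric_two,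
    tsum_geometric_two]
  simp

/-- Poisson-type averages are dominated by the maximal function. -/
lemma lintegral_poissonWeight_mul_le_ballMaximal {h : EuclideanSpace ℝ (Fin n) → ℝ≥0∞}
    (hm : AEMeasurable h) {r : ℝ} (hr : 0 < r) (x : EuclideanSpace ℝ (Fin n)) :
    ∫⁻ z, ENNReal.ofReal (poissonWeight r (z - x)) * h z ≤
      ENNReal.ofReal (2 ^ (n + 1)) * volume (Metric.ball (0 : EuclideanSpace ℝ (Fin n)) 1) * 2 *
        ballMaximal h x := by
  refine (lintegral_poissonWeight_mul_le hm hr x).trans ?_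
  rw [mul_assoc _ 2]
  refine mul_le_mul' le_rfl ?_
  refine le_trans ?_ (mul_le_mul' tsum_ofReal_geometric_two.le le_rfl)
  rw [← ENNReal.tsum_mul_right]
  exact ENNReal.tsum_le_tsum fun k =>
    mul_le_mul' le_rfl (ballAverage_le_ballMaximal h x (by positivity))

lemma lintegral_poissonWeight_lt_top {r : ℝ} (hr : 0 < r) (x : EuclideanSpace ℝ (Fin n)) :
    ∫⁻ z, ENNReal.ofReal (poissonWeight r (z - x)) < ∞ := by
  have h1 := lintegral_poissonWeight_mul_le (h := fun _ => 1) aemeasurable_const hr x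
  simp only [mul_one] at h1
  refine h1.trans_lt ?_
  have h2 : ∀ k : ℕ, (volume (Metric.ball x (2 ^ k * r)))⁻¹ *
      ∫⁻ _ in Metric.ball x (2 ^ k * r), 1 = 1 := fun k => by
    rw [setLIntegral_one, ENNReal.inv_mul_cancel (volume_ball_ne_zero x (by positivity))
      measure_ball_lt_top.ne]
  simp only [h2, mul_one, tsum_ofReal_geometric_two]
  exact ENNReal.mul_lt_top (ENNReal.mul_lt_top ENNReal.ofReal_lt_top measure_ball_lt_top)
    (by norm_num)

end Weight

/-! ### Functions of bounded mean oscillation -/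

section BMO

variable {n : ℕ} {f : EuclideanSpace ℝ (Fin n) → ℝ} {N : ℝ}

lemma lintegral_sub_average_le_of_bmoNorm_le (hN : bmoNorm f ≤ ENNReal.ofReal N)
    (c : EuclideanSpace ℝ (Fin n)) {r : ℝ} (hr : 0 < r) :
    ∫⁻ x in Metric.ball c r, ‖f x - ⨍ y in Metric.ball c r, f y‖ₑ ≤
      ENNReal.ofReal N * volume (Metric.ball c r) := by
  have h1 : (volume (Metric.ball c r))⁻¹ *
      ∫⁻ x in Metric.ball c r, ‖f x - ⨍ y in Metric.ball c r, f y‖ₑ ≤ ENNReal.ofReal N :=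
    le_trans (by
      unfold bmoNorm
      exact le_iSup₂_of_le c r (le_iSup (fun _ : 0 < r => (volume (Metric.ball c r))⁻¹ *
        ∫⁻ x in Metric.ball c r, ‖f x - ⨍ y in Metric.ball c r, f y‖ₑ) hr)) hN
  rwa [ENNReal.inv_mul_le_iff (volume_ball_ne_zero c hr) measure_ball_lt_top.ne, mul_comm] at h1

lemma integrableOn_ball_of_locallyIntegrable (hf : LocallyIntegrable f)
    (c : EuclideanSpace ℝ (Fin n)) (r : ℝ) : IntegrableOn f (Metric.ball c r) :=
  (hf.integrableOn_isCompact (isCompact_closedBall c r)).mono_set Metric.ball_subset_closedBall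

/-- The mean of `f` over a ball differs from a constant by at most the mean of `|f - m|`. -/
lemma enorm_average_sub_mul_volume_le (hf : LocallyIntegrable f)
    (c : EuclideanSpace ℝ (Fin n)) {r : ℝ} (hr : 0 < r) (m : ℝ) :
    ‖(⨍ y in Metric.ball c r, f y) - m‖ₑ * volume (Metric.ball c r) ≤
      ∫⁻ x in Metric.ball c r, ‖f x - m‖ₑ := by
  have hfi := integrableOn_ball_of_locallyIntegrable hf c r
  have hv0 := volume_ball_ne_zero c hr
  have hvt : volume (Metric.ball c r) ≠ ∞ := measure_ball_lt_top.ne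
  have : ∫ x in Metric.ball c r, (f x - m) =
      volume.real (Metric.ball c r) * ((⨍ y in Metric.ball c r, f y) - m) := by
    rw [integral_sub hfi (integrableOn_const hvt), setIntegral_const, setAverage_eq, smul_eq_mul,
      smul_eq_mul]
    have : volume.real (Metric.ball c r) ≠ 0 := (ENNReal.toReal_ne_zero.2 ⟨hv0, hvt⟩)
    field_simp
  calc ‖(⨍ y in Metric.ball c r, f y) - m‖ₑ * volume (Metric.ball c r)
      = ‖∫ x in Metric.ball c r, (f x - m)‖ₑ := by
        rw [this, enorm_mul, mul_comm]
        congr 1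
        rw [Measure.real, Real.enorm_eq_ofReal ENNReal.toReal_nonneg, ENNReal.ofReal_toReal hvt]
    _ ≤ _ := enorm_integral_le_lintegral_enorm _

lemma enorm_average_sub_average_mul_volume_le (hf : LocallyIntegrable f)
    (hN : bmoNorm f ≤ ENNReal.ofReal N) {c c' : EuclideanSpace ℝ (Fin n)} {r r' : ℝ} (hr : 0 < r)
    (hr' : 0 < r') (hsub : Metric.ball c' r' ⊆ Metric.ball c r) :
    ‖(⨍ y in Metric.ball c' r', f y) - ⨍ y in Metric.ball c r, f y‖ₑ *
      volume (Metric.ball c' r') ≤ ENNReal.ofReal N * volume (Metric.ball c r) :=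
  (enorm_average_sub_mul_volume_le hf c' hr' _).trans
    ((lintegral_mono_set hsub).trans (lintegral_sub_average_le_of_bmoNorm_le hN c hr))

lemma enorm_average_two_mul_sub_le (hf : LocallyIntegrable f)
    (hN : bmoNorm f ≤ ENNReal.ofReal N) (c : EuclideanSpace ℝ (Fin n)) {r : ℝ} (hr : 0 < r) :
    ‖(⨍ y in Metric.ball c r, f y) - ⨍ y in Metric.ball c (2 * r), f y‖ₑ ≤
      ENNReal.ofReal (2 ^ n) * ENNReal.ofReal N := by
  have h := enorm_average_sub_average_mul_volume_le hf hN (by positivity : 0 < 2 * r) hr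
    (Metric.ball_subset_ball (x := c) (by linarith : r ≤ 2 * r))
  rw [volume_ball_dilate c c two_pos, ← mul_assoc] at h
  rw [mul_comm (ENNReal.ofReal (2 ^ n))]
  exact (ENNReal.mul_le_mul_iff_left (volume_ball_ne_zero c hr) measure_ball_lt_top.ne).1 h

lemma enorm_average_two_pow_mul_sub_le (hf : LocallyIntegrable f)
    (hN : bmoNorm f ≤ ENNReal.ofReal N) (c : EuclideanSpace ℝ (Fin n)) {r : ℝ} (hr : 0 < r)
    (k : ℕ) :
    ‖(⨍ y in Metric.ball c (2 ^ k * r), f y) - ⨍ y in Metric.ball c r, f y‖ₑ ≤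
      k * (ENNReal.ofReal (2 ^ n) * ENNReal.ofReal N) := by
  induction k with
  | zero => simp
  | succ k ih =>
    have h := enorm_average_two_mul_sub_le hf hN c (by positivity : 0 < 2 ^ k * r)
    rw [← mul_assoc, ← pow_succ'] at h
    push_cast
    rw [add_mul, one_mul]
    refine le_trans ?_ (add_le_add ih h)
    rw [← enorm_neg (_ - ⨍ y in Metric.ball c (2 ^ (k + 1) * r), f y), neg_sub]
    refine le_trans (le_of_eq ?_) (enorm_add_le _ _)
    congr 1
    abel

/-- The mean over `2ᵏ B` of `|f - f_B|` grows at most linearly in `k`. -/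
lemma lintegral_two_pow_mul_ball_sub_average_le (hf : LocallyIntegrable f)
    (hN : bmoNorm f ≤ ENNReal.ofReal N) (c : EuclideanSpace ℝ (Fin n)) {r : ℝ} (hr : 0 < r)
    (k : ℕ) :
    ∫⁻ x in Metric.ball c (2 ^ k * r), ‖f x - ⨍ y in Metric.ball c r, f y‖ₑ ≤
      volume (Metric.ball c (2 ^ k * r)) *
        ((1 + k * ENNReal.ofReal (2 ^ n)) * ENNReal.ofReal N) := by
  calc ∫⁻ x in Metric.ball c (2 ^ k * r), ‖f x - ⨍ y in Metric.ball c r, f y‖ₑ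
      ≤ ∫⁻ x in Metric.ball c (2 ^ k * r), (‖f x - ⨍ y in Metric.ball c (2 ^ k * r), f y‖ₑ +
          k * (ENNReal.ofReal (2 ^ n) * ENNReal.ofReal N)) := by
        refine lintegral_mono fun x => ?_
        refine le_trans ?_ (add_le_add le_rfl (enorm_average_two_pow_mul_sub_le hf hN c hr k))
        refine le_trans (le_of_eq ?_) (enorm_add_le _ _)
        congr 1
        ring
    _ = (∫⁻ x in Metric.ball c (2 ^ k * r), ‖f x - ⨍ y in Metric.ball c (2 ^ k * r), f y‖ₑ) +
          k * (ENNReal.ofReal (2 ^ n) * ENNReal.ofReal N) *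
            volume (Metric.ball c (2 ^ k * r)) := by
        rw [lintegral_add_right _ measurable_const, setLIntegral_const]
    _ ≤ ENNReal.ofReal N * volume (Metric.ball c (2 ^ k * r)) +
          k * (ENNReal.ofReal (2 ^ n) * ENNReal.ofReal N) *
            volume (Metric.ball c (2 ^ k * r)) := by
        gcongr
        exact lintegral_sub_average_le_of_bmoNorm_le hN c (by positivity)
    _ = _ := by ring

/-- The constant in the Poisson-type tail estimate for functions of bounded mean oscillation. -/
noncomputable def bmoTailConst (n : ℕ) : ℝ≥0 :=
  (2 ^ (n + 1) * (volume (Metric.ball (0 : EuclideanSpace ℝ (Fin n)) 1)).toNNReal) *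
    (2 + 2 * 2 ^ n)

/-- The Poisson-type mean of `|f - f_B|` is bounded by the mean oscillation of `f`. -/
theorem lintegral_poissonWeight_mul_sub_average_le (hf : LocallyIntegrable f)
    (hN : bmoNorm f ≤ ENNReal.ofReal N) (c : EuclideanSpace ℝ (Fin n)) {r : ℝ} (hr : 0 < r) :
    ∫⁻ z, ENNReal.ofReal (poissonWeight r (z - c)) * ‖f z - ⨍ y in Metric.ball c r, f y‖ₑ ≤
      bmoTailConst n * ENNReal.ofReal N := by
  have hm : AEMeasurable fun z => ‖f z - ⨍ y in Metric.ball c r, f y‖ₑ :=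
    (hf.aestronglyMeasurable.sub aestronglyMeasurable_const).enorm
  refine (lintegral_poissonWeight_mul_le hm hr c).trans ?_
  have hsum : ∑' k : ℕ, ENNReal.ofReal ((1 / 2) ^ k) * (1 + k * ENNReal.ofReal (2 ^ n)) =
      2 + 2 * ENNReal.ofReal (2 ^ n) := by
    have h2 : ∑' k : ℕ, ENNReal.ofReal ((1 / 2) ^ k) * (k : ℝ≥0∞) = 2 := by
      have h3 : HasSum (fun k : ℕ => (k : ℝ) * (1 / 2) ^ k) 2 := by
        have := hasSum_coe_mul_geometric_of_norm_lt_one (r := (1 / 2 : ℝ)) (by norm_num)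
        norm_num at this ⊢
        exact this
      have h4 : ∀ k : ℕ, ENNReal.ofReal ((1 / 2) ^ k) * (k : ℝ≥0∞) =
          ENNReal.ofReal ((k : ℝ) * (1 / 2) ^ k) := fun k => by
        rw [mul_comm, ENNReal.ofReal_mul (by positivity), ENNReal.ofReal_natCast]
      simp only [h4]
      rw [← ENNReal.ofReal_tsum_of_nonneg (fun k => by positivity) h3.summable, h3.tsum_eq]
      simp
    simp only [mul_add, mul_one, ← mul_assoc]
    rw [ENNReal.tsum_add, ENNReal.tsum_mul_right, h2, tsum_ofReal_geometric_two]
  have hterm : ∀ k : ℕ, ENNReal.ofReal ((1 / 2) ^ k) * ((volume (Metric.ball c (2 ^ k * r)))⁻¹ *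
      ∫⁻ z in Metric.ball c (2 ^ k * r), ‖f z - ⨍ y in Metric.ball c r, f y‖ₑ) ≤
      ENNReal.ofReal ((1 / 2) ^ k) * (1 + k * ENNReal.ofReal (2 ^ n)) * ENNReal.ofReal N := by
    intro k
    rw [mul_assoc]
    refine mul_le_mul' le_rfl ?_
    rw [ENNReal.inv_mul_le_iff (volume_ball_ne_zero c (by positivity)) measure_ball_lt_top.ne]
    exact lintegral_two_pow_mul_ball_sub_average_le hf hN c hr k
  refine (mul_le_mul' le_rfl (ENNReal.tsum_le_tsum hterm)).trans (le_of_eq ?_)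
  rw [ENNReal.tsum_mul_right, hsum, ← mul_assoc]
  congr 1
  have hvt : volume (Metric.ball (0 : EuclideanSpace ℝ (Fin n)) 1) ≠ ∞ := measure_ball_lt_top.ne
  unfold bmoTailConst
  push_cast
  rw [ENNReal.coe_toNNReal hvt, ENNReal.ofReal_pow (by norm_num), ENNReal.ofReal_pow (by norm_num),
    ENNReal.ofReal_ofNat]

end BMO

/-! ### The John–Nirenberg inequality -/

lemma ennreal_add_sq_le (a b : ℝ≥0∞) : (a + b) ^ 2 ≤ 2 * a ^ 2 + 2 * b ^ 2 := by
  rcases eq_or_ne a ∞ with rfl | ha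
  · simp
  rcases eq_or_ne b ∞ with rfl | hb
  · simp
  lift a to ℝ≥0 using ha
  lift b to ℝ≥0 using hb
  norm_cast
  rw [← mul_add]
  exact add_sq_le

section JohnNirenberg

variable {n : ℕ} {f : EuclideanSpace ℝ (Fin n) → ℝ} {N : ℝ}

/-- Lebesgue differentiation: at almost every point, a bound for the means over all small balls is
a bound for the function. -/
lemma ae_enorm_le_of_ball_means_le {g : EuclideanSpace ℝ (Fin n) → ℝ} (hg : LocallyIntegrable g)
    {l : ℝ} (hl : 0 ≤ l) :
    ∀ᵐ x, ∀ r : ℝ, 0 < r → (∀ s : ℝ, 0 < s → s ≤ r → ∫⁻ z in Metric.ball x s, ‖g z‖ₑ ≤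
      ENNReal.ofReal l * volume (Metric.ball x s)) → ‖g x‖ₑ ≤ ENNReal.ofReal l := by
  have hgn : LocallyIntegrable (fun z => ‖g z‖) := fun x => (hg x).norm
  filter_upwards [IsUnifLocDoublingMeasure.ae_tendsto_average volume hgn 1] with x hx r hr hmean
  have hδ : Tendsto (fun j : ℕ => r / ((j : ℝ) + 1)) atTop (𝓝[>] 0) := by
    refine tendsto_nhdsWithin_iff.2 ⟨?_, Eventually.of_forall fun j => ?_⟩
    · simpa [div_eq_mul_inv] using (tendsto_one_div_add_atTop_nhds_zero_nat (𝕜 := ℝ)).const_mul r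
    · exact Set.mem_Ioi.2 (by positivity)
  have hlim := hx (fun _ : ℕ => x) _ hδ
    (Eventually.of_forall fun j => Metric.mem_closedBall_self (by positivity))
  have hle : ‖g x‖ ≤ l := by
    refine le_of_tendsto hlim (Eventually.of_forall fun j => ?_)
    have hs : 0 < r / ((j : ℝ) + 1) := by positivity
    have hsr : r / ((j : ℝ) + 1) ≤ r :=
      div_le_self hr.le (by linarith [(Nat.cast_nonneg j : (0 : ℝ) ≤ j)])
    set s := r / ((j : ℝ) + 1)
    have hint : IntegrableOn g (Metric.ball x s) := integrableOn_ball_of_locallyIntegrable hg x s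
    have hvt : volume (Metric.ball x s) ≠ ∞ := measure_ball_lt_top.ne
    have hvc : volume (Metric.closedBall x s) = volume (Metric.ball x s) := by
      rw [Measure.addHaar_closedBall volume x hs.le, Measure.addHaar_ball_of_pos volume x hs]
    have hae : (Metric.ball x s : Set (EuclideanSpace ℝ (Fin n))) =ᵐ[volume]
        Metric.closedBall x s :=
      ae_eq_of_subset_of_measure_ge Metric.ball_subset_closedBall hvc.le
        measurableSet_ball.nullMeasurableSet (hvc ▸ hvt)
    rw [← setAverage_congr hae, setAverage_eq, smul_eq_mul]
    have hv : 0 < volume.real (Metric.ball x s) :=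
      ENNReal.toReal_pos (volume_ball_ne_zero x hs) hvt
    rw [inv_mul_le_iff₀ hv]
    have h2 := hmean s hs hsr
    rw [← ofReal_integral_norm_eq_lintegral_enorm hint] at h2
    rw [← ENNReal.ofReal_le_ofReal_iff (by positivity), ENNReal.ofReal_mul hv.le,
      Measure.real, ENNReal.ofReal_toReal hvt, mul_comm]
    exact h2
  rw [← ofReal_norm]
  exact ENNReal.ofReal_le_ofReal hle

/-- The height at which the mean oscillation is stopped. -/
noncomputable def stoppingHeight (n : ℕ) (N : ℝ) : ℝ := 8 * 40 ^ n * N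

/-- One step of the self-improvement of a bound `A` for the truncated mean square oscillation over
all balls. On a ball `B`, the points where `|f - f_B|` exceeds the stopping height are covered by
balls whose fivefold enlargements have total volume at most `|B| / 4`, and over each of which
`|f - f_B|` has mean at most the stopping height; on them the bound `A` is used again. -/
lemma lintegral_min_sq_le_of_forall_le (hf : LocallyIntegrable f) (hN0 : 0 < N)
    (hN : bmoNorm f ≤ ENNReal.ofReal N) (K : ℝ≥0∞) (A : ℝ≥0∞)
    (hA : ∀ (c : EuclideanSpace ℝ (Fin n)) (r : ℝ), 0 < r →
      ∫⁻ x in Metric.ball c r, min ‖f x - ⨍ y in Metric.ball c r, f y‖ₑ K ^ 2 ≤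
        A * volume (Metric.ball c r))
    (c : EuclideanSpace ℝ (Fin n)) {r : ℝ} (hr : 0 < r) :
    ∫⁻ x in Metric.ball c r, min ‖f x - ⨍ y in Metric.ball c r, f y‖ₑ K ^ 2 ≤
      (2 * ENNReal.ofReal (stoppingHeight n N) ^ 2 + A / 2) * volume (Metric.ball c r) := by
  set m := ⨍ y in Metric.ball c r, f y with hm
  set u : EuclideanSpace ℝ (Fin n) → ℝ≥0∞ := fun z => ‖f z - m‖ₑ with hu
  set l := ENNReal.ofReal (stoppingHeight n N) with hl
  have hlpos : 0 < stoppingHeight n N := by unfold stoppingHeight; positivity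
  have hl0 : l ≠ 0 := (ENNReal.ofReal_pos.2 hlpos).ne'
  have hlt : l ≠ ∞ := ENNReal.ofReal_ne_top
  have hgi : LocallyIntegrable fun z => f z - m := hf.sub (locallyIntegrable_const m)
  -- the mean of `u` over the double of the ball
  have hdouble : ∫⁻ z in Metric.ball c (2 * r), u z ≤
      volume (Metric.ball c (2 * r)) * ENNReal.ofReal ((1 + 2 ^ n) * N) := by
    have := lintegral_two_pow_mul_ball_sub_average_le hf hN c hr 1
    rw [pow_one, Nat.cast_one, one_mul] at this
    rw [ENNReal.ofReal_mul (by positivity), ENNReal.ofReal_add (by positivity) (by positivity),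
      ENNReal.ofReal_one]
    exact this
  have hsub : ∀ x ∈ Metric.ball c r, ∀ s ≤ r, Metric.ball x s ⊆ Metric.ball c (2 * r) := by
    intro x hx s hs
    refine Metric.ball_subset_ball' ?_
    rw [Metric.mem_ball] at hx
    linarith
  -- balls with large mean are much smaller than the given ball
  have hsmall : ∀ x ∈ Metric.ball c r, ∀ s ≤ r,
      l * volume (Metric.ball x s) < ∫⁻ z in Metric.ball x s, u z → s ≤ r / 10 := by
    intro x hx s hs hlts
    by_contra! hcon
    have h1 := hlts.trans_le ((lintegral_mono_set (hsub x hx s hs)).trans hdouble)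
    have h2 : volume (Metric.ball c (2 * r)) =
        ENNReal.ofReal (20 ^ n) * volume (Metric.ball x (r / 10)) := by
      rw [← volume_ball_dilate c x (by norm_num)]
      congr 2
      ring
    have h3 : volume (Metric.ball x (r / 10)) ≤ volume (Metric.ball x s) :=
      measure_mono (Metric.ball_subset_ball hcon.le)
    refine absurd h1 (not_lt.2 ?_)
    calc volume (Metric.ball c (2 * r)) * ENNReal.ofReal ((1 + 2 ^ n) * N)
        = ENNReal.ofReal (20 ^ n * ((1 + 2 ^ n) * N)) * volume (Metric.ball x (r / 10)) := by
          rw [h2, ENNReal.ofReal_mul (p := 20 ^ n) (by positivity)]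
          ring
      _ ≤ l * volume (Metric.ball x s) := by
          refine mul_le_mul' (ENNReal.ofReal_le_ofReal ?_) h3
          unfold stoppingHeight
          have h4 : (20 : ℝ) ^ n * 2 ^ n = 40 ^ n := by rw [← mul_pow]; norm_num
          have h5 : (20 : ℝ) ^ n ≤ 40 ^ n := by gcongr; norm_num
          have h6 : (20 : ℝ) ^ n * (1 + 2 ^ n) ≤ 8 * 40 ^ n := by
            have : (0 : ℝ) < 40 ^ n := by positivity
            nlinarith
          calc (20 : ℝ) ^ n * ((1 + 2 ^ n) * N) = 20 ^ n * (1 + 2 ^ n) * N := by ring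
            _ ≤ 8 * 40 ^ n * N := by gcongr
  -- the set where some mean is large, and an almost maximal radius at each of its points
  set S := {x ∈ Metric.ball c r | ∃ s : ℝ, 0 < s ∧ s ≤ r ∧
    l * volume (Metric.ball x s) < ∫⁻ z in Metric.ball x s, u z} with hS
  have hrad : ∀ x ∈ S, ∃ s : ℝ, 0 < s ∧ s ≤ r ∧
      l * volume (Metric.ball x s) < ∫⁻ z in Metric.ball x s, u z ∧
      ∫⁻ z in Metric.ball x (5 * s), u z ≤ l * volume (Metric.ball x (5 * s)) := by
    rintro x ⟨hx, s, hs0, hsr, hs⟩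
    by_contra! hcon
    have hall : ∀ k : ℕ, 5 ^ k * s ≤ r ∧ l * volume (Metric.ball x (5 ^ k * s)) <
        ∫⁻ z in Metric.ball x (5 ^ k * s), u z := by
      intro k
      induction k with
      | zero => simpa using ⟨hsr, hs⟩
      | succ k ih =>
        have h1 := hcon _ (by positivity) ih.1 ih.2
        have h2 := hsmall x hx _ ih.1 ih.2
        rw [← mul_assoc, ← pow_succ'] at h1
        refine ⟨?_, h1⟩
        rw [pow_succ']
        linarith
    obtain ⟨k, hk⟩ := pow_unbounded_of_one_lt (r / s) (by norm_num : (1 : ℝ) < 5)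
    have := (hall k).1
    rw [div_lt_iff₀ hs0] at hk
    linarith
  choose! ρ hρ0 hρr hρ hρ5 using hrad
  obtain ⟨T, hTS, hTc, hdis, hcov⟩ := exists_countable_disjoint_balls_covering S ρ hρ0 r hρr
  have hTcount : Countable T := hTc.to_subtype
  -- the enlarged balls have small total volume
  have hvol : ∑' x : T, volume (Metric.ball (x : EuclideanSpace ℝ (Fin n)) (5 * ρ x)) ≤
      volume (Metric.ball c r) / 4 := by
    have h1 : l * ∑' x : T, volume (Metric.ball (x : EuclideanSpace ℝ (Fin n)) (5 * ρ x)) ≤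
        l * (volume (Metric.ball c r) / 4) := by
      calc l * ∑' x : T, volume (Metric.ball (x : EuclideanSpace ℝ (Fin n)) (5 * ρ x))
          = ENNReal.ofReal (5 ^ n) * ∑' x : T,
              l * volume (Metric.ball (x : EuclideanSpace ℝ (Fin n)) (ρ x)) := by
            rw [← ENNReal.tsum_mul_left, ← ENNReal.tsum_mul_left]
            refine tsum_congr fun x => ?_
            rw [volume_ball_dilate (x : EuclideanSpace ℝ (Fin n)) x (by norm_num)]
            ring
        _ ≤ ENNReal.ofReal (5 ^ n) * ∑' x : T,
              ∫⁻ z in Metric.ball (x : EuclideanSpace ℝ (Fin n)) (ρ x), u z := by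
            refine mul_le_mul' le_rfl (ENNReal.tsum_le_tsum fun x => (hρ x (hTS x.2)).le)
        _ ≤ ENNReal.ofReal (5 ^ n) *
              (volume (Metric.ball c (2 * r)) * ENNReal.ofReal ((1 + 2 ^ n) * N)) := by
            refine mul_le_mul' le_rfl (le_trans ?_ hdouble)
            exact tsum_lintegral_ball_le u hTc ρ hdis _
              fun x hx => hsub x (hTS hx).1 _ (hρr x (hTS hx))
        _ = ENNReal.ofReal (4 * (5 ^ n * (2 ^ n * ((1 + 2 ^ n) * N)))) *
              (volume (Metric.ball c r) / 4) := by
            rw [volume_ball_dilate c c two_pos, ENNReal.ofReal_mul (p := 4) (by norm_num),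
              ENNReal.ofReal_mul (p := 5 ^ n) (by positivity),
              ENNReal.ofReal_mul (p := 2 ^ n) (by positivity),
              ENNReal.ofReal_ofNat, div_eq_mul_inv]
            have : (4 : ℝ≥0∞) * 4⁻¹ = 1 := ENNReal.mul_inv_cancel (by norm_num) (by norm_num)
            calc _ = ENNReal.ofReal (5 ^ n) * (ENNReal.ofReal (2 ^ n) * volume (Metric.ball c r) *
                  ENNReal.ofReal ((1 + 2 ^ n) * N)) * (4 * 4⁻¹) := by rw [this, mul_one]
              _ = _ := by ring
        _ ≤ l * (volume (Metric.ball c r) / 4) := by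
            refine mul_le_mul' (ENNReal.ofReal_le_ofReal ?_) le_rfl
            unfold stoppingHeight
            have h4 : (5 : ℝ) ^ n * 2 ^ n = 10 ^ n := by rw [← mul_pow]; norm_num
            have h5 : (10 : ℝ) ^ n * 2 ^ n = 20 ^ n := by rw [← mul_pow]; norm_num
            have h6 : (10 : ℝ) ^ n ≤ 40 ^ n := by gcongr; norm_num
            have h7 : (20 : ℝ) ^ n ≤ 40 ^ n := by gcongr; norm_num
            calc 4 * ((5 : ℝ) ^ n * (2 ^ n * ((1 + 2 ^ n) * N)))
                = 4 * (5 ^ n * 2 ^ n * (1 + 2 ^ n)) * N := by ring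
              _ = 4 * (10 ^ n + 20 ^ n) * N := by rw [h4, mul_add, h5, mul_one]
              _ ≤ 8 * 40 ^ n * N := mul_le_mul_of_nonneg_right (by linarith) hN0.le
    exact (ENNReal.mul_le_mul_iff_right hl0 hlt).1 h1
  -- on each enlarged ball the hypothesis applies
  have hballs : ∀ x ∈ T, ∫⁻ z in Metric.ball x (5 * ρ x), min (u z) K ^ 2 ≤
      (2 * A + 2 * l ^ 2) * volume (Metric.ball x (5 * ρ x)) := by
    intro x hx
    have hs : 0 < 5 * ρ x := by linarith [hρ0 x (hTS hx)]
    set D := Metric.ball x (5 * ρ x)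
    have hmean : ‖(⨍ y in D, f y) - m‖ₑ ≤ l := by
      have h1 := (enorm_average_sub_mul_volume_le hf x hs m).trans (hρ5 x (hTS hx))
      exact (ENNReal.mul_le_mul_iff_left (volume_ball_ne_zero x hs) measure_ball_lt_top.ne).1 h1
    calc ∫⁻ z in D, min (u z) K ^ 2
        ≤ ∫⁻ z in D, (2 * min ‖f z - ⨍ y in D, f y‖ₑ K ^ 2 + 2 * l ^ 2) := by
          refine lintegral_mono fun z => ?_
          have h1 : u z ≤ ‖f z - ⨍ y in D, f y‖ₑ + l := by
            refine le_trans ?_ (add_le_add le_rfl hmean)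
            refine le_trans (le_of_eq ?_) (enorm_add_le _ _)
            simp only [hu]
            congr 1
            ring
          have h2 : min (u z) K ≤ min ‖f z - ⨍ y in D, f y‖ₑ K + l := by
            rw [← min_add_add_right]
            exact min_le_min h1 le_self_add
          refine (pow_le_pow_left' h2 2).trans ?_
          exact ennreal_add_sq_le _ _
      _ = 2 * (∫⁻ z in D, min ‖f z - ⨍ y in D, f y‖ₑ K ^ 2) + 2 * l ^ 2 * volume D := by
          rw [lintegral_add_right _ measurable_const, setLIntegral_const,
            lintegral_const_mul' _ _ (by norm_num)]
      _ ≤ 2 * (A * volume D) + 2 * l ^ 2 * volume D := by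
          gcongr
          exact hA x _ hs
      _ = (2 * A + 2 * l ^ 2) * volume D := by ring
  -- off the enlarged balls `u` is bounded by the stopping height
  have hpt : ∀ᵐ z ∂(volume.restrict (Metric.ball c r)), min (u z) K ^ 2 ≤ l ^ 2 +
      ∑' x : T, (Metric.ball (x : EuclideanSpace ℝ (Fin n)) (5 * ρ x)).indicator
        (fun z => min (u z) K ^ 2) z := by
    filter_upwards [ae_restrict_mem measurableSet_ball,
      ae_restrict_of_ae (ae_enorm_le_of_ball_means_le hgi hlpos.le)] with z hz hleb
    by_cases hzS : z ∈ S
    · obtain ⟨x, hx, hzx⟩ := Set.mem_iUnion₂.1 (hcov hzS)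
      refine le_add_left (le_trans (le_of_eq ?_) (ENNReal.le_tsum ⟨x, hx⟩))
      rw [Set.indicator_of_mem hzx]
    · refine le_add_right (pow_le_pow_left' ((min_le_left _ _).trans ?_) 2)
      refine hleb r hr fun s hs0 hsr => ?_
      by_contra! hcon
      exact hzS ⟨hz, s, hs0, hsr, hcon⟩
  have hmeas : AEMeasurable (fun z => min (u z) K ^ 2) :=
    ((hgi.aestronglyMeasurable.enorm).min aemeasurable_const).pow_const 2
  calc ∫⁻ z in Metric.ball c r, min (u z) K ^ 2
      ≤ ∫⁻ z in Metric.ball c r, (l ^ 2 +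
          ∑' x : T, (Metric.ball (x : EuclideanSpace ℝ (Fin n)) (5 * ρ x)).indicator
            (fun z => min (u z) K ^ 2) z) := lintegral_mono_ae hpt
    _ = l ^ 2 * volume (Metric.ball c r) + ∑' x : T, ∫⁻ z in Metric.ball c r,
          (Metric.ball (x : EuclideanSpace ℝ (Fin n)) (5 * ρ x)).indicator
            (fun z => min (u z) K ^ 2) z := by
        rw [lintegral_add_left measurable_const, setLIntegral_const, lintegral_tsum]
        exact fun x => (hmeas.indicator measurableSet_ball).restrict
    _ ≤ l ^ 2 * volume (Metric.ball c r) + ∑' x : T, (2 * A + 2 * l ^ 2) *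
          volume (Metric.ball (x : EuclideanSpace ℝ (Fin n)) (5 * ρ x)) := by
        gcongr with x
        refine (setLIntegral_le_lintegral _ _).trans ?_
        rw [lintegral_indicator measurableSet_ball]
        exact hballs x x.2
    _ ≤ l ^ 2 * volume (Metric.ball c r) + (2 * A + 2 * l ^ 2) *
          (volume (Metric.ball c r) / 4) := by
        rw [ENNReal.tsum_mul_left]
        gcongr
    _ ≤ (2 * l ^ 2 + A / 2) * volume (Metric.ball c r) := by
        have h1 : (2 : ℝ≥0∞) * 4⁻¹ = 2⁻¹ := by
          rw [show (4 : ℝ≥0∞) = 2 * 2 by norm_num, ENNReal.mul_inv (by norm_num) (by norm_num),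
            ← mul_assoc, ENNReal.mul_inv_cancel (by norm_num) (by norm_num), one_mul]
        have h2 : (2 * A + 2 * l ^ 2) * (volume (Metric.ball c r) / 4) =
            (A / 2 + l ^ 2 * 2⁻¹) * volume (Metric.ball c r) := by
          rw [div_eq_mul_inv, div_eq_mul_inv, ← h1]
          ring
        rw [h2, ← add_mul]
        refine mul_le_mul' ?_ le_rfl
        have h3 : l ^ 2 * 2⁻¹ ≤ l ^ 2 := mul_le_of_le_one_right' (by norm_num)
        calc l ^ 2 + (A / 2 + l ^ 2 * 2⁻¹) ≤ l ^ 2 + (A / 2 + l ^ 2) := by gcongr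
          _ = 2 * l ^ 2 + A / 2 := by ring

/-- The `L²` form of the John–Nirenberg inequality. -/
theorem lintegral_sub_average_sq_le (hf : LocallyIntegrable f) (hN0 : 0 < N)
    (hN : bmoNorm f ≤ ENNReal.ofReal N) (c : EuclideanSpace ℝ (Fin n)) {r : ℝ} (hr : 0 < r) :
    ∫⁻ x in Metric.ball c r, ‖f x - ⨍ y in Metric.ball c r, f y‖ₑ ^ 2 ≤
      4 * ENNReal.ofReal (stoppingHeight n N) ^ 2 * volume (Metric.ball c r) := by
  set l := ENNReal.ofReal (stoppingHeight n N)
  have htrunc : ∀ K : ℕ, ∫⁻ x in Metric.ball c r,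
      min ‖f x - ⨍ y in Metric.ball c r, f y‖ₑ K ^ 2 ≤ 4 * l ^ 2 * volume (Metric.ball c r) := by
    intro K
    -- the best constant for the truncated problem is finite, so it can be absorbed
    set A : ℝ≥0∞ := ⨆ (c : EuclideanSpace ℝ (Fin n)) (r : {r : ℝ // 0 < r}),
      (volume (Metric.ball c r))⁻¹ *
        ∫⁻ x in Metric.ball c r, min ‖f x - ⨍ y in Metric.ball c r, f y‖ₑ K ^ 2 with hA
    have hle : ∀ (c : EuclideanSpace ℝ (Fin n)) (r : ℝ), 0 < r →
        ∫⁻ x in Metric.ball c r, min ‖f x - ⨍ y in Metric.ball c r, f y‖ₑ K ^ 2 ≤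
          A * volume (Metric.ball c r) := by
      intro c r hr
      rw [mul_comm, ← ENNReal.inv_mul_le_iff (volume_ball_ne_zero c hr) measure_ball_lt_top.ne]
      exact le_iSup₂_of_le c ⟨r, hr⟩ le_rfl
    have hAt : A ≠ ∞ := by
      refine ((iSup₂_le fun c r => ?_).trans_lt
        (ENNReal.pow_lt_top (ENNReal.natCast_lt_top K) (n := 2))).ne
      rw [ENNReal.inv_mul_le_iff (volume_ball_ne_zero c r.2) measure_ball_lt_top.ne]
      calc ∫⁻ x in Metric.ball c r, min ‖f x - ⨍ y in Metric.ball c r, f y‖ₑ K ^ 2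
          ≤ ∫⁻ _ in Metric.ball c r, (K : ℝ≥0∞) ^ 2 :=
            lintegral_mono fun x => pow_le_pow_left' (min_le_right _ _) 2
        _ = _ := by rw [setLIntegral_const, mul_comm]
    have hself : A ≤ 2 * l ^ 2 + A / 2 := by
      refine iSup₂_le fun c r => ?_
      rw [ENNReal.inv_mul_le_iff (volume_ball_ne_zero c r.2) measure_ball_lt_top.ne, mul_comm]
      exact lintegral_min_sq_le_of_forall_le hf hN0 hN K A hle c r.2
    have hfinal : A ≤ 4 * l ^ 2 := by
      have h1 : A / 2 + A / 2 ≤ 2 * l ^ 2 + A / 2 := by rwa [ENNReal.add_halves]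
      have h2 : A / 2 ≤ 2 * l ^ 2 :=
        (ENNReal.add_le_add_iff_right (ENNReal.div_ne_top hAt (by norm_num))).1 h1
      rw [ENNReal.div_le_iff (by norm_num) (by norm_num)] at h2
      refine h2.trans (le_of_eq (by ring))
    exact (hle c r hr).trans (mul_le_mul' hfinal le_rfl)
  have hsup : ∀ a : ℝ≥0∞, a ≠ ∞ → a ^ 2 ≤ ⨆ K : ℕ, min a K ^ 2 := by
    intro a ha
    obtain ⟨K, hK⟩ := ENNReal.exists_nat_gt ha
    refine le_iSup_of_le K ?_
    rw [min_eq_left hK.le]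
  have hm : AEMeasurable fun z => ‖f z - ⨍ y in Metric.ball c r, f y‖ₑ :=
    (hf.aestronglyMeasurable.sub aestronglyMeasurable_const).enorm
  calc ∫⁻ x in Metric.ball c r, ‖f x - ⨍ y in Metric.ball c r, f y‖ₑ ^ 2
      ≤ ∫⁻ x in Metric.ball c r, ⨆ K : ℕ, min ‖f x - ⨍ y in Metric.ball c r, f y‖ₑ K ^ 2 :=
        lintegral_mono fun x => hsup _ enorm_ne_top
    _ = ⨆ K : ℕ, ∫⁻ x in Metric.ball c r, min ‖f x - ⨍ y in Metric.ball c r, f y‖ₑ K ^ 2 := by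
        refine lintegral_iSup' (fun K => ((hm.min aemeasurable_const).pow_const 2).restrict)
          (Eventually.of_forall fun x a b hab => ?_)
        refine pow_le_pow_left' (min_le_min le_rfl ?_) 2
        exact_mod_cast hab
    _ ≤ _ := iSup_le htrunc

end JohnNirenberg

/-! ### Estimates for the dilates of a Schwartz function -/

section Kernel

lemma SchwartzMap.exists_norm_le_div_one_add_pow {E F : Type*} [NormedAddCommGroup E]
    [NormedSpace ℝ E] [NormedAddCommGroup F] [NormedSpace ℝ F] (φ : 𝓢(E, F)) (k : ℕ) :
    ∃ C : ℝ, 0 < C ∧ ∀ v, ‖φ v‖ ≤ C / (1 + ‖v‖) ^ k := by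
  set S := 2 ^ k * (Finset.Iic (k, 0)).sup (fun m => SchwartzMap.seminorm ℝ m.1 m.2) φ
  have hS : 0 ≤ S := mul_nonneg (by positivity) (apply_nonneg _ _)
  refine ⟨S + 1, by linarith, fun v => ?_⟩
  rw [le_div_iff₀ (by positivity), mul_comm]
  have := SchwartzMap.one_add_le_sup_seminorm_apply (𝕜 := ℝ) (m := (k, 0)) (k := k) (n := 0)
    le_rfl le_rfl φ v
  rw [norm_iteratedFDeriv_zero] at this
  linarith

variable {n : ℕ} (φ : 𝓢(EuclideanSpace ℝ (Fin n), ℝ))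

lemma one_add_norm_inv_smul {s : ℝ} (hs : 0 < s) (u : EuclideanSpace ℝ (Fin n)) :
    1 + ‖s⁻¹ • u‖ = (s + ‖u‖) / s := by
  rw [norm_smul, Real.norm_of_nonneg (by positivity)]
  field_simp

lemma exists_abs_dilate_le : ∃ C : ℝ, 0 < C ∧ ∀ (s : ℝ), 0 < s → ∀ u,
    |dilate φ s u| ≤ C * poissonWeight s u := by
  obtain ⟨C, hC, h⟩ := φ.exists_norm_le_div_one_add_pow (n + 1)
  refine ⟨C, hC, fun s hs u => ?_⟩
  have h1 := h (s⁻¹ • u)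
  rw [one_add_norm_inv_smul hs, Real.norm_eq_abs] at h1
  unfold dilate poissonWeight
  rw [abs_mul, abs_of_pos (by positivity : 0 < (s ^ n)⁻¹)]
  calc (s ^ n)⁻¹ * |φ (s⁻¹ • u)| ≤ (s ^ n)⁻¹ * (C / ((s + ‖u‖) / s) ^ (n + 1)) := by gcongr
    _ = C * (s / (s + ‖u‖) ^ (n + 1)) := by
      have : s + ‖u‖ ≠ 0 := by positivity
      rw [div_pow, pow_succ s n]
      field_simp

lemma continuous_dilate (s : ℝ) : Continuous (dilate φ s) := by
  unfold dilate
  exact continuous_const.mul (φ.continuous.comp (continuous_const_smul _))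

lemma integral_dilate {s : ℝ} (hs : 0 < s) : ∫ x, dilate φ s x = ∫ x, φ x := by
  unfold dilate
  rw [integral_const_mul, Measure.integral_comp_smul, finrank_euclideanSpace_fin, smul_eq_mul,
    inv_pow, inv_inv, abs_of_pos (by positivity), ← mul_assoc, inv_mul_cancel₀ (by positivity),
    one_mul]

lemma integrable_dilate {s : ℝ} (hs : 0 < s) : Integrable (dilate φ s) := by
  unfold dilate
  exact (φ.integrable.comp_smul (inv_ne_zero hs.ne')).const_mul _

/-- The function `ψ = n φ + x · ∇φ`, which generates the dilations: `∂ₛ φ_s = - s⁻¹ ψ_s`. -/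
lemma exists_schwartzMap_dilation_generator :
    ∃ ψ : 𝓢(EuclideanSpace ℝ (Fin n), ℝ), ∀ v, ψ v = n * φ v + fderiv ℝ φ v v := by
  refine ⟨(n : ℝ) • φ + SchwartzMap.bilinLeftCLM (ContinuousLinearMap.id ℝ _)
    (Function.HasTemperateGrowth.id' (E := EuclideanSpace ℝ (Fin n)))
    (SchwartzMap.fderivCLM ℝ _ ℝ φ), fun v => ?_⟩
  simp

variable {φ} in
lemma hasDerivAt_dilate {ψ : 𝓢(EuclideanSpace ℝ (Fin n), ℝ)}
    (hψ : ∀ v, ψ v = n * φ v + fderiv ℝ φ v v) {s : ℝ} (hs : 0 < s)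
    (u : EuclideanSpace ℝ (Fin n)) :
    HasDerivAt (fun s => dilate φ s u) (-((s ^ (n + 1))⁻¹ * ψ (s⁻¹ • u))) s := by
  have h1 : HasDerivAt (fun s : ℝ => (s ^ n)⁻¹) (-(n * s ^ (n - 1)) / (s ^ n) ^ 2) s :=
    (hasDerivAt_pow n s).fun_inv (by positivity)
  have h2 : HasDerivAt (fun s : ℝ => s⁻¹ • u) ((-(s ^ 2)⁻¹) • u) s :=
    (hasDerivAt_inv hs.ne').smul_const u
  have h3 : HasDerivAt (fun s : ℝ => φ (s⁻¹ • u)) (fderiv ℝ φ (s⁻¹ • u) ((-(s ^ 2)⁻¹) • u)) s :=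
    (φ.hasFDerivAt (s⁻¹ • u)).comp_hasDerivAt s h2
  refine (h1.mul h3).congr_deriv ?_
  rw [hψ, ContinuousLinearMap.map_smul, ContinuousLinearMap.map_smul, smul_eq_mul, smul_eq_mul]
  rcases n with _ | k
  · field_simp
    simp
    ring
  · rw [Nat.add_sub_cancel]
    field_simp
    push_cast
    ring

lemma exists_abs_dilate_sub_dilate_le : ∃ C : ℝ, 0 < C ∧ ∀ a b : ℝ, 0 < b → b ≤ a → ∀ u,
    |dilate φ a u - dilate φ b u| ≤ C * (a - b) / (b + ‖u‖) ^ (n + 1) := by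
  obtain ⟨ψ, hψ⟩ := exists_schwartzMap_dilation_generator φ
  obtain ⟨C, hC, h⟩ := ψ.exists_norm_le_div_one_add_pow (n + 1)
  refine ⟨C, hC, fun a b hb hab u => ?_⟩
  have key : ∀ s ∈ Set.Icc b a, ‖-((s ^ (n + 1))⁻¹ * ψ (s⁻¹ • u))‖ ≤
      C / (b + ‖u‖) ^ (n + 1) := by
    intro s hs
    have hs0 : 0 < s := hb.trans_le hs.1
    have h1 := h (s⁻¹ • u)
    rw [one_add_norm_inv_smul hs0] at h1
    rw [norm_neg, norm_mul, Real.norm_of_nonneg (by positivity)]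
    calc (s ^ (n + 1))⁻¹ * ‖ψ (s⁻¹ • u)‖
        ≤ (s ^ (n + 1))⁻¹ * (C / ((s + ‖u‖) / s) ^ (n + 1)) := by gcongr
      _ = C / (s + ‖u‖) ^ (n + 1) := by
        have : s + ‖u‖ ≠ 0 := by positivity
        rw [div_pow]
        field_simp
      _ ≤ C / (b + ‖u‖) ^ (n + 1) := by
        gcongr
        exact hs.1
  have := (convex_Icc b a).norm_image_sub_le_of_norm_hasDerivWithin_le
    (f := fun s => dilate φ s u) (fun s hs => (hasDerivAt_dilate hψ (hb.trans_le hs.1)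
      u).hasDerivWithinAt) key (Set.left_mem_Icc.2 hab) (Set.right_mem_Icc.2 hab)
  rw [Real.norm_eq_abs, Real.norm_of_nonneg (sub_nonneg.2 hab)] at this
  refine this.trans (le_of_eq ?_)
  ring

lemma SchwartzMap.exists_norm_sub_le_div_one_add_pow {E F : Type*} [NormedAddCommGroup E]
    [NormedSpace ℝ E] [NormedAddCommGroup F] [NormedSpace ℝ F] (ψ : 𝓢(E, F)) (k : ℕ) :
    ∃ C : ℝ, 0 < C ∧ ∀ v v', ‖v - v'‖ ≤ 2 → ‖ψ v - ψ v'‖ ≤ C * ‖v - v'‖ / (1 + ‖v‖) ^ k := by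
  obtain ⟨C, hC, h⟩ := (SchwartzMap.fderivCLM ℝ E F ψ).exists_norm_le_div_one_add_pow k
  refine ⟨C * 3 ^ k, by positivity, fun v v' hv => ?_⟩
  have key : ∀ w ∈ segment ℝ v' v, ‖fderiv ℝ ψ w‖ ≤ C * 3 ^ k / (1 + ‖v‖) ^ k := by
    intro w hw
    have h1 := h w
    rw [SchwartzMap.fderivCLM_apply] at h1
    refine h1.trans ?_
    have h2 : ‖v - w‖ ≤ 2 := by
      have := norm_sub_le_of_mem_segment (segment_symm ℝ v' v ▸ hw)
      rw [norm_sub_rev, norm_sub_rev v' v] at this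
      exact this.trans hv
    have h3 : (1 + ‖v‖) / 3 ≤ 1 + ‖w‖ := by
      have := norm_add_le (v - w) w
      rw [sub_add_cancel] at this
      have := norm_nonneg w
      linarith
    calc C / (1 + ‖w‖) ^ k ≤ C / ((1 + ‖v‖) / 3) ^ k := by gcongr
      _ = C * 3 ^ k / (1 + ‖v‖) ^ k := by
        rw [div_pow]
        field_simp
  have := (convex_segment v' v).norm_image_sub_le_of_norm_fderiv_le
    (fun w _ => ψ.differentiableAt) key (left_mem_segment ℝ v' v) (right_mem_segment ℝ v' v)
  refine this.trans (le_of_eq ?_)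
  ring

/-- The mixed difference of the kernel in scale and position. The bound is a difference of values
of one function of the scale, so that its sum over consecutive scales telescopes. -/
lemma exists_abs_dilate_sub_sub_le : ∃ C : ℝ, 0 < C ∧ ∀ r a b : ℝ, 0 < r → r ≤ b → b ≤ a →
    ∀ u u', ‖u - u'‖ ≤ 2 * r →
      |(dilate φ a u - dilate φ b u) - (dilate φ a u' - dilate φ b u')| ≤
        C * (r / (b + ‖u‖) ^ (n + 1) - r / (a + ‖u‖) ^ (n + 1)) := by
  obtain ⟨ψ, hψ⟩ := exists_schwartzMap_dilation_generator φ
  obtain ⟨C, hC, h⟩ := ψ.exists_norm_sub_le_div_one_add_pow (n + 2)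
  refine ⟨2 * C, by positivity, fun r a b hr hrb hba u u' hu => ?_⟩
  set g : ℝ → ℝ := fun s => (dilate φ s u - dilate φ b u) - (dilate φ s u' - dilate φ b u') with hg
  set g' : ℝ → ℝ := fun s => -((s ^ (n + 1))⁻¹ * ψ (s⁻¹ • u)) - -((s ^ (n + 1))⁻¹ * ψ (s⁻¹ • u'))
  set B : ℝ → ℝ := fun s => 2 * C * (r / (b + ‖u‖) ^ (n + 1) - r / (s + ‖u‖) ^ (n + 1)) with hB
  set B' : ℝ → ℝ := fun s => 2 * C * (r * (n + 1) / (s + ‖u‖) ^ (n + 2))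
  have hpos : ∀ s, b ≤ s → 0 < s := fun s hs => (hr.trans_le hrb).trans_le hs
  have hgd : ∀ s, b ≤ s → HasDerivAt g (g' s) s := fun s hs =>
    ((hasDerivAt_dilate hψ (hpos s hs) u).sub_const _).sub
      ((hasDerivAt_dilate hψ (hpos s hs) u').sub_const _)
  have hBd : ∀ s, b ≤ s → HasDerivAt B (B' s) s := by
    intro s hs
    have hs0 := hpos s hs
    have h0 : s + ‖u‖ ≠ 0 := by positivity
    have h1 : HasDerivAt (fun s : ℝ => (s + ‖u‖) ^ (n + 1))
        (((n + 1 : ℕ) : ℝ) * (s + ‖u‖) ^ n * 1) s :=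
      ((hasDerivAt_id s).add_const _).pow (n + 1)
    have h2 := ((hasDerivAt_const s r).fun_div h1 (by positivity)).const_sub
      (r / (b + ‖u‖) ^ (n + 1))
    refine (h2.const_mul (2 * C)).congr_deriv ?_
    simp only [B']
    push_cast
    field_simp
    ring
  have hbound : ∀ s, b ≤ s → ‖g' s‖ ≤ B' s := by
    intro s hs
    have hs0 := hpos s hs
    have h0 : 0 < s + ‖u‖ := by positivity
    have h1 : s⁻¹ • u - s⁻¹ • u' = s⁻¹ • (u - u') := by rw [smul_sub]
    have h2 : ‖s⁻¹ • u - s⁻¹ • u'‖ ≤ s⁻¹ * (2 * r) := by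
      rw [h1, norm_smul, Real.norm_of_nonneg (by positivity)]
      gcongr
    have h3 : s⁻¹ * (2 * r) ≤ 2 := by
      rw [inv_mul_le_iff₀ hs0]
      linarith
    have h4 := h _ _ (h2.trans h3)
    rw [one_add_norm_inv_smul hs0] at h4
    have h5 : g' s = -((s ^ (n + 1))⁻¹ * (ψ (s⁻¹ • u) - ψ (s⁻¹ • u'))) := by
      simp only [g']
      ring
    rw [h5, norm_neg, norm_mul, Real.norm_of_nonneg (by positivity)]
    calc (s ^ (n + 1))⁻¹ * ‖ψ (s⁻¹ • u) - ψ (s⁻¹ • u')‖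
        ≤ (s ^ (n + 1))⁻¹ * (C * (s⁻¹ * (2 * r)) / ((s + ‖u‖) / s) ^ (n + 2)) := by
          refine mul_le_mul_of_nonneg_left (h4.trans ?_) (by positivity)
          gcongr
      _ = 2 * C * (r * 1 / (s + ‖u‖) ^ (n + 2)) := by
          rw [div_pow, pow_succ s (n + 1)]
          field_simp
      _ ≤ 2 * C * (r * (n + 1) / (s + ‖u‖) ^ (n + 2)) := by
          gcongr
          linarith [(Nat.cast_nonneg n : (0 : ℝ) ≤ n)]
  have := image_norm_le_of_norm_deriv_right_le_deriv_boundary' (f := g) (f' := g') (a := b) (b := a)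
    (B := B) (B' := B') (fun s hs => (hgd s hs.1).continuousAt.continuousWithinAt)
    (fun s hs => (hgd s hs.1).hasDerivWithinAt) (by simp [hg, hB])
    (fun s hs => (hBd s hs.1).continuousAt.continuousWithinAt)
    (fun s hs => (hBd s hs.1).hasDerivWithinAt) (fun s hs => hbound s hs.1)
    (Set.right_mem_Icc.2 hba)
  exact this

end Kernel

/-! ### The approximate identity on functions of moderate growth -/

section ApproxIdentity

variable {n : ℕ}

/-- Local integrability together with integrability against all the weights
`r / (r + |z - c|)^(n+1)`. Convolutions with Schwartz functions make sense for such functions. -/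
structure PoissonIntegrable (f : EuclideanSpace ℝ (Fin n) → ℝ) : Prop where
  locallyIntegrable : LocallyIntegrable f
  integrable_mul : ∀ (r : ℝ), 0 < r → ∀ c, Integrable fun z => poissonWeight r (z - c) * f z

lemma integrable_poissonWeight {r : ℝ} (hr : 0 < r) (c : EuclideanSpace ℝ (Fin n)) :
    Integrable fun z => poissonWeight r (z - c) := by
  refine ⟨((continuous_poissonWeight hr).comp (by fun_prop)).aestronglyMeasurable, ?_⟩
  refine (lintegral_mono fun z => ?_).trans_lt (lintegral_poissonWeight_lt_top hr c)
  rw [Real.enorm_of_nonneg (poissonWeight_nonneg hr _)]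

lemma poissonWeight_le {r : ℝ} (hr : 0 < r) (u : EuclideanSpace ℝ (Fin n)) :
    poissonWeight r u ≤ (r ^ n)⁻¹ := by
  unfold poissonWeight
  calc r / (r + ‖u‖) ^ (n + 1) ≤ r / r ^ (n + 1) := by
        gcongr
        linarith [norm_nonneg u]
    _ = (r ^ n)⁻¹ := by
        rw [pow_succ]
        field_simp

lemma poissonWeight_sub_comm (r : ℝ) (u v : EuclideanSpace ℝ (Fin n)) :
    poissonWeight r (u - v) = poissonWeight r (v - u) := by
  unfold poissonWeight
  rw [norm_sub_rev]

lemma MeasureTheory.Integrable.poissonIntegrable {f : EuclideanSpace ℝ (Fin n) → ℝ}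
    (hf : Integrable f) : PoissonIntegrable f := by
  refine ⟨hf.locallyIntegrable, fun r hr c => hf.bdd_mul (c := (r ^ n)⁻¹)
    ((continuous_poissonWeight hr).comp (by fun_prop)).aestronglyMeasurable
    (Eventually.of_forall fun z => ?_)⟩
  rw [Real.norm_of_nonneg (poissonWeight_nonneg hr _)]
  exact poissonWeight_le hr _

lemma poissonIntegrable_const (m : ℝ) :
    PoissonIntegrable (fun _ : EuclideanSpace ℝ (Fin n) => m) :=
  ⟨locallyIntegrable_const m, fun _ hr c => (integrable_poissonWeight hr c).mul_const m⟩

lemma PoissonIntegrable.sub {f g : EuclideanSpace ℝ (Fin n) → ℝ} (hf : PoissonIntegrable f)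
    (hg : PoissonIntegrable g) : PoissonIntegrable (fun x => f x - g x) := by
  refine ⟨hf.1.sub hg.1, fun r hr c => ?_⟩
  simp only [mul_sub]
  exact (hf.2 r hr c).sub (hg.2 r hr c)

lemma PoissonIntegrable.indicator {f : EuclideanSpace ℝ (Fin n) → ℝ} (hf : PoissonIntegrable f)
    {s : Set (EuclideanSpace ℝ (Fin n))} (hs : MeasurableSet s) :
    PoissonIntegrable (s.indicator f) := by
  refine ⟨hf.1.indicator hs, fun r hr c => ?_⟩
  refine ((hf.2 r hr c).indicator hs).congr (Eventually.of_forall fun z => ?_)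
  by_cases hz : z ∈ s <;> simp [hz]

lemma poissonIntegrable_of_bmoNorm_le {f : EuclideanSpace ℝ (Fin n) → ℝ} {N : ℝ}
    (hf : LocallyIntegrable f) (hN : bmoNorm f ≤ ENNReal.ofReal N) : PoissonIntegrable f := by
  refine ⟨hf, fun r hr c => ?_⟩
  set m := ⨍ y in Metric.ball c r, f y
  have hw : Continuous fun z : EuclideanSpace ℝ (Fin n) => poissonWeight r (z - c) :=
    (continuous_poissonWeight hr).comp (by fun_prop)
  have h1 : Integrable fun z => poissonWeight r (z - c) * (f z - m) := by
    refine ⟨hw.aestronglyMeasurable.mul (hf.aestronglyMeasurable.sub aestronglyMeasurable_const),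
      ?_⟩
    refine lt_of_le_of_lt (lintegral_mono fun z => ?_)
      ((lintegral_poissonWeight_mul_sub_average_le hf hN c hr).trans_lt
        (ENNReal.mul_lt_top ENNReal.coe_lt_top ENNReal.ofReal_lt_top))
    rw [enorm_mul, Real.enorm_of_nonneg (poissonWeight_nonneg hr _)]
  refine (h1.add ((integrable_poissonWeight hr c).mul_const m)).congr
    (Eventually.of_forall fun z => ?_)
  simp only [Pi.add_apply]
  ring

variable (φ : 𝓢(EuclideanSpace ℝ (Fin n), ℝ)) {f g : EuclideanSpace ℝ (Fin n) → ℝ}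

lemma integrable_dilate_mul (hf : PoissonIntegrable f) {s : ℝ} (hs : 0 < s)
    (x : EuclideanSpace ℝ (Fin n)) : Integrable fun z => dilate φ s (x - z) * f z := by
  obtain ⟨C, hC, h⟩ := exists_abs_dilate_le φ
  refine ((hf.2 s hs x).const_mul C).mono
    (((continuous_dilate φ s).comp (by fun_prop)).aestronglyMeasurable.mul
      hf.1.aestronglyMeasurable) (Eventually.of_forall fun z => ?_)
  rw [norm_mul, norm_mul, norm_mul, Real.norm_of_nonneg hC.le,
    Real.norm_of_nonneg (poissonWeight_nonneg hs _), ← mul_assoc]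
  refine mul_le_mul_of_nonneg_right ?_ (norm_nonneg _)
  rw [poissonWeight_sub_comm]
  exact h s hs (x - z)

lemma convolutionExists_dilate (hf : PoissonIntegrable f) {s : ℝ} (hs : 0 < s) :
    ConvolutionExists (dilate φ s) f (ContinuousLinearMap.mul ℝ ℝ) volume := by
  intro x
  rw [convolutionExistsAt_iff_integrable_swap]
  exact integrable_dilate_mul φ hf hs x

lemma approxIdentity_eq_integral (s : ℝ) (f : EuclideanSpace ℝ (Fin n) → ℝ)
    (x : EuclideanSpace ℝ (Fin n)) :
    approxIdentity φ s f x = ∫ z, dilate φ s (x - z) * f z := by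
  unfold approxIdentity
  rw [convolution_eq_swap]
  rfl

lemma continuous_approxIdentity (hf : PoissonIntegrable f) {s : ℝ} (hs : 0 < s) :
    Continuous (approxIdentity φ s f) := by
  obtain ⟨C, hC, h⟩ := exists_abs_dilate_le φ
  have heq : approxIdentity φ s f = fun x => ∫ z, dilate φ s (x - z) * f z :=
    funext fun x => approxIdentity_eq_integral φ s f x
  rw [heq, continuous_iff_continuousAt]
  intro x
  -- for `y` within distance `s` of `x`, the weights centred at `x` and `y` are comparable
  refine continuousAt_of_dominated
    (bound := fun z => C * 2 ^ (n + 1) * ‖poissonWeight s (z - x) * f z‖)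
    (Eventually.of_forall fun y => (integrable_dilate_mul φ hf hs y).aestronglyMeasurable) ?_
    ((hf.2 s hs x).norm.const_mul _) ?_
  · filter_upwards [Metric.ball_mem_nhds x hs] with y hy
    refine Eventually.of_forall fun z => ?_
    rw [norm_mul, norm_mul, ← mul_assoc]
    refine mul_le_mul_of_nonneg_right ((h s hs (y - z)).trans ?_) (norm_nonneg _)
    rw [Real.norm_of_nonneg (poissonWeight_nonneg hs _), mul_assoc]
    refine mul_le_mul_of_nonneg_left ?_ hC.le
    unfold poissonWeight
    have h1 : (s + ‖z - x‖) / 2 ≤ s + ‖y - z‖ := by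
      rw [Metric.mem_ball, dist_eq_norm] at hy
      have h2 := norm_sub_le (y - x) (y - z)
      rw [sub_sub_sub_cancel_left] at h2
      have := norm_nonneg (y - z)
      linarith
    calc s / (s + ‖y - z‖) ^ (n + 1) ≤ s / ((s + ‖z - x‖) / 2) ^ (n + 1) := by gcongr
      _ = 2 ^ (n + 1) * (s / (s + ‖z - x‖) ^ (n + 1)) := by
        rw [div_pow]
        field_simp
  · refine Eventually.of_forall fun z => ?_
    exact (((continuous_dilate φ s).comp (by fun_prop)).mul continuous_const).continuousAt

lemma approxIdentity_add (hf : PoissonIntegrable f) (hg : PoissonIntegrable g) {s : ℝ}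
    (hs : 0 < s) (x : EuclideanSpace ℝ (Fin n)) :
    approxIdentity φ s (fun x => f x + g x) x =
      approxIdentity φ s f x + approxIdentity φ s g x := by
  simp only [approxIdentity_eq_integral, mul_add]
  exact integral_add (integrable_dilate_mul φ hf hs x) (integrable_dilate_mul φ hg hs x)

/-- Differences of two approximate identities do not see constants. -/
lemma approxIdentity_sub_eq_integral (hf : PoissonIntegrable f) {a b : ℝ} (ha : 0 < a)
    (hb : 0 < b) (m : ℝ) (x : EuclideanSpace ℝ (Fin n)) :
    approxIdentity φ a f x - approxIdentity φ b f x =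
      ∫ z, (dilate φ a (x - z) - dilate φ b (x - z)) * (f z - m) := by
  have hm := poissonIntegrable_const (n := n) m
  have h1 : ∀ s : ℝ, 0 < s → ∫ z, dilate φ s (x - z) * m = (∫ z, φ z) * m := by
    intro s hs
    rw [integral_mul_const, integral_sub_left_eq_self, integral_dilate φ hs]
  have h2 : ∀ z, (dilate φ a (x - z) - dilate φ b (x - z)) * (f z - m) =
      (dilate φ a (x - z) * f z - dilate φ b (x - z) * f z) -
        (dilate φ a (x - z) * m - dilate φ b (x - z) * m) := fun z => by ring
  have hd : ∀ g : EuclideanSpace ℝ (Fin n) → ℝ, PoissonIntegrable g →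
      Integrable fun z => dilate φ a (x - z) * g z - dilate φ b (x - z) * g z := fun g hg =>
    (integrable_dilate_mul φ hg ha x).sub (integrable_dilate_mul φ hg hb x)
  simp only [h2]
  rw [integral_sub (hd f hf) (hd _ hm),
    integral_sub (integrable_dilate_mul φ hf ha x) (integrable_dilate_mul φ hf hb x),
    integral_sub (integrable_dilate_mul φ hm ha x) (integrable_dilate_mul φ hm hb x),
    h1 a ha, h1 b hb, sub_self, sub_zero, approxIdentity_eq_integral, approxIdentity_eq_integral]

/-- The approximate identity is dominated by the maximal function. -/
lemma exists_enorm_approxIdentity_le_ballMaximal : ∃ C : ℝ≥0, ∀ (f : EuclideanSpace ℝ (Fin n) → ℝ),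
    AEMeasurable f → ∀ s : ℝ, 0 < s → ∀ x,
      ‖approxIdentity φ s f x‖ₑ ≤ C * ballMaximal (fun z => ‖f z‖ₑ) x := by
  obtain ⟨C, hC, h⟩ := exists_abs_dilate_le φ
  have hvt : volume (Metric.ball (0 : EuclideanSpace ℝ (Fin n)) 1) ≠ ∞ := measure_ball_lt_top.ne
  refine ⟨C.toNNReal * (2 ^ (n + 1) *
    (volume (Metric.ball (0 : EuclideanSpace ℝ (Fin n)) 1)).toNNReal * 2), fun f hf s hs x => ?_⟩
  rw [approxIdentity_eq_integral]
  calc ‖∫ z, dilate φ s (x - z) * f z‖ₑ ≤ ∫⁻ z, ‖dilate φ s (x - z) * f z‖ₑ :=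
        enorm_integral_le_lintegral_enorm _
    _ ≤ ∫⁻ z, ENNReal.ofReal C * (ENNReal.ofReal (poissonWeight s (z - x)) * ‖f z‖ₑ) := by
        refine lintegral_mono fun z => ?_
        rw [enorm_mul, ← mul_assoc, ← ENNReal.ofReal_mul hC.le, poissonWeight_sub_comm,
          Real.enorm_eq_ofReal_abs]
        exact mul_le_mul' (ENNReal.ofReal_le_ofReal (h s hs _)) le_rfl
    _ = ENNReal.ofReal C * ∫⁻ z, ENNReal.ofReal (poissonWeight s (z - x)) * ‖f z‖ₑ :=
        lintegral_const_mul' _ _ ENNReal.ofReal_ne_top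
    _ ≤ _ := by
        refine (mul_le_mul' le_rfl
          (lintegral_poissonWeight_mul_le_ballMaximal hf.enorm hs x)).trans (le_of_eq ?_)
        push_cast
        rw [ENNReal.coe_toNNReal hvt, ENNReal.ofReal_pow (by norm_num), ENNReal.ofReal_ofNat,
          ENNReal.ofReal, mul_assoc, mul_assoc, mul_assoc, mul_assoc, mul_assoc]

end ApproxIdentity

/-! ### Plancherel's theorem for integrable functions -/

section Plancherel

open scoped FourierTransform

variable {E : Type*} [NormedAddCommGroup E] [InnerProductSpace ℝ E] [FiniteDimensional ℝ E]
  [MeasurableSpace E] [BorelSpace E]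

lemma continuous_fourier_of_integrable {f : E → ℂ} (hf : Integrable f) : Continuous (𝓕 f) :=
  VectorFourier.fourierIntegral_continuous Real.continuous_fourierChar continuous_inner hf

lemma norm_fourier_ofReal_le (f : E → ℝ) (ξ : E) :
    ‖𝓕 (fun x => (f x : ℂ)) ξ‖ ≤ ∫ x, ‖f x‖ := by
  rw [Real.fourier_eq]
  refine (norm_integral_le_integral_norm _).trans (le_of_eq ?_)
  refine integral_congr_ae (Eventually.of_forall fun x => ?_)
  simp [Circle.norm_smul]

/-- On `L¹ ∩ L²` the Fourier integral represents the Fourier transform on `L²`. -/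
lemma fourier_toLp_ae_eq {f : E → ℂ} (hf : Integrable f) (hf2 : MemLp f 2) :
    ((𝓕 (hf2.toLp f) : Lp ℂ 2 (volume : Measure E)) : E → ℂ) =ᵐ[volume] 𝓕 f := by
  refine ae_eq_of_integral_contDiff_smul_eq
    ((Lp.memLp _).locallyIntegrable (by norm_num))
    (continuous_fourier_of_integrable hf).locallyIntegrable fun g hg hgc => ?_
  have hgc' : HasCompactSupport fun x => (g x : ℂ) :=
    hgc.comp_left (g := fun t : ℝ => (t : ℂ)) Complex.ofReal_zero
  set G : 𝓢(E, ℂ) := hgc'.toSchwartzMap (Complex.ofRealCLM.contDiff.comp hg) with hG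
  have hGx : ∀ x, G x = g x := fun x => rfl
  have h1 := DFunLike.congr_fun (Lp.fourier_toTemperedDistribution_eq (hf2.toLp f)) G
  rw [TemperedDistribution.fourier_apply, Lp.toTemperedDistribution_apply,
    Lp.toTemperedDistribution_apply] at h1
  have h2 : ∫ x, 𝓕 G x • (hf2.toLp f) x = ∫ x, G x • 𝓕 f x := by
    have h3 : ∫ x, 𝓕 G x • (hf2.toLp f) x = ∫ x, 𝓕 G x • f x := by
      refine integral_congr_ae ?_
      filter_upwards [hf2.coeFn_toLp] with x hx
      rw [hx]
    rw [h3]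
    have := VectorFourier.integral_fourierIntegral_smul_eq_flip (μ := (volume : Measure E))
      (ν := (volume : Measure E)) (L := innerₗ E) (f := (G : E → ℂ)) (g := f)
      Real.continuous_fourierChar continuous_inner G.integrable hf
    rw [flip_innerₗ] at this
    exact this
  simp only [hGx, Complex.real_smul, smul_eq_mul] at h1 h2 ⊢
  rw [← h1, ← h2]

theorem lintegral_enorm_fourier_sq {f : E → ℂ} (hf : Integrable f) (hf2 : MemLp f 2) :
    ∫⁻ ξ, ‖𝓕 f ξ‖ₑ ^ 2 = ∫⁻ x, ‖f x‖ₑ ^ 2 := by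
  have h1 : eLpNorm (𝓕 f) 2 volume = eLpNorm f 2 volume := by
    rw [← eLpNorm_congr_ae (fourier_toLp_ae_eq hf hf2)]
    have := Lp.norm_fourier_eq (hf2.toLp f)
    rw [Lp.norm_def, Lp.norm_def, ENNReal.toReal_eq_toReal_iff' (Lp.eLpNorm_ne_top _)
      (Lp.eLpNorm_ne_top _), eLpNorm_congr_ae hf2.coeFn_toLp] at this
    exact this
  have h2 : ∀ g : E → ℂ, ∫⁻ x, ‖g x‖ₑ ^ 2 = eLpNorm g 2 volume ^ 2 := by
    intro g
    have := eLpNorm_nnreal_pow_eq_lintegral (f := g) (μ := (volume : Measure E)) (p := 2)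
      (by norm_num)
    norm_num at this
    exact this.symm
  rw [h2, h2, h1]

theorem lintegral_enorm_fourierInv_sq {f : E → ℂ} (hf : Integrable f) (hf2 : MemLp f 2) :
    ∫⁻ x, ‖𝓕⁻ f x‖ₑ ^ 2 = ∫⁻ ξ, ‖f ξ‖ₑ ^ 2 := by
  rw [← lintegral_enorm_fourier_sq hf hf2, ← lintegral_neg_eq_self]
  simp only [Real.fourierInv_eq_fourier_neg, neg_neg]

end Plancherel

/-! ### The approximate identity as a Fourier multiplier -/

section Multiplier

open scoped FourierTransform

variable {n : ℕ} (φ : 𝓢(EuclideanSpace ℝ (Fin n), ℝ))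

/-- The Fourier transform of a real-valued Schwartz function. -/
noncomputable def symbol : 𝓢(EuclideanSpace ℝ (Fin n), ℂ) :=
  𝓕 (φ.postcompCLM Complex.ofRealCLM)

lemma symbol_apply (ξ : EuclideanSpace ℝ (Fin n)) :
    symbol φ ξ = 𝓕 (fun x => (φ x : ℂ)) ξ := rfl

lemma symbol_zero (hφ : ∫ x, φ x = 1) : symbol φ 0 = 1 := by
  rw [symbol_apply, Real.fourier_eq]
  simp only [inner_zero_right, neg_zero, AddChar.map_zero_eq_one, one_smul]
  rw [integral_complex_ofReal, hφ, Complex.ofReal_one]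

lemma fourier_ofReal_dilate {s : ℝ} (hs : 0 < s) (ξ : EuclideanSpace ℝ (Fin n)) :
    𝓕 (fun x => (dilate φ s x : ℂ)) ξ = symbol φ (s • ξ) := by
  rw [symbol_apply, Real.fourier_eq, Real.fourier_eq]
  have h1 : ∀ x : EuclideanSpace ℝ (Fin n),
      Real.fourierChar (-inner ℝ x ξ) • (dilate φ s x : ℂ) =
        ((s ^ n)⁻¹ : ℝ) • (fun y => Real.fourierChar (-inner ℝ y (s • ξ)) • (φ y : ℂ))
          (s⁻¹ • x) := by
    intro x
    have h2 : inner ℝ (s⁻¹ • x) (s • ξ) = inner ℝ x ξ := by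
      rw [inner_smul_left, inner_smul_right]
      simp only [RCLike.conj_to_real]
      field_simp
    simp only [dilate, h2, Circle.smul_def, Complex.real_smul, smul_eq_mul]
    push_cast
    ring
  refine (integral_congr_ae (Eventually.of_forall h1)).trans ?_
  have h3 := Measure.integral_comp_smul (volume : Measure (EuclideanSpace ℝ (Fin n)))
    (fun y => Real.fourierChar (-inner ℝ y (s • ξ)) • (φ y : ℂ)) s⁻¹
  refine ((integral_smul _ _).trans (congrArg (fun t : ℂ => (s ^ n)⁻¹ • t) h3)).trans ?_
  beta_reduce
  rw [finrank_euclideanSpace_fin, smul_smul, inv_pow,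
    inv_inv, abs_of_pos (by positivity), inv_mul_cancel₀ (by positivity), one_smul]

variable {f : EuclideanSpace ℝ (Fin n) → ℝ}

lemma ofReal_approxIdentity (s : ℝ) (f : EuclideanSpace ℝ (Fin n) → ℝ) :
    (fun x => (approxIdentity φ s f x : ℂ)) =
      convolution (fun x => (dilate φ s x : ℂ)) (fun x => (f x : ℂ))
        (ContinuousLinearMap.mul ℂ ℂ) volume := by
  ext x
  simp only [approxIdentity, convolution_def, ContinuousLinearMap.mul_apply']
  rw [← integral_complex_ofReal]
  simp

lemma integrable_approxIdentity (hf : Integrable f) {s : ℝ} (hs : 0 < s) :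
    Integrable (approxIdentity φ s f) :=
  (integrable_dilate φ hs).integrable_convolution _ hf

lemma fourier_ofReal_approxIdentity (hf : Integrable f) {s : ℝ} (hs : 0 < s)
    (ξ : EuclideanSpace ℝ (Fin n)) :
    𝓕 (fun x => (approxIdentity φ s f x : ℂ)) ξ =
      symbol φ (s • ξ) * 𝓕 (fun x => (f x : ℂ)) ξ := by
  have h1 : Integrable fun x => (dilate φ s x : ℂ) := (integrable_dilate φ hs).ofReal
  have h2 : Integrable fun x => (f x : ℂ) := hf.ofReal
  rw [ofReal_approxIdentity, ← fourier_ofReal_dilate φ hs]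
  exact Real.fourier_mul_convolution_eq h1 h2 ξ

lemma integrable_mul_fourier {m : EuclideanSpace ℝ (Fin n) → ℂ} (hm : Integrable m)
    (hf : Integrable f) : Integrable fun ξ => m ξ * 𝓕 (fun x => (f x : ℂ)) ξ := by
  refine hm.mul_bdd (c := ∫ x, ‖f x‖)
    (continuous_fourier_of_integrable hf.ofReal).aestronglyMeasurable
    (Eventually.of_forall fun ξ => norm_fourier_ofReal_le f ξ)

lemma integrable_symbol_smul {s : ℝ} (hs : 0 < s) : Integrable fun ξ => symbol φ (s • ξ) :=
  (symbol φ).integrable.comp_smul hs.ne'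

lemma ofReal_approxIdentity_eq_fourierInv (hf : Integrable f) {s : ℝ} (hs : 0 < s)
    (x : EuclideanSpace ℝ (Fin n)) :
    (approxIdentity φ s f x : ℂ) =
      𝓕⁻ (fun ξ => symbol φ (s • ξ) * 𝓕 (fun x => (f x : ℂ)) ξ) x := by
  have h1 : (fun ξ => symbol φ (s • ξ) * 𝓕 (fun x => (f x : ℂ)) ξ) =
      𝓕 (fun x => (approxIdentity φ s f x : ℂ)) :=
    funext fun ξ => (fourier_ofReal_approxIdentity φ hf hs ξ).symm
  have hc : Continuous fun x => (approxIdentity φ s f x : ℂ) :=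
    Complex.continuous_ofReal.comp (continuous_approxIdentity φ hf.poissonIntegrable hs)
  have hi : Integrable (𝓕 (fun x => (approxIdentity φ s f x : ℂ))) := by
    rw [← h1]
    exact integrable_mul_fourier (integrable_symbol_smul φ hs) hf
  rw [h1, hc.fourierInv_fourier_eq (integrable_approxIdentity φ hf hs).ofReal hi]

lemma fourierInv_sub_apply {g h : EuclideanSpace ℝ (Fin n) → ℂ} (hg : Integrable g)
    (hh : Integrable h) (x : EuclideanSpace ℝ (Fin n)) :
    𝓕⁻ (fun ξ => g ξ - h ξ) x = 𝓕⁻ g x - 𝓕⁻ h x := by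
  simp only [Real.fourierInv_eq_fourier_neg, Real.fourier_eq, smul_sub]
  exact integral_sub ((Real.fourierIntegral_convergent_iff (-x)).2 hg)
    ((Real.fourierIntegral_convergent_iff (-x)).2 hh)

/-- Size and regularity bounds for the symbol that the square function estimates rely on. -/
lemma exists_symbol_bounds (hφ : ∫ x, φ x = 1) : ∃ C : ℝ, 0 < C ∧
    (∀ η, ‖symbol φ η‖ ≤ C) ∧ (∀ η, ‖η‖ * ‖symbol φ η‖ ^ 2 ≤ C) ∧
    (∀ η, ‖1 - symbol φ η‖ ^ 2 ≤ C * ‖η‖) ∧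
    (∀ η, ‖fderiv ℝ (symbol φ) η‖ ≤ C / (1 + ‖η‖) ^ 2) := by
  obtain ⟨A, hA, h0⟩ := (symbol φ).exists_norm_le_div_one_add_pow 1
  obtain ⟨B, hB, h1⟩ :=
    (SchwartzMap.fderivCLM ℝ _ ℂ (symbol φ)).exists_norm_le_div_one_add_pow 2
  simp only [SchwartzMap.fderivCLM_apply] at h1
  have hbd : ∀ η, ‖symbol φ η‖ ≤ A := fun η =>
    (h0 η).trans (div_le_self hA.le (by simp))
  have hlip : ∀ η, ‖1 - symbol φ η‖ ≤ B * ‖η‖ := by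
    intro η
    have := Convex.norm_image_sub_le_of_norm_fderiv_le (f := symbol φ) (s := Set.univ) (C := B)
      (fun w _ => (symbol φ).differentiableAt)
      (fun w _ => (h1 w).trans (div_le_self hB.le (one_le_pow₀ (by simp)))) convex_univ
      (Set.mem_univ η) (Set.mem_univ 0)
    rwa [symbol_zero φ hφ, zero_sub, norm_neg] at this
  refine ⟨A + A ^ 2 + (1 + A) * B + B, by positivity, fun η => ?_, fun η => ?_, fun η => ?_,
    fun η => ?_⟩
  · have := hbd η
    nlinarith [mul_pos (by linarith : 0 < 1 + A) hB, sq_nonneg A]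
  · have h2 : (1 + ‖η‖) * ‖symbol φ η‖ ≤ A := by
      have := h0 η
      rwa [pow_one, le_div_iff₀ (by positivity), mul_comm] at this
    have h3 := norm_nonneg (symbol φ η)
    have h4 : ‖η‖ * ‖symbol φ η‖ ≤ A := by nlinarith
    calc ‖η‖ * ‖symbol φ η‖ ^ 2 = ‖η‖ * ‖symbol φ η‖ * ‖symbol φ η‖ := by ring
      _ ≤ A * A := mul_le_mul h4 (hbd η) h3 hA.le
      _ ≤ _ := by nlinarith [mul_pos (by linarith : 0 < 1 + A) hB]
  · have h2 : ‖1 - symbol φ η‖ ≤ 1 + A := by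
      refine (norm_sub_le _ _).trans ?_
      rw [norm_one]
      linarith [hbd η]
    calc ‖1 - symbol φ η‖ ^ 2 = ‖1 - symbol φ η‖ * ‖1 - symbol φ η‖ := sq _
      _ ≤ (1 + A) * (B * ‖η‖) := mul_le_mul h2 (hlip η) (norm_nonneg _) (by linarith)
      _ = (1 + A) * B * ‖η‖ := by ring
      _ ≤ _ := by
        gcongr
        nlinarith [sq_nonneg A]
  · refine (h1 η).trans ?_
    gcongr
    nlinarith [mul_pos (by linarith : 0 < 1 + A) hB, sq_nonneg A]

/-- The derivative of the dilated symbol `ξ ↦ φ̂(s ξ)` with respect to the scale `s`. -/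
noncomputable def symbolDeriv (s : ℝ) (ξ : EuclideanSpace ℝ (Fin n)) : ℂ :=
  fderiv ℝ (symbol φ) (s • ξ) ξ

lemma hasDerivAt_symbol_smul (s : ℝ) (ξ : EuclideanSpace ℝ (Fin n)) :
    HasDerivAt (fun s : ℝ => symbol φ (s • ξ)) (symbolDeriv φ s ξ) s := by
  have h1 : HasDerivAt (fun s : ℝ => s • ξ) ξ s := by
    simpa using (hasDerivAt_id s).smul_const ξ
  exact ((symbol φ).hasFDerivAt (s • ξ)).comp_hasDerivAt s h1

lemma continuous_symbolDeriv :
    Continuous fun q : ℝ × EuclideanSpace ℝ (Fin n) => symbolDeriv φ q.1 q.2 := by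
  have h1 : Continuous (fderiv ℝ (symbol φ)) := (symbol φ).smooth 1 |>.continuous_fderiv one_ne_zero
  exact (h1.comp (by fun_prop)).clm_apply continuous_snd

lemma symbol_smul_sub_symbol_smul (a b : ℝ) (ξ : EuclideanSpace ℝ (Fin n)) :
    symbol φ (a • ξ) - symbol φ (b • ξ) = ∫ s in b..a, symbolDeriv φ s ξ := by
  rw [intervalIntegral.integral_eq_sub_of_hasDerivAt fun s _ => hasDerivAt_symbol_smul φ s ξ]
  exact ((continuous_symbolDeriv φ).comp (by fun_prop :
    Continuous fun s : ℝ => (s, ξ))).intervalIntegrable _ _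

lemma exists_norm_symbolDeriv_le (b : ℝ) (hb : 0 < b) : ∃ C : ℝ, 0 < C ∧ ∀ s, b ≤ s → ∀ ξ,
    ‖symbolDeriv φ s ξ‖ ≤ C * poissonWeight 1 ξ := by
  obtain ⟨B, hB, h1⟩ :=
    (SchwartzMap.fderivCLM ℝ _ ℂ (symbol φ)).exists_norm_le_div_one_add_pow (n + 2)
  simp only [SchwartzMap.fderivCLM_apply] at h1
  set d := min b 1
  have hd : 0 < d := lt_min hb one_pos
  refine ⟨B / d ^ (n + 2), by positivity, fun s hs ξ => ?_⟩
  have h2 : d * (1 + ‖ξ‖) ≤ 1 + ‖s • ξ‖ := by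
    rw [norm_smul, Real.norm_of_nonneg (hb.le.trans hs)]
    have h3 : d ≤ 1 := min_le_right _ _
    have h4 : d ≤ s := (min_le_left _ _).trans hs
    have := norm_nonneg ξ
    nlinarith
  unfold symbolDeriv poissonWeight
  calc ‖fderiv ℝ (symbol φ) (s • ξ) ξ‖ ≤ ‖fderiv ℝ (symbol φ) (s • ξ)‖ * ‖ξ‖ :=
        ContinuousLinearMap.le_opNorm _ _
    _ ≤ B / (d * (1 + ‖ξ‖)) ^ (n + 2) * (1 + ‖ξ‖) := by
        refine mul_le_mul ((h1 _).trans ?_) (by linarith) (norm_nonneg _) (by positivity)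
        gcongr
    _ = B / d ^ (n + 2) * (1 / (1 + ‖ξ‖) ^ (n + 1)) := by
        rw [mul_pow, pow_succ (1 + ‖ξ‖)]
        field_simp

lemma integrable_symbolDeriv {s : ℝ} (hs : 0 < s) : Integrable (symbolDeriv φ s) := by
  obtain ⟨C, hC, h⟩ := exists_norm_symbolDeriv_le φ s hs
  have h1 : Integrable fun ξ : EuclideanSpace ℝ (Fin n) => C * poissonWeight 1 ξ := by
    simpa using (integrable_poissonWeight one_pos (0 : EuclideanSpace ℝ (Fin n))).const_mul C
  refine h1.mono' ?_ (Eventually.of_forall fun ξ => h s le_rfl ξ)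
  exact ((continuous_symbolDeriv φ).comp (by fun_prop : Continuous fun ξ :
    EuclideanSpace ℝ (Fin n) => (s, ξ))).aestronglyMeasurable

end Multiplier

/-! ### Two integral inequalities -/

section OneVariable

lemma lintegral_Ioi_div_one_add_mul_sq_le {y : ℝ} (hy : 0 ≤ y) :
    ∫⁻ s in Set.Ioi (0 : ℝ), ENNReal.ofReal (y / (1 + s * y) ^ 2) ≤ 1 := by
  rcases hy.eq_or_lt with rfl | hy
  · simp
  have hd : ∀ s ∈ Set.Ici (0 : ℝ),
      HasDerivAt (fun s => -(1 + s * y)⁻¹) (y / (1 + s * y) ^ 2) s := by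
    intro s hs
    have h0 : 1 + s * y ≠ 0 := by
      have := mul_nonneg (Set.mem_Ici.1 hs) hy.le
      positivity
    have h1 : HasDerivAt (fun s => 1 + s * y) y s := by
      simpa using ((hasDerivAt_id s).mul_const y).const_add 1
    refine (h1.fun_inv h0).fun_neg.congr_deriv ?_
    field_simp
  have hlim : Tendsto (fun s => -(1 + s * y)⁻¹) atTop (𝓝 0) := by
    rw [← neg_zero]
    refine (tendsto_inv_atTop_zero.comp ?_).neg
    exact tendsto_atTop_add_const_left _ _ (tendsto_id.atTop_mul_const hy)
  have hnn : ∀ s ∈ Set.Ioi (0 : ℝ), 0 ≤ y / (1 + s * y) ^ 2 := fun s hs => by positivity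
  rw [← ofReal_integral_eq_lintegral_ofReal (integrableOn_Ioi_deriv_of_nonneg' hd hnn hlim)
    ((ae_restrict_iff' measurableSet_Ioi).2 (Eventually.of_forall hnn)),
    integral_Ioi_of_hasDerivAt_of_nonneg' hd hnn hlim]
  simp

/-- The Cauchy–Schwarz inequality with a positive weight. -/
lemma lintegral_sq_le_mul_lintegral {α : Type*} [MeasurableSpace α] (μ : Measure α)
    {w F : α → ℝ≥0∞} (hw : AEMeasurable w μ) (hF : AEMeasurable F μ)
    (h0 : ∀ᵐ a ∂μ, w a ≠ 0) (ht : ∀ᵐ a ∂μ, w a ≠ ∞) :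
    (∫⁻ a, F a ∂μ) ^ 2 ≤ (∫⁻ a, w a ∂μ) * ∫⁻ a, (w a)⁻¹ * F a ^ 2 ∂μ := by
  have hhalf : ∀ a : ℝ≥0∞, (a ^ (1 / 2 : ℝ)) ^ (2 : ℝ) = a := fun a => by
    rw [← ENNReal.rpow_mul]
    norm_num
  have h1 := ENNReal.lintegral_mul_le_Lp_mul_Lq μ Real.HolderConjugate.two_two
    (f := fun a => w a ^ (1 / 2 : ℝ)) (g := (fun a => (w a)⁻¹ ^ (1 / 2 : ℝ)) * F)
    (hw.pow_const (1 / 2 : ℝ)) ((hw.inv.pow_const (1 / 2 : ℝ)).mul hF)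
  have h2 : ∫⁻ a, ((fun a => w a ^ (1 / 2 : ℝ)) * ((fun a => (w a)⁻¹ ^ (1 / 2 : ℝ)) * F)) a ∂μ =
      ∫⁻ a, F a ∂μ := by
    refine lintegral_congr_ae ?_
    filter_upwards [h0, ht] with a ha0 hat
    simp only [Pi.mul_apply]
    rw [← mul_assoc, ← ENNReal.mul_rpow_of_nonneg _ _ (by norm_num),
      ENNReal.mul_inv_cancel ha0 hat, ENNReal.one_rpow, one_mul]
  have h3 : ∀ a, ((fun a => (w a)⁻¹ ^ (1 / 2 : ℝ)) * F) a ^ (2 : ℝ) = (w a)⁻¹ * F a ^ 2 := by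
    intro a
    simp only [Pi.mul_apply]
    rw [ENNReal.mul_rpow_of_nonneg _ _ (by norm_num), hhalf, ENNReal.rpow_two]
  have h4 : ∀ c : ℝ≥0∞, (c ^ (1 / 2 : ℝ)) ^ 2 = c := fun c => by
    rw [← ENNReal.rpow_two, hhalf]
  rw [h2] at h1
  simp only [h3, hhalf] at h1
  refine (pow_le_pow_left' h1 2).trans (le_of_eq ?_)
  rw [mul_pow, h4, h4]

end OneVariable

/-! ### Square sums of the symbols over blocks of scales -/

section OscillationL2

open scoped FourierTransform

variable {n : ℕ} (φ : 𝓢(EuclideanSpace ℝ (Fin n), ℝ))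

lemma memLp_two_of_integrable_of_bounded {α : Type*} [MeasurableSpace α] {μ : Measure α}
    {g : α → ℂ} (hg : Integrable g μ) {M : ℝ} (hM : ∀ x, ‖g x‖ ≤ M) : MemLp g 2 μ := by
  rw [memLp_two_iff_integrable_sq_norm hg.aestronglyMeasurable]
  simp only [sq]
  exact hg.norm.mul_bdd (c := M) hg.norm.aestronglyMeasurable
    (Eventually.of_forall fun x => by rw [norm_norm]; exact hM x)

/-- Fundamental theorem of calculus in the scale, on the Fourier side. -/
lemma enorm_fourierInv_symbol_sub_le {h : EuclideanSpace ℝ (Fin n) → ℂ} (hc : Continuous h)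
    {M : ℝ} (hM : ∀ ξ, ‖h ξ‖ ≤ M) {a b : ℝ} (hb : 0 < b) (hba : b ≤ a)
    (x : EuclideanSpace ℝ (Fin n)) :
    ‖𝓕⁻ (fun ξ => (symbol φ (a • ξ) - symbol φ (b • ξ)) * h ξ) x‖ₑ ≤
      ∫⁻ s in Set.Ioc b a, ‖𝓕⁻ (fun ξ => symbolDeriv φ s ξ * h ξ) x‖ₑ := by
  have hM0 : 0 ≤ M := (norm_nonneg _).trans (hM 0)
  obtain ⟨C, hC, hD⟩ := exists_norm_symbolDeriv_le φ b hb
  have hDc := continuous_symbolDeriv φ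
  set G : EuclideanSpace ℝ (Fin n) → ℝ → ℂ :=
    fun ξ s => Real.fourierChar (inner ℝ ξ x) • (symbolDeriv φ s ξ * h ξ) with hG
  have hint : Integrable (Function.uncurry G)
      ((volume : Measure (EuclideanSpace ℝ (Fin n))).prod (volume.restrict (Set.Ioc b a))) := by
    have h1 : Integrable (fun ξ : EuclideanSpace ℝ (Fin n) => C * poissonWeight 1 ξ * M) := by
      simpa using
        ((integrable_poissonWeight one_pos (0 : EuclideanSpace ℝ (Fin n))).const_mul C).mul_const M
    have h2 := h1.mul_prod (integrable_const (μ := volume.restrict (Set.Ioc b a)) (1 : ℝ))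
    refine h2.mono' ?_ ?_
    · refine Continuous.aestronglyMeasurable ?_
      have e1 : Continuous fun q : EuclideanSpace ℝ (Fin n) × ℝ =>
          Real.fourierChar (inner ℝ q.1 x) := Real.continuous_fourierChar.comp (by fun_prop)
      exact e1.smul ((hDc.comp (by fun_prop : Continuous fun q : EuclideanSpace ℝ (Fin n) × ℝ =>
          (q.2, q.1))).mul (hc.comp continuous_fst))
    · have h3 : ∀ᵐ q ∂((volume : Measure (EuclideanSpace ℝ (Fin n))).prod
          (volume.restrict (Set.Ioc b a))), q.2 ∈ Set.Ioc b a :=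
        Measure.quasiMeasurePreserving_snd.ae (ae_restrict_mem measurableSet_Ioc)
      filter_upwards [h3] with q hq
      simp only [hG, Function.uncurry_def, Circle.norm_smul, norm_mul, mul_one]
      exact mul_le_mul (hD _ hq.1.le _) (hM _) (norm_nonneg _)
        (mul_nonneg hC.le (poissonWeight_nonneg one_pos _))
  have heq : 𝓕⁻ (fun ξ => (symbol φ (a • ξ) - symbol φ (b • ξ)) * h ξ) x =
      ∫ s in Set.Ioc b a, 𝓕⁻ (fun ξ => symbolDeriv φ s ξ * h ξ) x := by
    simp only [Real.fourierInv_eq]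
    rw [← integral_integral_swap hint]
    refine integral_congr_ae (Eventually.of_forall fun ξ => ?_)
    simp only [hG, Circle.smul_def, smul_eq_mul]
    rw [symbol_smul_sub_symbol_smul, intervalIntegral.integral_of_le hba, integral_const_mul,
      integral_mul_const]
  rw [heq]
  exact enorm_integral_le_lintegral_enorm _

lemma measurable_enorm_fourierInv_symbolDeriv {h : EuclideanSpace ℝ (Fin n) → ℂ}
    (hc : Continuous h) : Measurable fun q : ℝ × EuclideanSpace ℝ (Fin n) =>
      ‖𝓕⁻ (fun ξ => symbolDeriv φ q.1 ξ * h ξ) q.2‖ₑ := by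
  simp only [Real.fourierInv_eq]
  refine StronglyMeasurable.enorm (StronglyMeasurable.integral_prod_right (f := fun
    (q : ℝ × EuclideanSpace ℝ (Fin n)) (ξ : EuclideanSpace ℝ (Fin n)) =>
      Real.fourierChar (inner ℝ ξ q.2) • (symbolDeriv φ q.1 ξ * h ξ)) ?_)
  refine Continuous.stronglyMeasurable ?_
  have e1 : Continuous fun q : (ℝ × EuclideanSpace ℝ (Fin n)) × EuclideanSpace ℝ (Fin n) =>
      Real.fourierChar (inner ℝ q.2 q.1.2) := Real.continuous_fourierChar.comp (by fun_prop)
  exact e1.smul (((continuous_symbolDeriv φ).comp (by fun_prop : Continuous fun q :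
      (ℝ × EuclideanSpace ℝ (Fin n)) × EuclideanSpace ℝ (Fin n) => (q.1.1, q.2))).mul
      (hc.comp continuous_snd))

/-- The density of the weight used on the scales between `t'` and `t`. It is `1 / t` near `t`, which
suits low frequencies, and `t' / s²` near `t'`, which suits high ones; its mass is at most `2`. -/
noncomputable def scaleWeight (t' t s : ℝ) : ℝ := 1 / t + t' / s ^ 2

lemma scaleWeight_pos {t' t s : ℝ} (ht' : 0 < t') (ht : t' ≤ t) : 0 < scaleWeight t' t s := by
  have : 0 < t := ht'.trans_le ht
  unfold scaleWeight
  positivity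

lemma measurable_scaleWeight (t' t : ℝ) : Measurable (scaleWeight t' t) := by
  unfold scaleWeight
  fun_prop

lemma lintegral_scaleWeight_le {t' t : ℝ} (ht' : 0 < t') (ht : t' ≤ t) :
    ∫⁻ s in Set.Ioc t' t, ENNReal.ofReal (scaleWeight t' t s) ≤ 2 := by
  have ht0 : 0 < t := ht'.trans_le ht
  have hpos : ∀ s ∈ Set.uIcc t' t, s ≠ 0 := fun s hs => by
    rw [Set.uIcc_of_le ht] at hs
    exact (ht'.trans_le hs.1).ne'
  have hd : ∀ s ∈ Set.uIcc t' t, HasDerivAt (fun s => s / t - t' * s⁻¹) (scaleWeight t' t s) s := by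
    intro s hs
    refine (((hasDerivAt_id s).div_const t).sub
      ((hasDerivAt_inv (hpos s hs)).const_mul t')).congr_deriv ?_
    unfold scaleWeight
    ring
  have hcont : ContinuousOn (scaleWeight t' t) (Set.uIcc t' t) := by
    unfold scaleWeight
    exact continuousOn_const.add (continuousOn_const.div (by fun_prop)
      fun s hs => pow_ne_zero 2 (hpos s hs))
  have hI := hcont.intervalIntegrable (μ := volume)
  rw [← ofReal_integral_eq_lintegral_ofReal, ← intervalIntegral.integral_of_le ht,
    intervalIntegral.integral_eq_sub_of_hasDerivAt hd hI]
  · rw [← ENNReal.ofReal_ofNat]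
    apply ENNReal.ofReal_le_ofReal
    have h1 : t' * t⁻¹ = t' / t := rfl
    have h2 : 0 ≤ t' / t := by positivity
    rw [div_self ht0.ne', mul_inv_cancel₀ ht'.ne', h1]
    linarith
  · exact (intervalIntegrable_iff_integrableOn_Ioc_of_le ht).1 hI
  · exact Eventually.of_forall fun s => (scaleWeight_pos ht' ht).le

lemma tsum_lintegral_Ioc_le {t : ℕ → ℝ} (ht : ∀ i, 0 < t i) (hanti : Antitone t) (g : ℝ → ℝ≥0∞) :
    ∑' i, ∫⁻ s in Set.Ioc (t (i + 1)) (t i), g s ≤ ∫⁻ s in Set.Ioi 0, g s := by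
  have hdis : Pairwise (Function.onFun Disjoint fun i : ℕ => Set.Ioc (t (i + 1)) (t i)) :=
    hanti.pairwise_disjoint_on_Ioc_succ
  rw [← lintegral_iUnion (fun i => measurableSet_Ioc) hdis]
  exact lintegral_mono_set (Set.iUnion_subset fun i s hs => (ht _).trans hs.1)

/-- The multiplier `1 - (φ̂(t' ξ) - φ̂(t ξ))`, which removes the frequencies between `1 / t` and
`1 / t'`. -/
noncomputable def cutoffSymbol (t' t : ℝ) (ξ : EuclideanSpace ℝ (Fin n)) : ℂ :=
  1 - (symbol φ (t' • ξ) - symbol φ (t • ξ))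

lemma continuous_symbol_smul (s : ℝ) :
    Continuous fun ξ : EuclideanSpace ℝ (Fin n) => symbol φ (s • ξ) :=
  (symbol φ).continuous.comp (continuous_const_smul s)

lemma continuous_cutoffSymbol (t' t : ℝ) : Continuous (cutoffSymbol φ t' t) :=
  continuous_const.sub ((continuous_symbol_smul φ t').sub (continuous_symbol_smul φ t))

lemma norm_symbolDeriv_le {C : ℝ} (h : ∀ η, ‖fderiv ℝ (symbol φ) η‖ ≤ C / (1 + ‖η‖) ^ 2) {s : ℝ}
    (hs : 0 < s) (ξ : EuclideanSpace ℝ (Fin n)) :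
    ‖symbolDeriv φ s ξ‖ ≤ C * (‖ξ‖ / (1 + s * ‖ξ‖) ^ 2) := by
  refine (ContinuousLinearMap.le_opNorm _ _).trans ?_
  have := h (s • ξ)
  rw [norm_smul, Real.norm_of_nonneg hs.le] at this
  calc _ ≤ C / (1 + s * ‖ξ‖) ^ 2 * ‖ξ‖ := by gcongr
    _ = _ := by ring

/-- The frequency supports of consecutive blocks of scales overlap boundedly: the square sum of the
symbols of `Φ_{t (i+1)} - Φ_{t i}` is bounded. -/
lemma exists_tsum_enorm_symbol_sub_sq_le (hφ : ∫ x, φ x = 1) : ∃ K : ℝ≥0, ∀ t : ℕ → ℝ,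
    (∀ i, 0 < t i) → Antitone t → ∀ ξ : EuclideanSpace ℝ (Fin n),
      ∑' i, ‖symbol φ (t (i + 1) • ξ) - symbol φ (t i • ξ)‖ₑ ^ 2 ≤ K := by
  obtain ⟨C, hC, hb, -, -, hd⟩ := exists_symbol_bounds φ hφ
  refine ⟨Real.toNNReal (2 * C * C), fun t ht hanti ξ => ?_⟩
  have hterm : ∀ i, ‖symbol φ (t (i + 1) • ξ) - symbol φ (t i • ξ)‖ₑ ^ 2 ≤
      ENNReal.ofReal (2 * C * C) *
        ∫⁻ s in Set.Ioc (t (i + 1)) (t i), ENNReal.ofReal (‖ξ‖ / (1 + s * ‖ξ‖) ^ 2) := by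
    intro i
    have h1 : ‖symbol φ (t (i + 1) • ξ) - symbol φ (t i • ξ)‖ₑ ≤ ENNReal.ofReal (2 * C) := by
      rw [← ofReal_norm]
      apply ENNReal.ofReal_le_ofReal
      refine (norm_sub_le _ _).trans ?_
      linarith [hb (t (i + 1) • ξ), hb (t i • ξ)]
    have h2 : ‖symbol φ (t (i + 1) • ξ) - symbol φ (t i • ξ)‖ₑ ≤
        ENNReal.ofReal C * ∫⁻ s in Set.Ioc (t (i + 1)) (t i),
          ENNReal.ofReal (‖ξ‖ / (1 + s * ‖ξ‖) ^ 2) := by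
      rw [← enorm_neg, neg_sub, symbol_smul_sub_symbol_smul,
        intervalIntegral.integral_of_le (hanti (Nat.le_succ i)),
        ← lintegral_const_mul' _ _ ENNReal.ofReal_ne_top]
      refine (enorm_integral_le_lintegral_enorm _).trans ?_
      refine setLIntegral_mono' measurableSet_Ioc fun s hs => ?_
      rw [← ENNReal.ofReal_mul hC.le, ← ofReal_norm]
      exact ENNReal.ofReal_le_ofReal (norm_symbolDeriv_le φ hd ((ht _).trans hs.1) ξ)
    rw [sq, ENNReal.ofReal_mul (by positivity), mul_assoc]
    exact mul_le_mul' h1 h2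
  calc ∑' i, ‖symbol φ (t (i + 1) • ξ) - symbol φ (t i • ξ)‖ₑ ^ 2
      ≤ ∑' i, ENNReal.ofReal (2 * C * C) * ∫⁻ s in Set.Ioc (t (i + 1)) (t i),
          ENNReal.ofReal (‖ξ‖ / (1 + s * ‖ξ‖) ^ 2) := ENNReal.tsum_le_tsum hterm
    _ ≤ ENNReal.ofReal (2 * C * C) * 1 := by
        rw [ENNReal.tsum_mul_left]
        exact mul_le_mul' le_rfl ((tsum_lintegral_Ioc_le ht hanti _).trans
          (lintegral_Ioi_div_one_add_mul_sq_le (norm_nonneg ξ)))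
    _ = _ := by rw [mul_one]; rfl

/-- The weighted square function of the part of `f` outside the frequencies of the block is
controlled by an integrable function of `s |ξ|`. -/
lemma exists_inv_scaleWeight_mul_le (hφ : ∫ x, φ x = 1) : ∃ K : ℝ, 0 < K ∧ ∀ t' t s : ℝ,
    0 < t' → t' < s → s ≤ t → ∀ ξ : EuclideanSpace ℝ (Fin n),
      (scaleWeight t' t s)⁻¹ * ‖symbolDeriv φ s ξ * cutoffSymbol φ t' t ξ‖ ^ 2 ≤
        K * (‖ξ‖ / (1 + s * ‖ξ‖) ^ 2) := by
  obtain ⟨C, hC, -, hlow, hhigh, hd⟩ := exists_symbol_bounds φ hφ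
  refine ⟨2 * C ^ 3, by positivity, fun t' t s ht' ht's hst ξ => ?_⟩
  have hs : 0 < s := ht'.trans ht's
  have ht : 0 < t := hs.trans_le hst
  set y := ‖ξ‖
  have hy : 0 ≤ y := norm_nonneg ξ
  set w := scaleWeight t' t s with hw
  have hwpos : 0 < w := scaleWeight_pos ht' (ht's.le.trans hst)
  have hw1 : w⁻¹ ≤ t := by
    refine inv_le_of_inv_le₀ ht ?_
    rw [hw]
    unfold scaleWeight
    rw [one_div]
    have : 0 ≤ t' / s ^ 2 := by positivity
    linarith
  have hw2 : w⁻¹ ≤ s ^ 2 / t' := by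
    refine inv_le_of_inv_le₀ (by positivity) ?_
    rw [hw, inv_div]
    unfold scaleWeight
    have : 0 ≤ 1 / t := by positivity
    linarith
  have hq : ‖cutoffSymbol φ t' t ξ‖ ^ 2 ≤
      2 * ‖1 - symbol φ (t' • ξ)‖ ^ 2 + 2 * ‖symbol φ (t • ξ)‖ ^ 2 := by
    have h1 : cutoffSymbol φ t' t ξ = (1 - symbol φ (t' • ξ)) + symbol φ (t • ξ) := by
      unfold cutoffSymbol
      ring
    rw [h1]
    have h2 := norm_add_le (1 - symbol φ (t' • ξ)) (symbol φ (t • ξ))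
    have h3 := norm_nonneg ((1 - symbol φ (t' • ξ)) + symbol φ (t • ξ))
    nlinarith [sq_nonneg (‖1 - symbol φ (t' • ξ)‖ - ‖symbol φ (t • ξ)‖)]
  have hlow' : t * y * ‖symbol φ (t • ξ)‖ ^ 2 ≤ C := by
    have := hlow (t • ξ)
    rwa [norm_smul, Real.norm_of_nonneg ht.le] at this
  have hhigh' : ‖1 - symbol φ (t' • ξ)‖ ^ 2 ≤ C * (t' * y) := by
    have := hhigh (t' • ξ)
    rwa [norm_smul, Real.norm_of_nonneg ht'.le] at this
  have hmain : w⁻¹ * ‖cutoffSymbol φ t' t ξ‖ ^ 2 * y ≤ 2 * C * (1 + (s * y) ^ 2) := by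
    have e1 : w⁻¹ * ‖1 - symbol φ (t' • ξ)‖ ^ 2 * y ≤ C * (s * y) ^ 2 := by
      calc w⁻¹ * ‖1 - symbol φ (t' • ξ)‖ ^ 2 * y ≤ (s ^ 2 / t') * (C * (t' * y)) * y := by gcongr
        _ = C * (s * y) ^ 2 := by field_simp
    have e2 : w⁻¹ * ‖symbol φ (t • ξ)‖ ^ 2 * y ≤ C := by
      calc w⁻¹ * ‖symbol φ (t • ξ)‖ ^ 2 * y ≤ t * ‖symbol φ (t • ξ)‖ ^ 2 * y := by gcongr
        _ = t * y * ‖symbol φ (t • ξ)‖ ^ 2 := by ring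
        _ ≤ C := hlow'
    calc w⁻¹ * ‖cutoffSymbol φ t' t ξ‖ ^ 2 * y
        ≤ w⁻¹ * (2 * ‖1 - symbol φ (t' • ξ)‖ ^ 2 + 2 * ‖symbol φ (t • ξ)‖ ^ 2) * y := by gcongr
      _ = 2 * (w⁻¹ * ‖1 - symbol φ (t' • ξ)‖ ^ 2 * y) +
            2 * (w⁻¹ * ‖symbol φ (t • ξ)‖ ^ 2 * y) := by ring
      _ ≤ 2 * (C * (s * y) ^ 2) + 2 * C := by gcongr
      _ = _ := by ring
  have hD := norm_symbolDeriv_le φ hd hs ξ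
  calc w⁻¹ * ‖symbolDeriv φ s ξ * cutoffSymbol φ t' t ξ‖ ^ 2
      = ‖symbolDeriv φ s ξ‖ ^ 2 * (w⁻¹ * ‖cutoffSymbol φ t' t ξ‖ ^ 2) := by
        rw [norm_mul]
        ring
    _ ≤ (C * (y / (1 + s * y) ^ 2)) ^ 2 * (w⁻¹ * ‖cutoffSymbol φ t' t ξ‖ ^ 2) := by gcongr
    _ = C ^ 2 * (y / (1 + s * y) ^ 4) * (w⁻¹ * ‖cutoffSymbol φ t' t ξ‖ ^ 2 * y) := by
        field_simp
    _ ≤ C ^ 2 * (y / (1 + s * y) ^ 4) * (2 * C * (1 + (s * y) ^ 2)) := by gcongr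
    _ ≤ C ^ 2 * (y / (1 + s * y) ^ 4) * (2 * C * (1 + s * y) ^ 2) := by
        gcongr
        nlinarith [mul_nonneg hs.le hy]
    _ = 2 * C ^ 3 * (y / (1 + s * y) ^ 2) := by
        have : 1 + s * y ≠ 0 := by positivity
        field_simp

lemma exists_tsum_lintegral_symbolDeriv_le (hφ : ∫ x, φ x = 1) : ∃ K : ℝ≥0, ∀ t : ℕ → ℝ,
    (∀ i, 0 < t i) → Antitone t → ∀ ξ : EuclideanSpace ℝ (Fin n),
      ∑' i, ∫⁻ s in Set.Ioc (t (i + 1)) (t i),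
        (ENNReal.ofReal (scaleWeight (t (i + 1)) (t i) s))⁻¹ *
          ‖symbolDeriv φ s ξ * cutoffSymbol φ (t (i + 1)) (t i) ξ‖ₑ ^ 2 ≤ K := by
  obtain ⟨K, hK, h⟩ := exists_inv_scaleWeight_mul_le φ hφ
  refine ⟨K.toNNReal, fun t ht hanti ξ => ?_⟩
  calc ∑' i, ∫⁻ s in Set.Ioc (t (i + 1)) (t i),
        (ENNReal.ofReal (scaleWeight (t (i + 1)) (t i) s))⁻¹ *
          ‖symbolDeriv φ s ξ * cutoffSymbol φ (t (i + 1)) (t i) ξ‖ₑ ^ 2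
      ≤ ∑' i, ∫⁻ s in Set.Ioc (t (i + 1)) (t i),
          ENNReal.ofReal K * ENNReal.ofReal (‖ξ‖ / (1 + s * ‖ξ‖) ^ 2) := by
        refine ENNReal.tsum_le_tsum fun i => setLIntegral_mono' measurableSet_Ioc fun s hs => ?_
        rw [← ENNReal.ofReal_inv_of_pos (scaleWeight_pos (ht _) (hanti (Nat.le_succ i))),
          ← ofReal_norm, ← ENNReal.ofReal_pow (norm_nonneg _),
          ← ENNReal.ofReal_mul (inv_nonneg.2 (scaleWeight_pos (ht _) (hanti (Nat.le_succ i))).le),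
          ← ENNReal.ofReal_mul hK.le]
        exact ENNReal.ofReal_le_ofReal (h _ _ s (ht _) hs.1 hs.2 ξ)
    _ ≤ ENNReal.ofReal K * 1 := by
        refine (tsum_lintegral_Ioc_le ht hanti _).trans ?_
        rw [lintegral_const_mul' _ _ ENNReal.ofReal_ne_top]
        exact mul_le_mul' le_rfl (lintegral_Ioi_div_one_add_mul_sq_le (norm_nonneg ξ))
    _ = _ := by rw [mul_one]; rfl

end OscillationL2

/-! ### The oscillation operator on `L²` -/

section OscillationL2Bound

open scoped FourierTransform

variable {n : ℕ} (φ : 𝓢(EuclideanSpace ℝ (Fin n), ℝ)) {f : EuclideanSpace ℝ (Fin n) → ℝ}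

lemma exists_norm_cutoffSymbol_mul_fourier_le (f : EuclideanSpace ℝ (Fin n) → ℝ) (t' t : ℝ) :
    ∃ M : ℝ, ∀ ξ, ‖cutoffSymbol φ t' t ξ * 𝓕 (fun x => (f x : ℂ)) ξ‖ ≤ M := by
  obtain ⟨C, hC, h⟩ := (symbol φ).exists_norm_le_div_one_add_pow 0
  simp only [pow_zero, div_one] at h
  refine ⟨(1 + (C + C)) * ∫ x, ‖f x‖, fun ξ => ?_⟩
  rw [norm_mul]
  refine mul_le_mul ?_ ?_ (norm_nonneg _) (by positivity)
  · unfold cutoffSymbol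
    refine (norm_sub_le _ _).trans ?_
    rw [norm_one]
    have := norm_sub_le (symbol φ (t' • ξ)) (symbol φ (t • ξ))
    linarith [h (t' • ξ), h (t • ξ)]
  · exact norm_fourier_ofReal_le f ξ

lemma lintegral_approxIdentity_sub_sq (hf : Integrable f) {a b : ℝ} (ha : 0 < a) (hb : 0 < b) :
    ∫⁻ x, ‖approxIdentity φ a f x - approxIdentity φ b f x‖ₑ ^ 2 =
      ∫⁻ ξ, ‖symbol φ (a • ξ) - symbol φ (b • ξ)‖ₑ ^ 2 * ‖𝓕 (fun x => (f x : ℂ)) ξ‖ₑ ^ 2 := by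
  set F := 𝓕 (fun x => (f x : ℂ)) with hF
  have hia := integrable_mul_fourier (integrable_symbol_smul φ ha) hf
  have hib := integrable_mul_fourier (integrable_symbol_smul φ hb) hf
  have h1 : ∀ x, ‖approxIdentity φ a f x - approxIdentity φ b f x‖ₑ =
      ‖𝓕⁻ (fun ξ => symbol φ (a • ξ) * F ξ - symbol φ (b • ξ) * F ξ) x‖ₑ := by
    intro x
    rw [fourierInv_sub_apply hia hib, ← ofReal_approxIdentity_eq_fourierInv φ hf ha,
      ← ofReal_approxIdentity_eq_fourierInv φ hf hb, ← Complex.ofReal_sub,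
      ← ofReal_norm, ← ofReal_norm, Complex.norm_real]
  obtain ⟨M, hM⟩ := exists_norm_cutoffSymbol_mul_fourier_le φ f a b
  have hM' : ∀ ξ, ‖F ξ‖ ≤ ∫ x, ‖f x‖ := norm_fourier_ofReal_le f
  have hint : Integrable fun ξ => symbol φ (a • ξ) * F ξ - symbol φ (b • ξ) * F ξ := hia.sub hib
  have hbdd : ∀ ξ, ‖symbol φ (a • ξ) * F ξ - symbol φ (b • ξ) * F ξ‖ ≤
      (∫ x, ‖f x‖) + M := by
    intro ξ
    have : symbol φ (a • ξ) * F ξ - symbol φ (b • ξ) * F ξ = F ξ - cutoffSymbol φ a b ξ * F ξ := by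
      unfold cutoffSymbol
      ring
    rw [this]
    exact (norm_sub_le _ _).trans (add_le_add (hM' ξ) (hM ξ))
  simp only [h1]
  rw [lintegral_enorm_fourierInv_sq hint (memLp_two_of_integrable_of_bounded hint hbdd)]
  refine lintegral_congr fun ξ => ?_
  rw [← sub_mul, enorm_mul, mul_pow]

lemma fourier_ofReal_approxIdentity_sub (hf : Integrable f) {a b : ℝ} (ha : 0 < a) (hb : 0 < b)
    (ξ : EuclideanSpace ℝ (Fin n)) :
    𝓕 (fun x => ((approxIdentity φ a f x - approxIdentity φ b f x : ℝ) : ℂ)) ξ =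
      (symbol φ (a • ξ) - symbol φ (b • ξ)) * 𝓕 (fun x => (f x : ℂ)) ξ := by
  rw [sub_mul, ← fourier_ofReal_approxIdentity φ hf ha, ← fourier_ofReal_approxIdentity φ hf hb]
  simp only [Real.fourier_eq, Complex.ofReal_sub, smul_sub]
  have h1 : Integrable fun x => (approxIdentity φ a f x : ℂ) :=
    (integrable_approxIdentity φ hf ha).ofReal
  have h2 : Integrable fun x => (approxIdentity φ b f x : ℂ) :=
    (integrable_approxIdentity φ hf hb).ofReal
  exact integral_sub ((Real.fourierIntegral_convergent_iff ξ).2 h1)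
    ((Real.fourierIntegral_convergent_iff ξ).2 h2)

/-- Splitting `f` into the piece `Φ_{t'} f - Φ_t f` and the rest, whose frequencies are essentially
outside the range belonging to the scales in `[t', t]`. -/
lemma enorm_approxIdentity_sub_le (hf : Integrable f) {t' t a b : ℝ} (ht' : 0 < t')
    (htb : t' ≤ b) (hba : b ≤ a) (hat : a ≤ t) (x : EuclideanSpace ℝ (Fin n)) :
    ‖approxIdentity φ a f x - approxIdentity φ b f x‖ₑ ≤
      (‖approxIdentity φ a (fun z => approxIdentity φ t' f z - approxIdentity φ t f z) x‖ₑ +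
        ‖approxIdentity φ b (fun z => approxIdentity φ t' f z - approxIdentity φ t f z) x‖ₑ) +
      ∫⁻ s in Set.Ioc t' t, ‖𝓕⁻ (fun ξ => symbolDeriv φ s ξ *
        (cutoffSymbol φ t' t ξ * 𝓕 (fun x => (f x : ℂ)) ξ)) x‖ₑ := by
  have hb : 0 < b := ht'.trans_le htb
  have ha : 0 < a := hb.trans_le hba
  have ht : 0 < t := ha.trans_le hat
  set F := 𝓕 (fun x => (f x : ℂ)) with hF
  set g := fun z => approxIdentity φ t' f z - approxIdentity φ t f z with hg
  have hgi : Integrable g :=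
    (integrable_approxIdentity φ hf ht').sub (integrable_approxIdentity φ hf ht)
  have hgF : ∀ ξ, 𝓕 (fun x => (g x : ℂ)) ξ = (symbol φ (t' • ξ) - symbol φ (t • ξ)) * F ξ :=
    fun ξ => fourier_ofReal_approxIdentity_sub φ hf ht' ht ξ
  have hia := integrable_mul_fourier (integrable_symbol_smul φ ha) hf
  have hib := integrable_mul_fourier (integrable_symbol_smul φ hb) hf
  have hja := integrable_mul_fourier (integrable_symbol_smul φ ha) hgi
  have hjb := integrable_mul_fourier (integrable_symbol_smul φ hb) hgi
  have hident : ((approxIdentity φ a f x - approxIdentity φ b f x : ℝ) : ℂ) =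
      ((approxIdentity φ a g x : ℂ) - (approxIdentity φ b g x : ℂ)) +
        𝓕⁻ (fun ξ => (symbol φ (a • ξ) - symbol φ (b • ξ)) * (cutoffSymbol φ t' t ξ * F ξ)) x := by
    have h1 : (fun ξ => (symbol φ (a • ξ) - symbol φ (b • ξ)) * (cutoffSymbol φ t' t ξ * F ξ)) =
        fun ξ => (symbol φ (a • ξ) * F ξ - symbol φ (b • ξ) * F ξ) -
          (symbol φ (a • ξ) * 𝓕 (fun x => (g x : ℂ)) ξ -
            symbol φ (b • ξ) * 𝓕 (fun x => (g x : ℂ)) ξ) := by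
      ext ξ
      rw [hgF]
      unfold cutoffSymbol
      ring
    have hsf : Integrable fun ξ => symbol φ (a • ξ) * F ξ - symbol φ (b • ξ) * F ξ := hia.sub hib
    have hsg : Integrable fun ξ => symbol φ (a • ξ) * 𝓕 (fun x => (g x : ℂ)) ξ -
        symbol φ (b • ξ) * 𝓕 (fun x => (g x : ℂ)) ξ := hja.sub hjb
    rw [h1, fourierInv_sub_apply hsf hsg, fourierInv_sub_apply hia hib,
      fourierInv_sub_apply hja hjb, ← ofReal_approxIdentity_eq_fourierInv φ hf ha,
      ← ofReal_approxIdentity_eq_fourierInv φ hf hb,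
      ← ofReal_approxIdentity_eq_fourierInv φ hgi ha,
      ← ofReal_approxIdentity_eq_fourierInv φ hgi hb]
    push_cast
    ring
  have hreal : ∀ r : ℝ, ‖(r : ℂ)‖ₑ = ‖r‖ₑ := fun r => by
    rw [← ofReal_norm, ← ofReal_norm, Complex.norm_real]
  obtain ⟨M, hM⟩ := exists_norm_cutoffSymbol_mul_fourier_le φ f t' t
  have hcont : Continuous fun ξ => cutoffSymbol φ t' t ξ * F ξ :=
    (continuous_cutoffSymbol φ t' t).mul (continuous_fourier_of_integrable hf.ofReal)
  rw [← hreal, hident]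
  refine (enorm_add_le _ _).trans (add_le_add ?_ ?_)
  · refine (enorm_sub_le).trans ?_
    rw [hreal, hreal]
  · refine (enorm_fourierInv_symbol_sub_le φ hcont hM hb hba x).trans ?_
    exact lintegral_mono_set (Set.Ioc_subset_Ioc htb hat)

/-- The `L²` norm of the square function over the scales between `t'` and `t`, on the Fourier
side. -/
lemma lintegral_sq_lintegral_fourierInv_le (hf : Integrable f) {t' t : ℝ} (ht' : 0 < t')
    (ht : t' ≤ t) :
    ∫⁻ x, (∫⁻ s in Set.Ioc t' t, ‖𝓕⁻ (fun ξ => symbolDeriv φ s ξ *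
        (cutoffSymbol φ t' t ξ * 𝓕 (fun x => (f x : ℂ)) ξ)) x‖ₑ) ^ 2 ≤
      2 * ∫⁻ ξ, (∫⁻ s in Set.Ioc t' t, (ENNReal.ofReal (scaleWeight t' t s))⁻¹ *
        ‖symbolDeriv φ s ξ * cutoffSymbol φ t' t ξ‖ₑ ^ 2) * ‖𝓕 (fun x => (f x : ℂ)) ξ‖ₑ ^ 2 := by
  set F := 𝓕 (fun x => (f x : ℂ)) with hF
  have hFc : Continuous F := continuous_fourier_of_integrable hf.ofReal
  set h := fun ξ => cutoffSymbol φ t' t ξ * F ξ with hh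
  have hcont : Continuous h := (continuous_cutoffSymbol φ t' t).mul hFc
  obtain ⟨M, hM⟩ := exists_norm_cutoffSymbol_mul_fourier_le φ f t' t
  have hmeas := measurable_enorm_fourierInv_symbolDeriv φ hcont
  have hwm : Measurable fun s => ENNReal.ofReal (scaleWeight t' t s) :=
    (measurable_scaleWeight t' t).ennreal_ofReal
  have hplanch : ∀ s ∈ Set.Ioc t' t, ∫⁻ x, ‖𝓕⁻ (fun ξ => symbolDeriv φ s ξ * h ξ) x‖ₑ ^ 2 =
      ∫⁻ ξ, ‖symbolDeriv φ s ξ * h ξ‖ₑ ^ 2 := by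
    intro s hs
    have hs0 : 0 < s := ht'.trans hs.1
    have hi : Integrable fun ξ => symbolDeriv φ s ξ * h ξ :=
      (integrable_symbolDeriv φ hs0).mul_bdd (c := M) hcont.aestronglyMeasurable
        (Eventually.of_forall hM)
    obtain ⟨C, hC, hD⟩ := exists_norm_symbolDeriv_le φ s hs0
    refine lintegral_enorm_fourierInv_sq hi
      (memLp_two_of_integrable_of_bounded hi (M := C * M) fun ξ => ?_)
    rw [norm_mul]
    refine mul_le_mul ((hD s le_rfl ξ).trans ?_) (hM ξ) (norm_nonneg _) hC.le
    refine mul_le_of_le_one_right hC.le ((poissonWeight_le one_pos ξ).trans ?_)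
    simp
  calc ∫⁻ x, (∫⁻ s in Set.Ioc t' t, ‖𝓕⁻ (fun ξ => symbolDeriv φ s ξ * h ξ) x‖ₑ) ^ 2
      ≤ ∫⁻ x, 2 * ∫⁻ s in Set.Ioc t' t, (ENNReal.ofReal (scaleWeight t' t s))⁻¹ *
          ‖𝓕⁻ (fun ξ => symbolDeriv φ s ξ * h ξ) x‖ₑ ^ 2 := by
        refine lintegral_mono fun x => ?_
        refine (lintegral_sq_le_mul_lintegral _ hwm.aemeasurable
          (hmeas.comp (measurable_id.prodMk measurable_const)).aemeasurable ?_ ?_).trans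
          (mul_le_mul' (lintegral_scaleWeight_le ht' ht) le_rfl)
        · exact Eventually.of_forall fun s => (ENNReal.ofReal_pos.2 (scaleWeight_pos ht' ht)).ne'
        · exact Eventually.of_forall fun s => ENNReal.ofReal_ne_top
    _ = 2 * ∫⁻ s in Set.Ioc t' t, ∫⁻ x, (ENNReal.ofReal (scaleWeight t' t s))⁻¹ *
          ‖𝓕⁻ (fun ξ => symbolDeriv φ s ξ * h ξ) x‖ₑ ^ 2 := by
        rw [lintegral_const_mul' _ _ (by norm_num), lintegral_lintegral_swap]
        refine Measurable.aemeasurable ?_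
        exact ((hwm.comp measurable_snd).inv).mul ((hmeas.comp measurable_swap).pow_const 2)
    _ = 2 * ∫⁻ s in Set.Ioc t' t, ∫⁻ ξ, ((ENNReal.ofReal (scaleWeight t' t s))⁻¹ *
          ‖symbolDeriv φ s ξ * cutoffSymbol φ t' t ξ‖ₑ ^ 2) * ‖F ξ‖ₑ ^ 2 := by
        congr 1
        refine setLIntegral_congr_fun measurableSet_Ioc fun s hs => ?_
        have hw : (ENNReal.ofReal (scaleWeight t' t s))⁻¹ ≠ ∞ :=
          ENNReal.inv_ne_top.2 (ENNReal.ofReal_pos.2 (scaleWeight_pos ht' ht)).ne'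
        simp only [mul_assoc]
        rw [lintegral_const_mul' _ _ hw, lintegral_const_mul' _ _ hw, hplanch s hs]
        congr 1
        refine lintegral_congr fun ξ => ?_
        simp only [hh, enorm_mul]
        ring
    _ = 2 * ∫⁻ ξ, ∫⁻ s in Set.Ioc t' t, ((ENNReal.ofReal (scaleWeight t' t s))⁻¹ *
          ‖symbolDeriv φ s ξ * cutoffSymbol φ t' t ξ‖ₑ ^ 2) * ‖F ξ‖ₑ ^ 2 := by
        congr 1
        refine lintegral_lintegral_swap (Measurable.aemeasurable ?_)
        refine Measurable.mul (Measurable.mul (hwm.comp measurable_fst).inv ?_) ?_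
        · exact (((continuous_symbolDeriv φ).mul ((continuous_cutoffSymbol φ t' t).comp
            continuous_snd)).enorm.measurable).pow_const 2
        · exact ((hFc.comp continuous_snd).enorm.measurable).pow_const 2
    _ = _ := by
        congr 1
        refine lintegral_congr fun ξ => ?_
        exact lintegral_mul_const' _ _ (ENNReal.pow_ne_top enorm_ne_top)

/-- The oscillation operator is bounded on `L²`, uniformly in the sequence of scales. On the block
between `t (i + 1)` and `t i`, the piece `g i = Φ_{t (i+1)} f - Φ_{t i} f` is treated by the maximal
function, and the remaining frequencies by the square function in the scale. -/
theorem exists_lintegral_oscillation_sq_le (hn : 1 ≤ n) (hφ : ∫ x, φ x = 1) : ∃ K : ℝ≥0,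
    ∀ t : ℕ → ℝ, (∀ i, 0 < t i) → Antitone t → ∀ f : EuclideanSpace ℝ (Fin n) → ℝ,
      Integrable f → MemLp f 2 →
        ∫⁻ x, oscillationOp (approxIdentity φ) t f x ^ 2 ≤ K * ∫⁻ x, ‖f x‖ₑ ^ 2 := by
  obtain ⟨K₁, hK₁⟩ := exists_tsum_enorm_symbol_sub_sq_le φ hφ
  obtain ⟨K₂, hK₂⟩ := exists_tsum_lintegral_symbolDeriv_le φ hφ
  obtain ⟨C, hC⟩ := exists_enorm_approxIdentity_le_ballMaximal φ
  have : Nontrivial (EuclideanSpace ℝ (Fin n)) := by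
    have : Nonempty (Fin n) := ⟨⟨0, hn⟩⟩
    infer_instance
  refine ⟨2 * (2 * C) ^ 2 * (Real.toNNReal (8 * 5 ^ n)) * K₁ + 2 * 2 * K₂,
    fun t ht hanti f hf hf2 => ?_⟩
  set F := 𝓕 (fun x => (f x : ℂ)) with hF
  have hFc : Continuous F := continuous_fourier_of_integrable hf.ofReal
  set g : ℕ → EuclideanSpace ℝ (Fin n) → ℝ :=
    fun i z => approxIdentity φ (t (i + 1)) f z - approxIdentity φ (t i) f z with hg
  have hgm : ∀ i, Measurable (g i) := fun i =>
    ((continuous_approxIdentity φ hf.poissonIntegrable (ht _)).sub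
      (continuous_approxIdentity φ hf.poissonIntegrable (ht _))).measurable
  set S : ℕ → EuclideanSpace ℝ (Fin n) → ℝ≥0∞ := fun i x =>
    ∫⁻ s in Set.Ioc (t (i + 1)) (t i), ‖𝓕⁻ (fun ξ => symbolDeriv φ s ξ *
        (cutoffSymbol φ (t (i + 1)) (t i) ξ * F ξ)) x‖ₑ with hS
  have hSm : ∀ i, Measurable (S i) := by
    intro i
    have := measurable_enorm_fourierInv_symbolDeriv φ
      ((continuous_cutoffSymbol φ (t (i + 1)) (t i)).mul hFc)
    exact Measurable.lintegral_prod_right' (this.comp measurable_swap)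
  have hpt : ∀ x, oscillationOp (approxIdentity φ) t f x ^ 2 ≤
      ∑' i, (2 * (2 * C * ballMaximal (fun z => ‖g i z‖ₑ) x) ^ 2 + 2 * S i x ^ 2) := by
    intro x
    unfold oscillationOp
    rw [← ENNReal.rpow_two, ← ENNReal.rpow_mul]
    norm_num only
    rw [ENNReal.rpow_one]
    refine ENNReal.tsum_le_tsum fun i => iSup_le fun a => iSup_le fun b => iSup_le fun hab => ?_
    have hb : 0 < b := (ht _).trans_le hab.1
    have ha : 0 < a := hb.trans hab.2.1
    refine (pow_le_pow_left' ((enorm_approxIdentity_sub_le φ hf (ht _) hab.1 hab.2.1.le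
      hab.2.2 x).trans (add_le_add (add_le_add (hC (g i) (hgm i).aemeasurable a ha x)
        (hC (g i) (hgm i).aemeasurable b hb x)) le_rfl)) 2).trans ?_
    refine (ennreal_add_sq_le _ _).trans (le_of_eq ?_)
    rw [← two_mul, ← mul_assoc]
  have hterm₁ : ∀ i, ∫⁻ x, 2 * (2 * C * ballMaximal (fun z => ‖g i z‖ₑ) x) ^ 2 ≤
      2 * (2 * C) ^ 2 * ENNReal.ofReal (8 * 5 ^ n) *
        ∫⁻ ξ, ‖symbol φ (t (i + 1) • ξ) - symbol φ (t i • ξ)‖ₑ ^ 2 * ‖F ξ‖ₑ ^ 2 := by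
    intro i
    have h1 := lintegral_ballMaximal_sq_le (hgm i).enorm
    rw [lintegral_approxIdentity_sub_sq φ hf (ht _) (ht _), finrank_euclideanSpace_fin] at h1
    simp only [mul_pow, ← mul_assoc]
    rw [lintegral_const_mul' _ _ (by finiteness), mul_assoc (2 * 2 ^ 2 * (C : ℝ≥0∞) ^ 2)]
    exact mul_le_mul' le_rfl h1
  have hterm₂ : ∀ i, ∫⁻ x, 2 * S i x ^ 2 ≤
      2 * (2 * ∫⁻ ξ, (∫⁻ s in Set.Ioc (t (i + 1)) (t i),
        (ENNReal.ofReal (scaleWeight (t (i + 1)) (t i) s))⁻¹ *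
          ‖symbolDeriv φ s ξ * cutoffSymbol φ (t (i + 1)) (t i) ξ‖ₑ ^ 2) * ‖F ξ‖ₑ ^ 2) := by
    intro i
    rw [lintegral_const_mul' _ _ (by norm_num)]
    exact mul_le_mul' le_rfl
      (lintegral_sq_lintegral_fourierInv_le φ hf (ht _) (hanti (Nat.le_succ i)))
  have hFm : Measurable fun ξ => ‖F ξ‖ₑ ^ 2 := hFc.enorm.measurable.pow_const 2
  have hplanch : ∫⁻ ξ, ‖F ξ‖ₑ ^ 2 = ∫⁻ x, ‖f x‖ₑ ^ 2 := by
    have h1 : Integrable fun x => (f x : ℂ) := hf.ofReal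
    have h2 : MemLp (fun x => (f x : ℂ)) 2 := hf2.ofReal
    rw [hF, lintegral_enorm_fourier_sq h1 h2]
    refine lintegral_congr fun x => ?_
    rw [← ofReal_norm, ← ofReal_norm, Complex.norm_real]
  -- summation over the blocks is carried out for each frequency
  have hsum : ∀ (a : ℕ → EuclideanSpace ℝ (Fin n) → ℝ≥0∞) (K : ℝ≥0), (∀ i, Measurable (a i)) →
      (∀ ξ, ∑' i, a i ξ ≤ K) → ∑' i, ∫⁻ ξ, a i ξ * ‖F ξ‖ₑ ^ 2 ≤ K * ∫⁻ x, ‖f x‖ₑ ^ 2 := by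
    intro a K ham haK
    have hm : ∀ i, AEMeasurable fun ξ => a i ξ * ‖F ξ‖ₑ ^ 2 :=
      fun i => ((ham i).mul hFm).aemeasurable
    rw [← lintegral_tsum hm, ← hplanch,
      ← lintegral_const_mul' _ _ ENNReal.coe_ne_top]
    refine lintegral_mono fun ξ => ?_
    rw [ENNReal.tsum_mul_right]
    exact mul_le_mul' (haK ξ) le_rfl
  have hm₁ : ∀ i, Measurable fun ξ => ‖symbol φ (t (i + 1) • ξ) - symbol φ (t i • ξ)‖ₑ ^ 2 :=
    fun i => ((continuous_symbol_smul φ _).sub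
      (continuous_symbol_smul φ _)).enorm.measurable.pow_const 2
  have hm₂ : ∀ i, Measurable fun ξ => ∫⁻ s in Set.Ioc (t (i + 1)) (t i),
        (ENNReal.ofReal (scaleWeight (t (i + 1)) (t i) s))⁻¹ *
          ‖symbolDeriv φ s ξ * cutoffSymbol φ (t (i + 1)) (t i) ξ‖ₑ ^ 2 := by
    intro i
    refine Measurable.lintegral_prod_right' (f := fun q : EuclideanSpace ℝ (Fin n) × ℝ =>
      (ENNReal.ofReal (scaleWeight (t (i + 1)) (t i) q.2))⁻¹ *
          ‖symbolDeriv φ q.2 q.1 * cutoffSymbol φ (t (i + 1)) (t i) q.1‖ₑ ^ 2) ?_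
    refine Measurable.mul
      (((measurable_scaleWeight _ _).comp measurable_snd).ennreal_ofReal).inv ?_
    exact ((((continuous_symbolDeriv φ).comp continuous_swap).mul
      ((continuous_cutoffSymbol φ _ _).comp continuous_fst)).enorm.measurable).pow_const 2
  calc ∫⁻ x, oscillationOp (approxIdentity φ) t f x ^ 2
      ≤ ∫⁻ x, ∑' i, (2 * (2 * C * ballMaximal (fun z => ‖g i z‖ₑ) x) ^ 2 + 2 * S i x ^ 2) :=
        lintegral_mono hpt
    _ = ∑' i, ((∫⁻ x, 2 * (2 * C * ballMaximal (fun z => ‖g i z‖ₑ) x) ^ 2) +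
          ∫⁻ x, 2 * S i x ^ 2) := by
        have hMm : ∀ i, Measurable fun x =>
            2 * (2 * C * ballMaximal (fun z => ‖g i z‖ₑ) x) ^ 2 := fun i =>
          (((measurable_ballMaximal _).const_mul _).pow_const 2).const_mul _
        have hSm' : ∀ i, Measurable fun x => 2 * S i x ^ 2 := fun i =>
          ((hSm i).pow_const 2).const_mul _
        have hadd : ∀ i, AEMeasurable fun x =>
            2 * (2 * C * ballMaximal (fun z => ‖g i z‖ₑ) x) ^ 2 + 2 * S i x ^ 2 :=
          fun i => ((hMm i).add (hSm' i)).aemeasurable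
        rw [lintegral_tsum hadd]
        exact tsum_congr fun i => lintegral_add_left (hMm i) _
    _ ≤ ∑' i, (2 * (2 * C) ^ 2 * ENNReal.ofReal (8 * 5 ^ n) *
          (∫⁻ ξ, ‖symbol φ (t (i + 1) • ξ) - symbol φ (t i • ξ)‖ₑ ^ 2 * ‖F ξ‖ₑ ^ 2) +
          2 * (2 * ∫⁻ ξ, (∫⁻ s in Set.Ioc (t (i + 1)) (t i),
            (ENNReal.ofReal (scaleWeight (t (i + 1)) (t i) s))⁻¹ *
              ‖symbolDeriv φ s ξ * cutoffSymbol φ (t (i + 1)) (t i) ξ‖ₑ ^ 2) * ‖F ξ‖ₑ ^ 2)) :=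
        ENNReal.tsum_le_tsum fun i => add_le_add (hterm₁ i) (hterm₂ i)
    _ ≤ 2 * (2 * C) ^ 2 * ENNReal.ofReal (8 * 5 ^ n) * (K₁ * ∫⁻ x, ‖f x‖ₑ ^ 2) +
          2 * (2 * (K₂ * ∫⁻ x, ‖f x‖ₑ ^ 2)) := by
        rw [ENNReal.tsum_add, ENNReal.tsum_mul_left, ENNReal.tsum_mul_left, ENNReal.tsum_mul_left]
        gcongr
        · exact hsum _ K₁ hm₁ (hK₁ t ht hanti)
        · exact hsum _ K₂ hm₂ (hK₂ t ht hanti)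
    _ = _ := by
        push_cast
        rw [ENNReal.ofReal]
        ring

end OscillationL2Bound

/-! ### Oscillation of a function of the scale -/

section ScaleOscillation

/-- The oscillation along the scales `t` of a function `G` of the scale, with values in `[0, ∞]`. -/
noncomputable def scaleOscillation (G : ℝ → ℝ) (t : ℕ → ℝ) : ℝ≥0∞ :=
  (∑' i : ℕ, ⨆ (a : ℝ) (b : ℝ) (_ : t (i + 1) ≤ b ∧ b < a ∧ a ≤ t i), ‖G a - G b‖ₑ ^ 2) ^
    (1 / 2 : ℝ)

lemma tsum_add_sq_rpow_le (u v : ℕ → ℝ≥0∞) :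
    (∑' i, (u i + v i) ^ 2) ^ (1 / 2 : ℝ) ≤
      (∑' i, u i ^ 2) ^ (1 / 2 : ℝ) + (∑' i, v i ^ 2) ^ (1 / 2 : ℝ) := by
  have h := ENNReal.lintegral_Lp_add_le (μ := Measure.count) (p := 2)
    (measurable_of_countable u).aemeasurable (measurable_of_countable v).aemeasurable (by norm_num)
  simpa only [lintegral_count, Pi.add_apply, ENNReal.rpow_two] using h

lemma tsum_sq_rpow_le (w : ℕ → ℝ≥0∞) : (∑' i, w i ^ 2) ^ (1 / 2 : ℝ) ≤ ∑' i, w i := by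
  have h : ∑' i, w i ^ 2 ≤ (∑' i, w i) ^ 2 := by
    rw [sq (∑' i, w i), ← ENNReal.tsum_mul_right]
    refine ENNReal.tsum_le_tsum fun i => ?_
    rw [sq]
    exact mul_le_mul' le_rfl (ENNReal.le_tsum i)
  refine (ENNReal.rpow_le_rpow h (by norm_num)).trans (le_of_eq ?_)
  rw [← ENNReal.rpow_two, ← ENNReal.rpow_mul]
  norm_num

lemma tsum_ofReal_sub_le {t : ℕ → ℝ} (ht : ∀ i, 0 < t i) (hanti : Antitone t) {h : ℝ → ℝ} {K : ℝ}
    (hh : AntitoneOn h (Set.Ioi 0)) (h0 : ∀ s, 0 < s → 0 ≤ h s) (hK : ∀ s, 0 < s → h s ≤ K) :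
    ∑' i, ENNReal.ofReal (h (t (i + 1)) - h (t i)) ≤ ENNReal.ofReal K := by
  refine ENNReal.tsum_le_of_sum_range_le fun m => ?_
  rw [← ENNReal.ofReal_sum_of_nonneg, Finset.sum_range_sub fun i => h (t i)]
  · refine ENNReal.ofReal_le_ofReal ?_
    linarith [hK _ (ht m), h0 _ (ht 0)]
  · intro i _
    exact sub_nonneg.2 (hh (ht _) (ht _) (hanti (Nat.le_succ i)))

/-- If the increments of `G` are bounded by those of `G₁` below the scale `r`, those of `G₂` above
the scale `r`, and those of a bounded monotone function, then so is its oscillation: the last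
contribution is summed in `ℓ¹`, where it telescopes. -/
lemma scaleOscillation_le {t : ℕ → ℝ} (ht : ∀ i, 0 < t i) (hanti : Antitone t) {h : ℝ → ℝ} {K : ℝ}
    (hh : AntitoneOn h (Set.Ioi 0)) (h0 : ∀ s, 0 < s → 0 ≤ h s) (hK : ∀ s, 0 < s → h s ≤ K)
    {G G₁ G₂ : ℝ → ℝ} (r : ℝ)
    (hG : ∀ a b, 0 < b → b ≤ a → a ≤ t 0 → ‖G a - G b‖ ≤ ‖G₁ (min a r) - G₁ (min b r)‖ +
      ‖G₂ (max a r) - G₂ (max b r)‖ + (h b - h a)) :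
    scaleOscillation G t ≤ scaleOscillation G₁ (fun i => min (t i) r) + scaleOscillation G₂ t +
      ENNReal.ofReal K := by
  set U : ℕ → ℝ≥0∞ := fun i => ⨆ (a : ℝ) (b : ℝ)
    (_ : min (t (i + 1)) r ≤ b ∧ b < a ∧ a ≤ min (t i) r), ‖G₁ a - G₁ b‖ₑ ^ 2 with hU
  set V : ℕ → ℝ≥0∞ := fun i => ⨆ (a : ℝ) (b : ℝ)
    (_ : t (i + 1) ≤ b ∧ b < a ∧ a ≤ t i), ‖G₂ a - G₂ b‖ₑ ^ 2 with hV
  set w : ℕ → ℝ≥0∞ := fun i => ENNReal.ofReal (h (t (i + 1)) - h (t i)) with hw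
  have hroot : ∀ X : ℝ≥0∞, (X ^ (1 / 2 : ℝ)) ^ 2 = X := by
    intro X
    rw [← ENNReal.rpow_two, ← ENNReal.rpow_mul]
    norm_num
  have hle : ∀ X Y : ℝ≥0∞, X ^ 2 ≤ Y → X ≤ Y ^ (1 / 2 : ℝ) := by
    intro X Y hXY
    refine le_trans (le_of_eq ?_) (ENNReal.rpow_le_rpow hXY (by norm_num))
    rw [← ENNReal.rpow_two, ← ENNReal.rpow_mul]
    norm_num
  have hU' : scaleOscillation G₁ (fun i => min (t i) r) =
      (∑' i, (U i ^ (1 / 2 : ℝ)) ^ 2) ^ (1 / 2 : ℝ) := by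
    simp only [hroot]
    rfl
  have hV' : scaleOscillation G₂ t = (∑' i, (V i ^ (1 / 2 : ℝ)) ^ 2) ^ (1 / 2 : ℝ) := by
    simp only [hroot]
    rfl
  have hterm : ∀ i, (⨆ (a : ℝ) (b : ℝ) (_ : t (i + 1) ≤ b ∧ b < a ∧ a ≤ t i),
      ‖G a - G b‖ₑ ^ 2) ≤ (U i ^ (1 / 2 : ℝ) + V i ^ (1 / 2 : ℝ) + w i) ^ 2 := by
    intro i
    refine iSup_le fun a => iSup_le fun b => iSup_le fun hab => pow_le_pow_left' ?_ 2
    have hb : 0 < b := (ht _).trans_le hab.1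
    have hat : a ≤ t 0 := hab.2.2.trans (hanti (Nat.zero_le i))
    have ha : 0 < a := hb.trans hab.2.1
    have hG' := ENNReal.ofReal_le_ofReal (hG a b hb hab.2.1.le hat)
    rw [ofReal_norm] at hG'
    refine hG'.trans (ENNReal.ofReal_add_le.trans (add_le_add
      (ENNReal.ofReal_add_le.trans (add_le_add ?_ ?_)) ?_))
    · rw [ofReal_norm]
      refine hle _ _ ?_
      rcases (min_le_min_right r hab.2.1.le).eq_or_lt with heq | hlt
      · rw [heq, sub_self, enorm_zero]
        simp
      · exact le_iSup_of_le (min a r) (le_iSup_of_le (min b r) (le_iSup_of_le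
          ⟨min_le_min_right r hab.1, hlt, min_le_min_right r hab.2.2⟩ le_rfl))
    · rw [ofReal_norm]
      refine hle _ _ ?_
      rcases (max_le_max_right r hab.2.1.le).eq_or_lt with heq | hlt
      · rw [heq, sub_self, enorm_zero]
        simp
      · have hra : r ≤ a := by
          by_contra! hcon
          rw [max_eq_right hcon.le] at hlt
          exact absurd (le_max_right b r) hlt.not_ge
        refine le_iSup_of_le (max a r) (le_iSup_of_le (max b r) (le_iSup_of_le
          ⟨hab.1.trans (le_max_left _ _), hlt, ?_⟩ le_rfl))
        rw [max_eq_left hra]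
        exact hab.2.2
    · refine ENNReal.ofReal_le_ofReal (sub_le_sub (hh (ht _) hb hab.1) ?_)
      exact hh ha (ht _) hab.2.2
  calc scaleOscillation G t
      ≤ (∑' i, (U i ^ (1 / 2 : ℝ) + V i ^ (1 / 2 : ℝ) + w i) ^ 2) ^ (1 / 2 : ℝ) :=
        ENNReal.rpow_le_rpow (ENNReal.tsum_le_tsum hterm) (by norm_num)
    _ ≤ _ := by
        rw [hU', hV']
        exact (tsum_add_sq_rpow_le _ _).trans (add_le_add (tsum_add_sq_rpow_le _ _)
          ((tsum_sq_rpow_le w).trans (tsum_ofReal_sub_le ht hanti hh h0 hK)))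

end ScaleOscillation

/-! ### Increments of the approximate identity on a ball -/

section BallIncrements

variable {n : ℕ} (φ : 𝓢(EuclideanSpace ℝ (Fin n), ℝ)) {f : EuclideanSpace ℝ (Fin n) → ℝ}

lemma integral_poissonWeight_mul_abs_sub_le {N : ℝ} (hf : LocallyIntegrable f) (hN0 : 0 ≤ N)
    (hN : bmoNorm f ≤ ENNReal.ofReal N) (c : EuclideanSpace ℝ (Fin n)) {r : ℝ} (hr : 0 < r) :
    ∫ z, poissonWeight r (z - c) * |f z - ⨍ y in Metric.ball c r, f y| ≤ bmoTailConst n * N := by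
  rw [integral_eq_lintegral_of_nonneg_ae (Eventually.of_forall fun z =>
    mul_nonneg (poissonWeight_nonneg hr _) (abs_nonneg _))]
  · refine ENNReal.toReal_le_of_le_ofReal (by positivity) ?_
    rw [ENNReal.ofReal_mul (by positivity), ENNReal.ofReal_coe_nnreal]
    refine le_trans (lintegral_mono fun z => ?_)
      (lintegral_poissonWeight_mul_sub_average_le hf hN c hr)
    rw [ENNReal.ofReal_mul (poissonWeight_nonneg hr _), Real.enorm_eq_ofReal_abs]
  · exact ((continuous_poissonWeight hr).comp (by fun_prop)).aestronglyMeasurable.mul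
      (hf.aestronglyMeasurable.sub aestronglyMeasurable_const).norm

lemma integrable_poissonWeight_mul_abs_sub (hf : PoissonIntegrable f)
    (c : EuclideanSpace ℝ (Fin n)) {r : ℝ} (hr : 0 < r) (m : ℝ) :
    Integrable fun z => poissonWeight r (z - c) * |f z - m| := by
  refine ((hf.sub (poissonIntegrable_const m)).2 r hr c).norm.congr
    (Eventually.of_forall fun z => ?_)
  simp only [norm_mul, Real.norm_of_nonneg (poissonWeight_nonneg hr _), Real.norm_eq_abs]

/-- On a ball, the part of the function outside the double ball contributes increments that are
proportional to those of the scale. -/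
lemma exists_abs_approxIdentity_indicator_compl_sub_le : ∃ C : ℝ, 0 < C ∧
    ∀ (f : EuclideanSpace ℝ (Fin n) → ℝ), PoissonIntegrable f → ∀ (m : ℝ)
      (c : EuclideanSpace ℝ (Fin n)) (r : ℝ), 0 < r → ∀ x ∈ Metric.ball c r,
      ∀ a b : ℝ, 0 < b → b ≤ a →
        |approxIdentity φ a ((Metric.ball c (2 * r))ᶜ.indicator fun z => f z - m) x -
          approxIdentity φ b ((Metric.ball c (2 * r))ᶜ.indicator fun z => f z - m) x| ≤
        C * (∫ z, poissonWeight (2 * r) (z - c) * |f z - m|) * ((a - b) / r) := by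
  obtain ⟨C, hC, h⟩ := exists_abs_dilate_sub_dilate_le φ
  refine ⟨C * 4 ^ (n + 1), by positivity, fun f hf m c r hr x hx a b hb hba => ?_⟩
  have ha : 0 < a := hb.trans_le hba
  have hr2 : 0 < 2 * r := by positivity
  have hf2 : PoissonIntegrable ((Metric.ball c (2 * r))ᶜ.indicator fun z => f z - m) :=
    (hf.sub (poissonIntegrable_const m)).indicator measurableSet_ball.compl
  have hW := integrable_poissonWeight_mul_abs_sub hf c hr2 m
  rw [approxIdentity_sub_eq_integral φ hf2 ha hb 0 x, ← Real.norm_eq_abs]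
  have hle : ∀ z, ‖(dilate φ a (x - z) - dilate φ b (x - z)) *
      ((Metric.ball c (2 * r))ᶜ.indicator (fun z => f z - m) z - 0)‖ ≤
      (C * 4 ^ (n + 1) * ((a - b) / r)) * (poissonWeight (2 * r) (z - c) * |f z - m|) := by
    intro z
    have hab : 0 ≤ a - b := sub_nonneg.2 hba
    have hp := poissonWeight_nonneg (n := n) hr2 (z - c)
    rw [sub_zero, norm_mul]
    by_cases hz : z ∈ Metric.ball c (2 * r)
    · simp only [Set.indicator_of_notMem (Set.notMem_compl_iff.2 hz), norm_zero, mul_zero]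
      positivity
    · rw [Set.indicator_of_mem (Set.mem_compl hz), Real.norm_eq_abs, Real.norm_eq_abs, ← mul_assoc]
      refine mul_le_mul_of_nonneg_right ((h a b hb hba _).trans ?_) (abs_nonneg _)
      rw [Metric.mem_ball, dist_eq_norm, not_lt] at hz
      rw [Metric.mem_ball, dist_eq_norm] at hx
      have htri : ‖z - c‖ ≤ ‖x - c‖ + ‖x - z‖ := by
        have := norm_sub_le (x - c) (x - z)
        rwa [sub_sub_sub_cancel_left] at this
      have hden : (2 * r + ‖z - c‖) / 4 ≤ b + ‖x - z‖ := by linarith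
      have hpos : 0 < 2 * r + ‖z - c‖ := by positivity
      calc C * (a - b) / (b + ‖x - z‖) ^ (n + 1)
          ≤ C * (a - b) / ((2 * r + ‖z - c‖) / 4) ^ (n + 1) := by gcongr
        _ = (C * 4 ^ (n + 1) * ((a - b) / r)) * (r / (2 * r + ‖z - c‖) ^ (n + 1)) := by
          rw [div_pow]
          field_simp
        _ ≤ (C * 4 ^ (n + 1) * ((a - b) / r)) * poissonWeight (2 * r) (z - c) := by
          unfold poissonWeight
          gcongr
          linarith
  refine (norm_integral_le_of_norm_le (hW.const_mul _) (Eventually.of_forall hle)).trans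
    (le_of_eq ?_)
  rw [integral_const_mul]
  ring

/-- Above the scale `r`, the increments at two points of a ball of radius `r` differ by those of a
bounded monotone function of the scale. -/
lemma exists_abs_approxIdentity_sub_sub_le : ∃ C : ℝ, 0 < C ∧
    ∀ (f : EuclideanSpace ℝ (Fin n) → ℝ), PoissonIntegrable f → ∀ (m : ℝ)
      (c : EuclideanSpace ℝ (Fin n)) (r : ℝ), 0 < r → ∀ x ∈ Metric.ball c r,
      ∃ H : ℝ → ℝ, AntitoneOn H (Set.Ici r) ∧ (∀ s, r ≤ s → 0 ≤ H s) ∧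
        (∀ s, r ≤ s → H s ≤ C * ∫ z, poissonWeight (2 * r) (z - c) * |f z - m|) ∧
        ∀ y ∈ Metric.ball c r, ∀ a b : ℝ, r ≤ b → b ≤ a →
          |(approxIdentity φ a f x - approxIdentity φ b f x) -
            (approxIdentity φ a f y - approxIdentity φ b f y)| ≤ H b - H a := by
  obtain ⟨C, hC, h⟩ := exists_abs_dilate_sub_sub_le φ
  refine ⟨C * 3 ^ (n + 1), by positivity, fun f hf m c r hr x hx => ?_⟩
  have hr2 : 0 < 2 * r := by positivity
  have hW := integrable_poissonWeight_mul_abs_sub hf c hr2 m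
  set k : ℝ → EuclideanSpace ℝ (Fin n) → ℝ := fun s z =>
    C * (r / (s + ‖x - z‖) ^ (n + 1)) * |f z - m| with hk
  have hk0 : ∀ s, r ≤ s → ∀ z, 0 ≤ k s z := by
    intro s hs z
    have : 0 < s := hr.trans_le hs
    positivity
  have hkle : ∀ s, r ≤ s → ∀ z,
      k s z ≤ C * 3 ^ (n + 1) * (poissonWeight (2 * r) (z - c) * |f z - m|) := by
    intro s hs z
    have hs0 : 0 < s := hr.trans_le hs
    rw [← mul_assoc]
    refine mul_le_mul_of_nonneg_right ?_ (abs_nonneg _)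
    rw [mul_assoc]
    refine mul_le_mul_of_nonneg_left ?_ hC.le
    rw [Metric.mem_ball, dist_eq_norm] at hx
    have htri : ‖z - c‖ ≤ ‖x - c‖ + ‖x - z‖ := by
      have := norm_sub_le (x - c) (x - z)
      rwa [sub_sub_sub_cancel_left] at this
    have hden : (2 * r + ‖z - c‖) / 3 ≤ s + ‖x - z‖ := by linarith [norm_nonneg (x - z)]
    have hpos : 0 < 2 * r + ‖z - c‖ := by positivity
    unfold poissonWeight
    calc r / (s + ‖x - z‖) ^ (n + 1) ≤ r / ((2 * r + ‖z - c‖) / 3) ^ (n + 1) := by gcongr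
      _ = 3 ^ (n + 1) * (r / (2 * r + ‖z - c‖) ^ (n + 1)) := by
        rw [div_pow]
        field_simp
      _ ≤ _ := by
        gcongr
        linarith
  have hkm : ∀ s, r ≤ s → AEStronglyMeasurable (k s) := by
    intro s hs
    have hs0 : 0 < s := hr.trans_le hs
    refine AEStronglyMeasurable.mul (Continuous.aestronglyMeasurable ?_)
      (hf.1.aestronglyMeasurable.sub aestronglyMeasurable_const).norm
    refine continuous_const.mul (continuous_const.div (by fun_prop) fun z => ?_)
    positivity
  have hki : ∀ s, r ≤ s → Integrable (k s) := fun s hs =>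
    (hW.const_mul (C * 3 ^ (n + 1))).mono' (hkm s hs) (Eventually.of_forall fun z => by
      rw [Real.norm_of_nonneg (hk0 s hs z)]
      exact hkle s hs z)
  refine ⟨fun s => ∫ z, k s z, ?_, fun s hs => integral_nonneg (hk0 s hs), ?_, ?_⟩
  · intro b hb a ha hba
    have hb0 : 0 < b := hr.trans_le hb
    refine integral_mono (hki a ha) (hki b hb) fun z => ?_
    simp only [hk]
    gcongr
  · intro s hs
    rw [← integral_const_mul]
    exact integral_mono (hki s hs) (hW.const_mul _) (hkle s hs)
  · intro y hy a b hb hba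
    have hb0 : 0 < b := hr.trans_le hb
    have ha0 : 0 < a := hb0.trans_le hba
    have hi : ∀ w, Integrable fun z => (dilate φ a (w - z) - dilate φ b (w - z)) * (f z - m) := by
      intro w
      have hfm := hf.sub (poissonIntegrable_const m)
      refine ((integrable_dilate_mul φ hfm ha0 w).sub (integrable_dilate_mul φ hfm hb0 w)).congr
        (Eventually.of_forall fun z => ?_)
      simp only [Pi.sub_apply]
      ring
    rw [approxIdentity_sub_eq_integral φ hf ha0 hb0 m x,
      approxIdentity_sub_eq_integral φ hf ha0 hb0 m y, ← integral_sub (hi x) (hi y),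
      ← integral_sub (hki b hb) (hki a (hb.trans hba)), ← Real.norm_eq_abs]
    refine norm_integral_le_of_norm_le ((hki b hb).sub (hki a (hb.trans hba)))
      (Eventually.of_forall fun z => ?_)
    rw [← sub_mul, norm_mul, Real.norm_eq_abs, Real.norm_eq_abs]
    simp only [hk]
    rw [← sub_mul, ← mul_sub]
    refine mul_le_mul_of_nonneg_right (h r a b hr hb hba _ _ ?_) (abs_nonneg _)
    rw [sub_sub_sub_cancel_right, ← dist_eq_norm]
    rw [Metric.mem_ball] at hx hy
    linarith [dist_triangle_right x y c]

/-- Control of the increments at a point of a ball of radius `r` by the local part of the function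
below the scale `r` and by the increments at any other point of the ball above the scale `r`. -/
lemma exists_norm_approxIdentity_sub_le : ∃ K : ℝ, 0 < K ∧
    ∀ (f : EuclideanSpace ℝ (Fin n) → ℝ) (N : ℝ), LocallyIntegrable f → 0 < N →
      bmoNorm f ≤ ENNReal.ofReal N → ∀ (c : EuclideanSpace ℝ (Fin n)) (r : ℝ), 0 < r →
      ∀ x ∈ Metric.ball c r, ∃ h : ℝ → ℝ, AntitoneOn h (Set.Ioi 0) ∧ (∀ s, 0 < s → 0 ≤ h s) ∧
        (∀ s, 0 < s → h s ≤ K * N) ∧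
        ∀ y ∈ Metric.ball c r, ∀ a b : ℝ, 0 < b → b ≤ a →
          ‖approxIdentity φ a f x - approxIdentity φ b f x‖ ≤
            ‖approxIdentity φ (min a r) ((Metric.ball c (2 * r)).indicator
                fun z => f z - ⨍ w in Metric.ball c (2 * r), f w) x -
              approxIdentity φ (min b r) ((Metric.ball c (2 * r)).indicator
                fun z => f z - ⨍ w in Metric.ball c (2 * r), f w) x‖ +
            ‖approxIdentity φ (max a r) f y - approxIdentity φ (max b r) f y‖ + (h b - h a) := by
  obtain ⟨C₁, hC₁, h₁⟩ := exists_abs_approxIdentity_indicator_compl_sub_le φ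
  obtain ⟨C₂, hC₂, h₂⟩ := exists_abs_approxIdentity_sub_sub_le φ
  refine ⟨(C₁ + C₂) * bmoTailConst n + 1, by positivity, fun f N hf hN0 hN c r hr x hx => ?_⟩
  have hfP := poissonIntegrable_of_bmoNorm_le hf hN
  have hr2 : 0 < 2 * r := by positivity
  set m := ⨍ w in Metric.ball c (2 * r), f w with hm
  set W := ∫ z, poissonWeight (2 * r) (z - c) * |f z - m| with hW
  have hWN : W ≤ bmoTailConst n * N := integral_poissonWeight_mul_abs_sub_le hf hN0.le hN c hr2
  have hW0 : 0 ≤ W := integral_nonneg fun z =>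
    mul_nonneg (poissonWeight_nonneg hr2 _) (abs_nonneg _)
  obtain ⟨H, hHanti, hH0, hHle, hHy⟩ := h₂ f hfP m c r hr x hx
  have hmin : ∀ s : ℝ, 0 < s → 0 < min s r := fun s hs => lt_min hs hr
  refine ⟨fun s => C₁ * W * ((r - min s r) / r) + H (max s r), ?_, ?_, ?_, ?_⟩
  · intro b _ a _ hba
    refine add_le_add ?_ (hHanti (le_max_right b r) (le_max_right a r) (max_le_max_right r hba))
    have := min_le_min_right r hba
    gcongr
  · intro s _
    have h1 : 0 ≤ r - min s r := sub_nonneg.2 (min_le_right _ _)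
    have := hH0 _ (le_max_right s r)
    positivity
  · intro s hs
    have h1 : (r - min s r) / r ≤ 1 := by
      rw [div_le_one hr]
      linarith [hmin s hs]
    have h2 := mul_le_mul_of_nonneg_left h1 (mul_nonneg hC₁.le hW0)
    have h3 := hHle _ (le_max_right s r)
    have h4 := mul_le_mul_of_nonneg_left hWN (add_nonneg hC₁.le hC₂.le)
    linarith
  · intro y hy a b hb hba
    have ha : 0 < a := hb.trans_le hba
    have hma := hmin a ha
    have hmb := hmin b hb
    set f₁ := (Metric.ball c (2 * r)).indicator fun z => f z - m with hf₁
    set f₂ := (Metric.ball c (2 * r))ᶜ.indicator fun z => f z - m with hf₂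
    have hfm := hfP.sub (poissonIntegrable_const m)
    have hP₁ : PoissonIntegrable f₁ := hfm.indicator measurableSet_ball
    have hP₂ : PoissonIntegrable f₂ := hfm.indicator measurableSet_ball.compl
    have hsplit : approxIdentity φ (min a r) f x - approxIdentity φ (min b r) f x =
        (approxIdentity φ (min a r) f₁ x - approxIdentity φ (min b r) f₁ x) +
          (approxIdentity φ (min a r) f₂ x - approxIdentity φ (min b r) f₂ x) := by
      have hadd : (fun z => f z - m) = fun z => f₁ z + f₂ z :=
        (Set.indicator_self_add_compl _ _).symm
      have h3 : approxIdentity φ (min a r) f x - approxIdentity φ (min b r) f x =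
          approxIdentity φ (min a r) (fun z => f z - m) x -
            approxIdentity φ (min b r) (fun z => f z - m) x := by
        rw [approxIdentity_sub_eq_integral φ hfP hma hmb m x,
          approxIdentity_sub_eq_integral φ hfm hma hmb 0 x]
        simp only [sub_zero]
      rw [h3, hadd, approxIdentity_add φ hP₁ hP₂ hma, approxIdentity_add φ hP₁ hP₂ hmb]
      ring
    have hclip : approxIdentity φ a f x - approxIdentity φ b f x =
        (approxIdentity φ (min a r) f x - approxIdentity φ (min b r) f x) +
          (approxIdentity φ (max a r) f x - approxIdentity φ (max b r) f x) := by
      have : ∀ s, approxIdentity φ s f x =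
          approxIdentity φ (min s r) f x + approxIdentity φ (max s r) f x -
            approxIdentity φ r f x := by
        intro s
        rcases le_total s r with hs | hs
        · rw [min_eq_left hs, max_eq_right hs]
          ring
        · rw [min_eq_right hs, max_eq_left hs]
          ring
      linarith [this a, this b]
    have e1 : ‖approxIdentity φ (min a r) f₂ x - approxIdentity φ (min b r) f₂ x‖ ≤
        C₁ * W * ((min a r - min b r) / r) :=
      h₁ f hfP m c r hr x hx (min a r) (min b r) hmb (min_le_min_right r hba)
    have e2 : ‖(approxIdentity φ (max a r) f x - approxIdentity φ (max b r) f x) -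
        (approxIdentity φ (max a r) f y - approxIdentity φ (max b r) f y)‖ ≤
          H (max b r) - H (max a r) :=
      hHy y hy (max a r) (max b r) (le_max_right _ _) (max_le_max_right r hba)
    have e3 : C₁ * W * ((r - min b r) / r) - C₁ * W * ((r - min a r) / r) =
        C₁ * W * ((min a r - min b r) / r) := by ring
    rw [hclip, hsplit]
    have e4 := norm_add_le ((approxIdentity φ (min a r) f₁ x - approxIdentity φ (min b r) f₁ x) +
          (approxIdentity φ (min a r) f₂ x - approxIdentity φ (min b r) f₂ x))
      (approxIdentity φ (max a r) f x - approxIdentity φ (max b r) f x)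
    have e5 := norm_add_le (approxIdentity φ (min a r) f₁ x - approxIdentity φ (min b r) f₁ x)
      (approxIdentity φ (min a r) f₂ x - approxIdentity φ (min b r) f₂ x)
    have e6 := norm_le_norm_add_norm_sub'
      (approxIdentity φ (max a r) f x - approxIdentity φ (max b r) f x)
      (approxIdentity φ (max a r) f y - approxIdentity φ (max b r) f y)
    linarith

end BallIncrements

/-! ### Oscillation of functions of bounded mean oscillation on a ball -/

section OscillationOnBall

variable {n : ℕ} (φ : 𝓢(EuclideanSpace ℝ (Fin n), ℝ)) {f : EuclideanSpace ℝ (Fin n) → ℝ}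

lemma oscillationOp_eq_scaleOscillation (t : ℕ → ℝ) (f : EuclideanSpace ℝ (Fin n) → ℝ)
    (x : EuclideanSpace ℝ (Fin n)) : oscillationOp (approxIdentity φ) t f x =
      scaleOscillation (fun s => approxIdentity φ s f x) t := rfl

/-- The oscillation operator is a power of a lower semicontinuous function. -/
lemma measurable_oscillationOp (hf : PoissonIntegrable f) {t : ℕ → ℝ} (ht : ∀ i, 0 < t i) :
    Measurable (oscillationOp (approxIdentity φ) t f) := by
  refine Measurable.pow_const (LowerSemicontinuous.measurable ?_) _
  refine lowerSemicontinuous_tsum fun i => lowerSemicontinuous_iSup fun a =>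
    lowerSemicontinuous_iSup fun b => lowerSemicontinuous_iSup fun hab => ?_
  have hb : 0 < b := (ht _).trans_le hab.1
  refine Continuous.lowerSemicontinuous ((ENNReal.continuous_pow 2).comp ?_)
  exact ((continuous_approxIdentity φ hf (hb.trans hab.2.1)).sub
    (continuous_approxIdentity φ hf hb)).enorm

/-- The part of `f - f_{2B}` that lives on the double `2B` of the ball `B = B(c, r)`. -/
noncomputable def localPart (f : EuclideanSpace ℝ (Fin n) → ℝ) (c : EuclideanSpace ℝ (Fin n))
    (r : ℝ) : EuclideanSpace ℝ (Fin n) → ℝ :=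
  (Metric.ball c (2 * r)).indicator fun z => f z - ⨍ w in Metric.ball c (2 * r), f w

lemma PoissonIntegrable.localPart (hf : PoissonIntegrable f) (c : EuclideanSpace ℝ (Fin n))
    (r : ℝ) : PoissonIntegrable (localPart f c r) :=
  (hf.sub (poissonIntegrable_const _)).indicator measurableSet_ball

/-- The oscillation at two points of a ball, and its size at one point when the ball is at least as
large as all the scales, up to the oscillation of the local part at the scales below the radius. -/
lemma exists_oscillationOp_le : ∃ K : ℝ, 0 < K ∧
    ∀ t : ℕ → ℝ, (∀ i, 0 < t i) → Antitone t →
      ∀ (f : EuclideanSpace ℝ (Fin n) → ℝ) (N : ℝ), LocallyIntegrable f → 0 < N →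
      bmoNorm f ≤ ENNReal.ofReal N → ∀ (c : EuclideanSpace ℝ (Fin n)) (r : ℝ), 0 < r →
      ∀ x ∈ Metric.ball c r,
        (∀ y ∈ Metric.ball c r, oscillationOp (approxIdentity φ) t f x ≤
          oscillationOp (approxIdentity φ) (fun i => min (t i) r) (localPart f c r) x +
            oscillationOp (approxIdentity φ) t f y + ENNReal.ofReal (K * N)) ∧
        (t 0 ≤ r → oscillationOp (approxIdentity φ) t f x ≤
          oscillationOp (approxIdentity φ) (fun i => min (t i) r) (localPart f c r) x +
            ENNReal.ofReal (K * N)) := by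
  obtain ⟨K, hK, hmain⟩ := exists_norm_approxIdentity_sub_le φ
  refine ⟨K, hK, fun t ht hanti f N hf hN0 hN c r hr x hx => ?_⟩
  obtain ⟨h, hh, h0, hle, hxy⟩ := hmain f N hf hN0 hN c r hr x hx
  simp only [oscillationOp_eq_scaleOscillation]
  refine ⟨fun y hy => ?_, fun htr => ?_⟩
  · exact scaleOscillation_le (G₁ := fun s => approxIdentity φ s (localPart f c r) x)
      ht hanti hh h0 hle r fun a b hb hba _ => hxy y hy a b hb hba
  · have hz : scaleOscillation (fun _ => 0) t = 0 := by
      simp [scaleOscillation]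
    rw [← add_zero (scaleOscillation _ fun i => min (t i) r), ← hz]
    refine scaleOscillation_le (G₁ := fun s => approxIdentity φ s (localPart f c r) x)
      ht hanti hh h0 hle r fun a b hb hba hat => ?_
    have h1 := hxy x hx a b hb hba
    rw [max_eq_right (hat.trans htr), max_eq_right ((hba.trans hat).trans htr), sub_self] at h1
    rwa [sub_self]

lemma ennreal_le_add_sq_mul_inv (a : ℝ≥0∞) {N : ℝ} (hN : 0 < N) :
    a ≤ ENNReal.ofReal N + (ENNReal.ofReal N)⁻¹ * a ^ 2 := by
  have h0 : ENNReal.ofReal N ≠ 0 := (ENNReal.ofReal_pos.2 hN).ne'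
  rcases le_total a (ENNReal.ofReal N) with h | h
  · exact le_add_right h
  · refine le_add_left ?_
    calc a = (ENNReal.ofReal N)⁻¹ * (ENNReal.ofReal N * a) := by
          rw [← mul_assoc, ENNReal.inv_mul_cancel h0 ENNReal.ofReal_ne_top, one_mul]
      _ ≤ (ENNReal.ofReal N)⁻¹ * a ^ 2 := by
          rw [sq]
          gcongr

/-- The mean over a ball of the oscillation of the local part: this combines the `L²` bound with
the John–Nirenberg inequality. -/
lemma exists_lintegral_oscillationOp_localPart_le (hn : 1 ≤ n) (hφ : ∫ x, φ x = 1) :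
    ∃ K : ℝ, 0 < K ∧ ∀ t : ℕ → ℝ, (∀ i, 0 < t i) → Antitone t →
      ∀ (f : EuclideanSpace ℝ (Fin n) → ℝ) (N : ℝ), LocallyIntegrable f → 0 < N →
      bmoNorm f ≤ ENNReal.ofReal N → ∀ (c : EuclideanSpace ℝ (Fin n)) (r : ℝ), 0 < r →
        ∫⁻ x in Metric.ball c r, oscillationOp (approxIdentity φ) t (localPart f c r) x ≤
          ENNReal.ofReal (K * N) * volume (Metric.ball c r) := by
  obtain ⟨L, hL⟩ := exists_lintegral_oscillation_sq_le φ hn hφ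
  refine ⟨1 + L * (4 * (8 * 40 ^ n) ^ 2 * 2 ^ n), by positivity,
    fun t ht hanti f N hf hN0 hN c r hr => ?_⟩
  have hr2 : 0 < 2 * r := by positivity
  have hon := integrableOn_ball_of_locallyIntegrable hf c (2 * r)
  have hint : IntegrableOn (fun z => f z - ⨍ w in Metric.ball c (2 * r), f w)
      (Metric.ball c (2 * r)) := hon.sub (integrableOn_const measure_ball_lt_top.ne)
  have h1 : Integrable (localPart f c r) := hint.integrable_indicator measurableSet_ball
  have hsq : ∫⁻ x, ‖localPart f c r x‖ₑ ^ 2 ≤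
      4 * ENNReal.ofReal (stoppingHeight n N) ^ 2 * volume (Metric.ball c (2 * r)) := by
    refine le_trans (le_of_eq ?_) (lintegral_sub_average_sq_le hf hN0 hN c hr2)
    rw [← lintegral_indicator measurableSet_ball]
    refine lintegral_congr fun x => ?_
    unfold localPart
    by_cases hx : x ∈ Metric.ball c (2 * r) <;> simp [hx]
  have h2 : MemLp (localPart f c r) 2 := by
    refine ⟨h1.aestronglyMeasurable, ?_⟩
    rw [eLpNorm_lt_top_iff_lintegral_rpow_enorm_lt_top (by norm_num) (by norm_num)]
    simp only [ENNReal.toReal_ofNat, ENNReal.rpow_two]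
    refine hsq.trans_lt (ENNReal.mul_lt_top (by finiteness) measure_ball_lt_top)
  have hNne : ENNReal.ofReal N ≠ 0 := (ENNReal.ofReal_pos.2 hN0).ne'
  calc ∫⁻ x in Metric.ball c r, oscillationOp (approxIdentity φ) t (localPart f c r) x
      ≤ ∫⁻ x in Metric.ball c r, (ENNReal.ofReal N + (ENNReal.ofReal N)⁻¹ *
          oscillationOp (approxIdentity φ) t (localPart f c r) x ^ 2) :=
        lintegral_mono fun x => ennreal_le_add_sq_mul_inv _ hN0
    _ = ENNReal.ofReal N * volume (Metric.ball c r) + (ENNReal.ofReal N)⁻¹ *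
          ∫⁻ x in Metric.ball c r,
            oscillationOp (approxIdentity φ) t (localPart f c r) x ^ 2 := by
        rw [lintegral_add_left measurable_const, setLIntegral_const,
          lintegral_const_mul' _ _ (ENNReal.inv_ne_top.2 hNne)]
    _ ≤ ENNReal.ofReal N * volume (Metric.ball c r) + (ENNReal.ofReal N)⁻¹ *
          (L * (4 * ENNReal.ofReal (stoppingHeight n N) ^ 2 *
            (ENNReal.ofReal (2 ^ n) * volume (Metric.ball c r)))) := by
        rw [← volume_ball_dilate c c two_pos]
        gcongr
        exact (setLIntegral_le_lintegral _ _).trans ((hL t ht hanti _ h1 h2).trans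
          (mul_le_mul' le_rfl hsq))
    _ = ENNReal.ofReal ((1 + L * (4 * (8 * 40 ^ n) ^ 2 * 2 ^ n)) * N) *
          volume (Metric.ball c r) := by
        have hheight : 0 ≤ stoppingHeight n N := by
          unfold stoppingHeight
          positivity
        rw [← ENNReal.ofReal_inv_of_pos hN0, ← ENNReal.ofReal_pow hheight,
          ← ENNReal.ofReal_coe_nnreal, show (4 : ℝ≥0∞) = ENNReal.ofReal 4 by simp]
        simp only [← mul_assoc]
        rw [← ENNReal.ofReal_mul (by positivity), ← ENNReal.ofReal_mul (by positivity),
          ← ENNReal.ofReal_mul (by positivity), ← ENNReal.ofReal_mul (by positivity), ← add_mul,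
          ← ENNReal.ofReal_add hN0.le (by positivity)]
        congr 2
        unfold stoppingHeight
        field_simp

end OscillationOnBall

/-! ### Bounded lower oscillation -/

section BoundedLowerOscillation

variable {n : ℕ} (φ : 𝓢(EuclideanSpace ℝ (Fin n), ℝ))

/-- If `g` is bounded below almost everywhere on a ball by `g x - A`, then it exceeds its essential
infimum at `x` by at most `A`. -/
lemma toENNReal_sub_ballEssInf_le {g : EuclideanSpace ℝ (Fin n) → ℝ}
    {c x : EuclideanSpace ℝ (Fin n)} {r A : ℝ}
    (h : ∀ᵐ y ∂volume.restrict (Metric.ball c r), g x ≤ A + g y) :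
    ((g x : EReal) - ballEssInf g c r).toENNReal ≤ ENNReal.ofReal A := by
  have h1 : ((g x - A : ℝ) : EReal) ≤ ballEssInf g c r := by
    refine le_essInf_of_ae_le _ ?_
    filter_upwards [h] with y hy
    exact EReal.coe_le_coe_iff.2 (by linarith)
  have h2 : (g x : EReal) - ballEssInf g c r ≤ (A : EReal) := by
    refine (EReal.sub_le_sub le_rfl h1).trans (le_of_eq ?_)
    rw [← EReal.coe_sub, sub_sub_cancel]
  refine (EReal.toENNReal_le_toENNReal h2).trans (le_of_eq ?_)
  simp

/-- The bounds of the theorem, with an upper bound `N` for the norm of `f`. On a ball `B`, the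
difference `O x - O y` is at most the oscillation of the local part at `x` plus a multiple of `N`,
for all `x, y ∈ B`; hence so is `O x - essinf_B O`, and this bound has mean at most a multiple
of `N`. -/
theorem exists_oscillationOp_bounds (hn : 1 ≤ n) (hφ : ∫ x, φ x = 1) : ∃ K : ℝ, 0 < K ∧
    ∀ t : ℕ → ℝ, (∀ i, 0 < t i) → Antitone t →
      ∀ (f : EuclideanSpace ℝ (Fin n) → ℝ) (N : ℝ), LocallyIntegrable f → 0 < N →
      bmoNorm f ≤ ENNReal.ofReal N →
        (∀ᵐ x, oscillationOp (approxIdentity φ) t f x < ∞) ∧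
        LocallyIntegrable (fun x => (oscillationOp (approxIdentity φ) t f x).toReal) ∧
        bloNorm (fun x => (oscillationOp (approxIdentity φ) t f x).toReal) ≤
          ENNReal.ofReal (K * N) := by
  obtain ⟨K₁, hK₁, hosc⟩ := exists_oscillationOp_le φ
  obtain ⟨K₂, hK₂, hloc⟩ := exists_lintegral_oscillationOp_localPart_le φ hn hφ
  refine ⟨K₁ + K₂, by positivity, fun t ht hanti f N hf hN0 hN => ?_⟩
  have hfP := poissonIntegrable_of_bmoNorm_le hf hN
  set O := oscillationOp (approxIdentity φ) t f with hO
  set S : EuclideanSpace ℝ (Fin n) → ℝ → EuclideanSpace ℝ (Fin n) → ℝ≥0∞ := fun c r =>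
    oscillationOp (approxIdentity φ) (fun i => min (t i) r) (localPart f c r) with hS
  have hOm : Measurable O := measurable_oscillationOp φ hfP ht
  have hSm : ∀ c r, 0 < r → Measurable (S c r) := fun c r hr =>
    measurable_oscillationOp φ (hfP.localPart c r) fun i => lt_min (ht i) hr
  have hSint : ∀ c r, 0 < r → ∫⁻ x in Metric.ball c r, (S c r x + ENNReal.ofReal (K₁ * N)) ≤
      ENNReal.ofReal ((K₁ + K₂) * N) * volume (Metric.ball c r) := by
    intro c r hr
    rw [lintegral_add_left (hSm c r hr), setLIntegral_const, add_comm K₁, add_mul,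
      ENNReal.ofReal_add (by positivity) (by positivity), add_mul]
    gcongr
    exact hloc _ (fun i => lt_min (ht i) hr) (fun i j hij => min_le_min_right r (hanti hij))
      f N hf hN0 hN c r hr
  -- on a ball whose radius is at least all the scales, no comparison with a second point is needed
  have hbig : ∀ R, t 0 ≤ R → ∫⁻ x in Metric.ball 0 R, O x < ∞ := by
    intro R hR
    have hR0 : 0 < R := (ht 0).trans_le hR
    refine lt_of_le_of_lt ?_ ((hSint 0 R hR0).trans_lt
      (ENNReal.mul_lt_top ENNReal.ofReal_lt_top measure_ball_lt_top))
    refine setLIntegral_mono' measurableSet_ball fun x hx => ?_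
    exact (hosc t ht hanti f N hf hN0 hN 0 R hR0 x hx).2 hR
  have hfin : ∀ᵐ x, O x < ∞ := by
    have h1 : ∀ k : ℕ, ∀ᵐ x, x ∈ Metric.ball (0 : EuclideanSpace ℝ (Fin n)) (t 0 + k) →
        O x < ∞ := fun k => by
      rw [← ae_restrict_iff' measurableSet_ball]
      exact ae_lt_top hOm (hbig _ (by simp)).ne
    filter_upwards [ae_all_iff.2 h1] with x hx
    obtain ⟨k, hk⟩ := exists_nat_gt ‖x‖
    refine hx k ?_
    rw [mem_ball_zero_iff]
    linarith [ht 0]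
  refine ⟨hfin, fun x => ?_, ?_⟩
  · refine ⟨Metric.ball 0 (t 0 + (‖x‖ + 1)), Metric.isOpen_ball.mem_nhds ?_, ?_⟩
    · rw [mem_ball_zero_iff]
      linarith [ht 0]
    · exact integrable_toReal_of_lintegral_ne_top hOm.aemeasurable
        (hbig _ (by linarith [norm_nonneg x])).ne
  · refine iSup_le fun c => iSup_le fun r => iSup_le fun hr => ?_
    have hpt : ∀ᵐ x ∂volume.restrict (Metric.ball c r),
        (((O x).toReal : EReal) - ballEssInf (fun x => (O x).toReal) c r).toENNReal ≤
          S c r x + ENNReal.ofReal (K₁ * N) := by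
      filter_upwards [ae_restrict_mem measurableSet_ball] with x hx
      by_cases hSx : S c r x = ∞
      · simp [hSx]
      have hA : S c r x + ENNReal.ofReal (K₁ * N) ≠ ∞ :=
        ENNReal.add_ne_top.2 ⟨hSx, ENNReal.ofReal_ne_top⟩
      rw [← ENNReal.ofReal_toReal hA]
      refine toENNReal_sub_ballEssInf_le (g := fun x => (O x).toReal) ?_
      filter_upwards [ae_restrict_mem measurableSet_ball, ae_restrict_of_ae hfin] with y hy hOy
      rw [← ENNReal.toReal_add hA hOy.ne]
      refine ENNReal.toReal_mono (ENNReal.add_ne_top.2 ⟨hA, hOy.ne⟩) ?_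
      rw [add_right_comm]
      exact (hosc t ht hanti f N hf hN0 hN c r hr x hx).1 y hy
    refine (mul_le_mul' le_rfl ((lintegral_mono_ae hpt).trans (hSint c r hr))).trans
      (le_of_eq ?_)
    rw [mul_left_comm, ENNReal.inv_mul_cancel (volume_ball_ne_zero c hr) measure_ball_lt_top.ne,
      mul_one]

end BoundedLowerOscillation

theorem theorem1 (n : ℕ) (hn : 1 ≤ n)
    (φ : 𝓢(EuclideanSpace ℝ (Fin n), ℝ)) (hφ : ∫ x, φ x = 1) :
    ∃ C : ℝ≥0, 0 < C ∧
      ∀ t : ℕ → ℝ, (∀ i, 0 < t i) → Antitone t → Tendsto t atTop (𝓝 0) →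
      ∀ f : EuclideanSpace ℝ (Fin n) → ℝ, MemBMO f →
        (∀ s : ℝ, 0 < s →
          ConvolutionExists (dilate φ s) f (ContinuousLinearMap.mul ℝ ℝ) volume) ∧
        (∀ᵐ x, oscillationOp (approxIdentity φ) t f x < ∞) ∧
        MemBLO (fun x => (oscillationOp (approxIdentity φ) t f x).toReal) ∧
        bloNorm (fun x => (oscillationOp (approxIdentity φ) t f x).toReal) ≤ C * bmoNorm f := by
  obtain ⟨K, hK, hmain⟩ := exists_oscillationOp_bounds φ hn hφ
  refine ⟨K.toNNReal, Real.toNNReal_pos.2 hK, fun t ht hanti _ f hf => ?_⟩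
  have hN : ∀ ε : ℝ, 0 < ε → bmoNorm f ≤ ENNReal.ofReal ((bmoNorm f).toReal + ε) := by
    intro ε hε
    refine (ENNReal.le_ofReal_iff_toReal_le hf.2.ne (by positivity)).2 (by linarith)
  have h1 := hmain t ht hanti f _ hf.1 (by positivity) (hN 1 one_pos)
  refine ⟨fun s hs => convolutionExists_dilate φ
    (poissonIntegrable_of_bmoNorm_le hf.1 (hN 1 one_pos)) hs, h1.1,
    ⟨h1.2.1, h1.2.2.trans_lt ENNReal.ofReal_lt_top⟩, ?_⟩
  -- the norm of `f` may vanish, so the bound is applied to slightly larger values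
  refine ENNReal.le_of_forall_pos_le_add fun ε hε _ => ?_
  have hε' : 0 < (ε : ℝ) / K := div_pos hε hK
  refine (hmain t ht hanti f _ hf.1 (by positivity) (hN _ hε')).2.2.trans (le_of_eq ?_)
  rw [mul_add, mul_div_cancel₀ _ hK.ne', ENNReal.ofReal_add (by positivity) ε.coe_nonneg,
    ENNReal.ofReal_mul hK.le, ENNReal.ofReal_toReal hf.2.ne, ENNReal.ofReal_coe_nnreal]
  rfl
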